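/- Consider the class of equations $$f(x)u_t=(e^{nu}u_x)_x+h(x)e^{nu},\qquad n f\neq 0,\qquad(*)$$ with arbitrary elements $f,h$ (smooth real functions of $x$ on an open interval) and $n$ (a real constant). A generalized equivalence transformation of $(*)$ is a smooth nondegenerate point transformation of the joint space of $(t,x,u,f,h,n)$, defined on a product of open intervals on which $f$ and $n$ do not vanish (each of its components may depend on all of $t,x,u,f,h,n$), which maps every equation of the class, with arbitrary elements taking values in these intervals, to an equation of the class: after $f(x),h(x),n$ are inserted, it becomes a nondegenerate point transformation of $(t,x,u)$ whose second-order prolongation maps the manifold defined by the equation in the jet space onto that of an equation with arbitrary elements $\tilde f(\tilde x),\tilde h(\tilde x),\tilde n$ (wherever the prolongation is defined). These transformations form the generalized equivalence group of $(*)$; since domains are local, "group" means pseudogroup. Theorem. The generalized equivalence group of class $(*)$ consists of the transformations $$\tilde t=\delta_1t+\delta_2,\quad \tilde x=\varphi(x),\quad \tilde u=\delta_3u+\frac{\delta_3}{2n}\ln|\delta_0^2\varphi_x|,$$ $$\tilde f=\delta_0\delta_1|\varphi_x|^{-3/2}f,\quad \tilde h=\delta_3\varphi_x^{-2}h+\frac{\delta_3}{n}|\varphi_x|^{-3/2}\bigl(|\varphi_x|^{-1/2}\bigr)_{xx},\quad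 \tilde n=\frac n{\delta_3},$$ where $\delta_0,\dots,\delta_3$ are arbitrary constants with $\delta_0>0$, $\delta_1\delta_3\neq0$, and $\varphi=\varphi(x)$ is an arbitrary smooth function with $\varphi_x\neq0$. Here, as $n$ is itself a constant arbitrary element, the $\delta_j$ and $\varphi$ are constants, respectively a function of $x$, for each fixed value of $n$, and they may depend smoothly on $n$ as long as the component $\tilde n=n/\delta_3(n)$ has nonvanishing derivative in $n$. The transformations whose $\delta_j$ and $\varphi$ do not depend on $n$ are themselves closed under composition and inversion, and contain the identity. Moreover, each equation of class $(*)$ is mapped by a transformation of this form (with $n$-independent parameters and $\tilde n=n$) to an equation of the class with $\tilde f=1$; and, for each $x_0$ in its interval, its restriction to some open interval around $x_0$ is mapped by such a transformation to an equation of the class with $\tilde h=0$. -/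

import Mathlib

open Set Filter Topology
open scoped ContDiff

/-- A nonempty open interval of the real line, bounded or not. -/
def IsOpenInterval (s : Set ℝ) : Prop :=
  IsOpen s ∧ s.OrdConnected ∧ s.Nonempty

/-- The joint space of the variables and the arbitrary elements,
with coordinates `(t, x, u, f, h, n)` in this order. -/
abbrev Joint : Type := ℝ × ℝ × ℝ × ℝ × ℝ × ℝ

/-- The equation `f(x) u_t = (e^{nu} u_x)_x + h(x) e^{nu}` belongs to the class, over the set `I`
of values of `x`. -/
def InClass (I : Set ℝ) (f h : ℝ → ℝ) (n : ℝ) : Prop :=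
  n ≠ 0 ∧ ContDiffOn ℝ ∞ f I ∧ ContDiffOn ℝ ∞ h I ∧ ∀ x ∈ I, f x ≠ 0

/-- The function `v = v(t, x)` satisfies `f v_t = (e^{nv} v_x)_x + h e^{nv}` at the point `p`. For a
smooth `v` this says that the second-order jet of `v` at `p` lies on the manifold which the equation
determines in the second-order jet space. -/
noncomputable def SatisfiesAt (f h : ℝ → ℝ) (n : ℝ) (v : ℝ × ℝ → ℝ) (p : ℝ × ℝ) : Prop :=
  f p.2 * deriv (fun s => v (s, p.2)) p.1 =
    deriv (fun y => Real.exp (n * v (p.1, y)) * deriv (fun y' => v (p.1, y')) y) p.2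
      + h p.2 * Real.exp (n * v p)

/-- The transformation `P` of the space of `(t, x, u)` maps the graph of `v` near `p` to the graph of
`w` near the image of `p`, the image of the graph of `v` being nowhere vertical near `p`. -/
def MapsGraphAt (P : ℝ × ℝ × ℝ → ℝ × ℝ × ℝ) (v w : ℝ × ℝ → ℝ) (p : ℝ × ℝ) : Prop :=
  (fderiv ℝ (fun q : ℝ × ℝ => ((P (q.1, q.2, v q)).1, (P (q.1, q.2, v q)).2.1)) p).det ≠ 0 ∧
  ∀ᶠ q in 𝓝 p, w ((P (q.1, q.2, v q)).1, (P (q.1, q.2, v q)).2.1) = (P (q.1, q.2, v q)).2.2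

/-- On the open set `W`, `P` is a nondegenerate point transformation of `(t, x, u)` whose
prolongation to the second-order jets maps the equation with arbitrary elements `f, h, n` to the
equation with arbitrary elements `f', h', n'`. The prolongation of `P` is expressed by the action
on (the jets of) arbitrary smooth functions `v`, which need not be solutions. -/
def ConnectsEquations (W : Set (ℝ × ℝ × ℝ)) (P : ℝ × ℝ × ℝ → ℝ × ℝ × ℝ)
    (f h : ℝ → ℝ) (n : ℝ) (f' h' : ℝ → ℝ) (n' : ℝ) : Prop :=
  ContDiffOn ℝ ∞ P W ∧ (∀ p ∈ W, (fderiv ℝ P p).det ≠ 0) ∧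
  ∀ (t x : ℝ) (v w : ℝ × ℝ → ℝ), (t, x, v (t, x)) ∈ W →
    ContDiffAt ℝ ∞ v (t, x) →
    ContDiffAt ℝ ∞ w ((P (t, x, v (t, x))).1, (P (t, x, v (t, x))).2.1) →
    MapsGraphAt P v w (t, x) →
    (SatisfiesAt f h n v (t, x) ↔
      SatisfiesAt f' h' n' w ((P (t, x, v (t, x))).1, (P (t, x, v (t, x))).2.1))

/-- The transformation of `(t, x, u)` which the transformation `Φ` of the joint space induces
for the equation with arbitrary elements `f, h, n`. -/
def induced (Φ : Joint → Joint) (f h : ℝ → ℝ) (n : ℝ) : ℝ × ℝ × ℝ → ℝ × ℝ × ℝ := fun p =>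
  ((Φ (p.1, p.2.1, p.2.2, f p.2.1, h p.2.1, n)).1,
   (Φ (p.1, p.2.1, p.2.2, f p.2.1, h p.2.1, n)).2.1,
   (Φ (p.1, p.2.1, p.2.2, f p.2.1, h p.2.1, n)).2.2.1)

/-- `Φ` maps the equation of the class with arbitrary elements `f, h, n` to the equation of the
class with arbitrary elements `f', h', n'`; here `(t, x, u)` runs through `W`. -/
def MapsEquation (W : Set (ℝ × ℝ × ℝ)) (Φ : Joint → Joint)
    (f h : ℝ → ℝ) (n : ℝ) (f' h' : ℝ → ℝ) (n' : ℝ) : Prop :=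
  InClass ((fun p => (induced Φ f h n p).2.1) '' W) f' h' n' ∧
  (∀ p ∈ W, (Φ (p.1, p.2.1, p.2.2, f p.2.1, h p.2.1, n)).2.2.2 =
    (f' (induced Φ f h n p).2.1, h' (induced Φ f h n p).2.1, n')) ∧
  ConnectsEquations W (induced Φ f h n) f h n f' h' n'

/-- A (local) domain of the joint space: a box with arbitrary open intervals as sides, on which the
arbitrary elements `f` and `n` do not vanish. -/
structure Box where
  t : Set ℝ
  x : Set ℝ
  u : Set ℝ
  f : Set ℝ
  h : Set ℝ
  n : Set ℝ
  ht : IsOpenInterval t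
  hx : IsOpenInterval x
  hu : IsOpenInterval u
  hf : IsOpenInterval f
  hh : IsOpenInterval h
  hn : IsOpenInterval n
  f_ne : (0 : ℝ) ∉ f
  n_ne : (0 : ℝ) ∉ n

/-- The set of points of a box. -/
def Box.toSet (D : Box) : Set Joint := D.t ×ˢ D.x ×ˢ D.u ×ˢ D.f ×ˢ D.h ×ˢ D.n

/-- `Φ` is, on the domain `D`, a transformation from the generalized equivalence group of the class:
a nondegenerate point transformation of the joint space (all its components may depend on all
of `t, x, u, f, h, n`) which maps every equation of the class to an equation of the class. -/
def IsGeneralizedEquivalence (D : Box) (Φ : Joint → Joint) : Prop :=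
  ContDiffOn ℝ ∞ Φ D.toSet ∧ (∀ z ∈ D.toSet, (fderiv ℝ Φ z).det ≠ 0) ∧
  ∀ (f h : ℝ → ℝ) (n : ℝ), InClass D.x f h n →
    MapsTo f D.x D.f → MapsTo h D.x D.h → n ∈ D.n →
    ∃ (f' h' : ℝ → ℝ) (n' : ℝ), MapsEquation (D.t ×ˢ D.x ×ˢ D.u) Φ f h n f' h' n'

/-- The explicit transformation with the parameters `δ₀, δ₁, δ₂, δ₃` and `φ`. -/
noncomputable def explicitTransf (δ₀ δ₁ δ₂ δ₃ : ℝ) (φ : ℝ → ℝ) : Joint → Joint :=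
  fun ⟨t, x, u, f, h, n⟩ =>
    (δ₁ * t + δ₂,
     φ x,
     δ₃ * u + δ₃ / (2 * n) * Real.log |δ₀ ^ 2 * deriv φ x|,
     δ₀ * δ₁ * |deriv φ x| ^ (-(3 / 2) : ℝ) * f,
     δ₃ * (deriv φ x) ^ (-2 : ℤ) * h
       + δ₃ / n * |deriv φ x| ^ (-(3 / 2) : ℝ)
          * iteratedDeriv 2 (fun y => |deriv φ y| ^ (-(1 / 2) : ℝ)) x,
     n / δ₃)

/-- The conditions on the parameters `δ₀, δ₁, δ₃` and `φ` over the interval `I`. -/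
def AdmissibleParams (I : Set ℝ) (δ₀ δ₁ δ₃ : ℝ) (φ : ℝ → ℝ) : Prop :=
  0 < δ₀ ∧ δ₁ ≠ 0 ∧ δ₃ ≠ 0 ∧ ContDiffOn ℝ ∞ φ I ∧ ∀ x ∈ I, deriv φ x ≠ 0

/-- The part of the joint space over the interval `I`. -/
def jointOver (I : Set ℝ) : Set Joint :=
  {z | z.2.1 ∈ I ∧ z.2.2.2.1 ≠ 0 ∧ z.2.2.2.2.2 ≠ 0}

/-- `Φ` is a member of the explicit family, with constants `δ₀, δ₁, δ₂, δ₃` and a function `φ`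
of `x` on the interval `I`. -/
def IsExplicit (I : Set ℝ) (Φ : Joint → Joint) : Prop :=
  ∃ (δ₀ δ₁ δ₂ δ₃ : ℝ) (φ : ℝ → ℝ), AdmissibleParams I δ₀ δ₁ δ₃ φ ∧
    EqOn Φ (explicitTransf δ₀ δ₁ δ₂ δ₃ φ) (jointOver I)

/-- `Φ` has, on `D`, the explicit form for each fixed value of `n`. The parameters are constant in
`t, x, u, f, h` (respectively, `φ` is a function of `x`) but may depend smoothly on the constant
arbitrary element `n`, in such a way that the component `n ↦ n / δ₃(n)` is nondegenerate. -/
def HasExplicitForm (D : Box) (Φ : Joint → Joint) : Prop :=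
  ∃ (δ₀ δ₁ δ₂ δ₃ : ℝ → ℝ) (φ : ℝ → ℝ → ℝ),
    ContDiffOn ℝ ∞ δ₀ D.n ∧ ContDiffOn ℝ ∞ δ₁ D.n ∧ ContDiffOn ℝ ∞ δ₂ D.n ∧
    ContDiffOn ℝ ∞ δ₃ D.n ∧
    ContDiffOn ℝ ∞ (fun q : ℝ × ℝ => φ q.1 q.2) (D.n ×ˢ D.x) ∧
    (∀ n ∈ D.n, AdmissibleParams D.x (δ₀ n) (δ₁ n) (δ₃ n) (φ n) ∧
      deriv (fun k => k / δ₃ k) n ≠ 0) ∧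
    ∀ z ∈ D.toSet, Φ z = explicitTransf (δ₀ z.2.2.2.2.2) (δ₁ z.2.2.2.2.2) (δ₂ z.2.2.2.2.2)
      (δ₃ z.2.2.2.2.2) (φ z.2.2.2.2.2) z

/-! Fix one equation and the transformation `(T, X, U)` of `(t, x, u)` induced on it, and test it on
quadratic polynomials whose second-order jet lies on the equation. Since `u_tt` does not occur in
the equation, it can be varied alone; the second-order relation along the direction in which `T` is
stationary then gives `D_x T = 0`, so `T` depends on `t` only (`fderiv_time_eq_zero`). Varying
`u_xx` together with `u_t` gives `f' e^{nu} (D_x X)^2 = e^{n'U} T_t f` (`space_relation`). The right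
side is independent of `u_x`, hence `X_u = 0`, and comparing two values of `u` shows `U = (n/n') u +
ψ(t, x)` (`exists_split_form`). Splitting what remains in `u_x` and `e^{nu}`
(`determining_relations`) gives `ξ_t = ψ_t = 0`, `ξ_xx = 2 n' ψ_x ξ_x` and the law for `h`. The
middle relation integrates to `e^{n'ψ} = δ₀ |φ_x|^{1/2}`, and the law for `f` then forces `τ_t` to
be constant (`exists_explicit_form`).

So on every single equation the transformation has the explicit form, but with parameters that could
depend on the functions `f` and `h`. To exclude this, observe that `n/δ₃`, and `δ₁ t + δ₂` at fixed
`t`, are constant along each graph `(x, f(x), h(x))`, and graphs join any two points with distinct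
`x`; so these components depend on `n`, respectively on `t` and `n`, alone. The value of `|φ_x|` at
a point is determined by the values of `Φ` there (`HasRepresentation.abs_deriv_eq`), while the chain
rule expresses `φ_x` through the slopes of `f` and `h`; varying these slopes gives `X_f = X_h = 0`.
Then `δ₀` is constant along graphs too.

The converse is the same jet computation read backwards: the terms with derivatives of `φ_x` cancel
against the Schwarzian term in the new `h`. Closure under composition is the cocycle identity of the
Schwarzian. The gauges amount to `φ_x = |f|^{2/3}`, and to `φ_x = y^{-2}` with `y'' = -n h y`. -/

/-! ### Calculus along curves and the expanded equation. -/

theorem ContinuousLinearMap.det_ne_zero_iff {V : Type*} [NormedAddCommGroup V] [NormedSpace ℝ V]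
    [FiniteDimensional ℝ V] (L : V →L[ℝ] V) : L.det ≠ 0 ↔ ∀ v, L v = 0 → v = 0 := by
  have h := (LinearMap.det_eq_zero_iff_ker_ne_bot (f := (L : V →ₗ[ℝ] V))).not.trans not_not
  rw [LinearMap.ker_eq_bot'] at h
  exact h

/-- The second derivative of a composition with a curve. -/
theorem deriv_deriv_comp_curve {E F : Type*} [NormedAddCommGroup E] [NormedSpace ℝ E]
    [NormedAddCommGroup F] [NormedSpace ℝ F] {G : E → F} {c : ℝ → E} {s : ℝ}
    (hG : ContDiffAt ℝ 2 G (c s)) (hc : ContDiffAt ℝ 2 c s) :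
    deriv (deriv (fun r => G (c r))) s =
      fderiv ℝ (fderiv ℝ G) (c s) (deriv c s) (deriv c s) + fderiv ℝ G (c s) (deriv (deriv c) s) := by
  have h1 : deriv (fun r => G (c r)) =ᶠ[𝓝 s] fun r => fderiv ℝ G (c r) (deriv c r) := by
    have hG' : ∀ᶠ r in 𝓝 s, ContDiffAt ℝ 2 G (c r) :=
      hc.continuousAt.eventually (hG.eventually (by simp))
    filter_upwards [hG', hc.eventually (by simp)] with r h1 h2
    exact fderiv_comp_deriv r (h1.differentiableAt (by simp)) (h2.differentiableAt (by simp))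
  rw [h1.deriv_eq]
  have hfd : ContDiffAt ℝ 1 (fderiv ℝ G) (c s) := hG.fderiv_right (by norm_num)
  have hcd : DifferentiableAt ℝ (deriv c) s := by
    have : ContDiffAt ℝ 1 (fderiv ℝ c) s := hc.fderiv_right (by norm_num)
    have h := (this.differentiableAt (by simp)).hasFDerivAt.hasDerivAt
    exact (h.clm_apply (hasDerivAt_const s (1:ℝ))).differentiableAt
  have hc' := (hc.differentiableAt (by simp)).hasDerivAt
  have h2 := (hfd.differentiableAt (by simp)).hasFDerivAt.comp_hasDerivAt s hc'
  have h3 := h2.clm_apply hcd.hasDerivAt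
  exact h3.deriv

theorem ContDiffAt.deriv_differentiableAt {F : Type*} [NormedAddCommGroup F] [NormedSpace ℝ F]
    {c : ℝ → F} {s : ℝ} (hc : ContDiffAt ℝ 2 c s) : DifferentiableAt ℝ (deriv c) s := by
  have : ContDiffAt ℝ 1 (fderiv ℝ c) s := hc.fderiv_right (by norm_num)
  have h := (this.differentiableAt (by simp)).hasFDerivAt.hasDerivAt
  exact (h.clm_apply (hasDerivAt_const s (1:ℝ))).differentiableAt

theorem ContDiffAt.of_infty {E F : Type*} [NormedAddCommGroup E] [NormedSpace ℝ E]
    [NormedAddCommGroup F] [NormedSpace ℝ F] {G : E → F} {x : E} (h : ContDiffAt ℝ ∞ G x) :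
    ContDiffAt ℝ 2 G x :=
  contDiffAt_infty.1 h 2

theorem satisfiesAt_iff {f h : ℝ → ℝ} {n : ℝ} {v : ℝ × ℝ → ℝ} {t x : ℝ}
    (hv : ContDiffAt ℝ 2 v (t, x)) :
    SatisfiesAt f h n v (t, x) ↔ f x * deriv (fun s => v (s, x)) t =
      Real.exp (n * v (t, x)) * (deriv (deriv fun y => v (t, y)) x
        + n * (deriv (fun y => v (t, y)) x) ^ 2 + h x) := by
  have hs : ContDiffAt ℝ 2 (fun y => v (t, y)) x :=
    ContDiffAt.comp (g := v) (f := fun y => (t, y)) x hv (by fun_prop)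
  have hd := (hs.differentiableAt (by simp)).hasDerivAt
  have hdd := hs.deriv_differentiableAt.hasDerivAt
  have h1 := ((hd.const_mul n).exp.mul hdd).deriv
  have h2 : deriv (fun y => Real.exp (n * v (t, y)) * deriv (fun y' => v (t, y')) y) x = _ := h1
  simp only [SatisfiesAt]
  rw [h2]
  constructor <;> intro hh <;> rw [hh] <;> ring

/-! ### Transport of second-order jets by a point transformation. -/

/-- A point transformation maps the graph of a function to the graph of a function, if the image
of the tangent plane is not vertical. -/
theorem exists_image_graph {v : ℝ × ℝ → ℝ} {P : ℝ × ℝ × ℝ → ℝ × ℝ × ℝ} {p : ℝ × ℝ}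
    (hv : ContDiffAt ℝ ∞ v p) (hP : ContDiffAt ℝ ∞ P (p.1, p.2, v p))
    (hdet : (fderiv ℝ (fun q : ℝ × ℝ =>
      ((P (q.1, q.2, v q)).1, (P (q.1, q.2, v q)).2.1)) p).det ≠ 0) :
    ∃ w : ℝ × ℝ → ℝ,
      ContDiffAt ℝ ∞ w ((P (p.1, p.2, v p)).1, (P (p.1, p.2, v p)).2.1) ∧ MapsGraphAt P v w p := by
  have hPv : ContDiffAt ℝ ∞ (fun q : ℝ × ℝ => P (q.1, q.2, v q)) p :=
    ContDiffAt.comp (f := fun q : ℝ × ℝ => (q.1, q.2, v q)) p hP (by fun_prop)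
  set Q : ℝ × ℝ → ℝ × ℝ := fun q => ((P (q.1, q.2, v q)).1, (P (q.1, q.2, v q)).2.1) with hQ
  have hQs : ContDiffAt ℝ ∞ Q p := by fun_prop
  let e := (fderiv ℝ Q p).toContinuousLinearEquivOfDetNeZero hdet
  have he : HasFDerivAt Q (e : ℝ × ℝ →L[ℝ] ℝ × ℝ) p := by
    have := (hQs.differentiableAt (by simp)).hasFDerivAt
    simpa [e] using this
  have hst := hQs.hasStrictFDerivAt' he (by simp)
  -- The function `w` is the third component of `P` along the graph, composed with the local inverse
  -- of the projected map `Q`.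
  refine ⟨fun r => (P ((hQs.localInverse he (by simp) r).1, (hQs.localInverse he (by simp) r).2,
    v (hQs.localInverse he (by simp) r))).2.2, ?_, hdet, ?_⟩
  · have h1 : ContDiffAt ℝ ∞ (hQs.localInverse he (by simp)) (Q p) :=
      hQs.to_localInverse he (by simp)
    have h2 : hQs.localInverse he (by simp) (Q p) = p := hQs.localInverse_apply_image he (by simp)
    have h3 : ContDiffAt ℝ ∞ (fun q : ℝ × ℝ => (P (q.1, q.2, v q)).2.2)
        (hQs.localInverse he (by simp) (Q p)) := by rw [h2]; fun_prop
    exact ContDiffAt.comp (g := fun q : ℝ × ℝ => (P (q.1, q.2, v q)).2.2) (Q p) h3 h1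
  · have := hst.eventually_left_inverse
    filter_upwards [this] with q hq
    have : hQs.localInverse he (by simp) (Q q) = q := hq
    simp only [hQ] at this
    simp only [this]

/-- A function of `(t, x)` with prescribed jet at `(t₀, x₀)`. -/
noncomputable def jetFun (t₀ x₀ u₀ q p a r : ℝ) : ℝ × ℝ → ℝ := fun z =>
  u₀ + q * (z.1 - t₀) + p * (z.2 - x₀) + a * (z.1 - t₀) ^ 2 / 2 + r * (z.2 - x₀) ^ 2 / 2

theorem contDiff_jetFun (t₀ x₀ u₀ q p a r : ℝ) : ContDiff ℝ ∞ (jetFun t₀ x₀ u₀ q p a r) := by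
  unfold jetFun; fun_prop

@[simp] theorem jetFun_apply (t₀ x₀ u₀ q p a r : ℝ) : jetFun t₀ x₀ u₀ q p a r (t₀, x₀) = u₀ := by
  simp [jetFun]

theorem deriv_quadratic (u b c s₀ s : ℝ) :
    deriv (fun s => u + b * (s - s₀) + c * (s - s₀) ^ 2 / 2) s = b + c * (s - s₀) := by
  have h := (((hasDerivAt_id s).sub_const s₀).const_mul b).const_add u
  have h2 := ((((hasDerivAt_id s).sub_const s₀).pow 2).const_mul c).div_const 2
  have := (h.add h2).deriv
  simp only [id] at this
  refine Eq.trans ?_ (this.trans ?_)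
  · rfl
  · simp; ring

theorem deriv_deriv_quadratic (u b c s₀ s : ℝ) :
    deriv (deriv (fun s => u + b * (s - s₀) + c * (s - s₀) ^ 2 / 2)) s = c := by
  rw [funext (deriv_quadratic u b c s₀)]
  simp

/-- The coefficient `a`, which is `u_tt`, is absent from the condition: it is the free parameter
that later isolates `D_x T`. -/
theorem satisfiesAt_jetFun {f h : ℝ → ℝ} {n t₀ x₀ u₀ q p a r : ℝ} :
    SatisfiesAt f h n (jetFun t₀ x₀ u₀ q p a r) (t₀, x₀) ↔
      f x₀ * q = Real.exp (n * u₀) * (r + n * p ^ 2 + h x₀) := by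
  rw [satisfiesAt_iff (contDiff_jetFun _ _ _ _ _ _ _).contDiffAt.of_infty]
  have h1 : (fun s => jetFun t₀ x₀ u₀ q p a r (s, x₀)) =
      fun s => u₀ + q * (s - t₀) + a * (s - t₀) ^ 2 / 2 := by funext s; simp [jetFun]
  have h2 : (fun s => jetFun t₀ x₀ u₀ q p a r (t₀, s)) =
      fun s => u₀ + p * (s - x₀) + r * (s - x₀) ^ 2 / 2 := by funext s; simp [jetFun]
  rw [h1, h2, deriv_quadratic, deriv_quadratic, deriv_deriv_quadratic]
  simp

/-- First and second order consequences, along the direction `(ξ, η)`, of the fact that the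
graph of `jetFun` is mapped to the graph of `w`. -/
theorem image_graph_jet {T X U : ℝ × ℝ × ℝ → ℝ} {w : ℝ × ℝ → ℝ} {t₀ x₀ u₀ q p a r : ℝ}
    (hT : ContDiffAt ℝ 2 T (t₀, x₀, u₀)) (hX : ContDiffAt ℝ 2 X (t₀, x₀, u₀))
    (hU : ContDiffAt ℝ 2 U (t₀, x₀, u₀))
    (hw : ContDiffAt ℝ 2 w (T (t₀, x₀, u₀), X (t₀, x₀, u₀)))
    (hm : ∀ᶠ z in 𝓝 (t₀, x₀), w (T (z.1, z.2, jetFun t₀ x₀ u₀ q p a r z),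
      X (z.1, z.2, jetFun t₀ x₀ u₀ q p a r z)) = U (z.1, z.2, jetFun t₀ x₀ u₀ q p a r z))
    (ξ η : ℝ) :
    (deriv (fun s => w (s, X (t₀, x₀, u₀))) (T (t₀, x₀, u₀))
        * fderiv ℝ T (t₀, x₀, u₀) (ξ, η, q * ξ + p * η)
      + deriv (fun s => w (T (t₀, x₀, u₀), s)) (X (t₀, x₀, u₀))
        * fderiv ℝ X (t₀, x₀, u₀) (ξ, η, q * ξ + p * η)
      = fderiv ℝ U (t₀, x₀, u₀) (ξ, η, q * ξ + p * η)) ∧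
    (fderiv ℝ T (t₀, x₀, u₀) (ξ, η, q * ξ + p * η) = 0 →
      (fderiv ℝ X (t₀, x₀, u₀) (ξ, η, q * ξ + p * η)) ^ 2 *
        deriv (deriv (fun s => w (T (t₀, x₀, u₀), s))) (X (t₀, x₀, u₀))
      + deriv (fun s => w (s, X (t₀, x₀, u₀))) (T (t₀, x₀, u₀)) *
        (fderiv ℝ (fderiv ℝ T) (t₀, x₀, u₀) (ξ, η, q * ξ + p * η) (ξ, η, q * ξ + p * η)
          + (a * ξ ^ 2 + r * η ^ 2) * fderiv ℝ T (t₀, x₀, u₀) (0, 0, 1))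
      + deriv (fun s => w (T (t₀, x₀, u₀), s)) (X (t₀, x₀, u₀)) *
        (fderiv ℝ (fderiv ℝ X) (t₀, x₀, u₀) (ξ, η, q * ξ + p * η) (ξ, η, q * ξ + p * η)
          + (a * ξ ^ 2 + r * η ^ 2) * fderiv ℝ X (t₀, x₀, u₀) (0, 0, 1))
      = fderiv ℝ (fderiv ℝ U) (t₀, x₀, u₀) (ξ, η, q * ξ + p * η) (ξ, η, q * ξ + p * η)
          + (a * ξ ^ 2 + r * η ^ 2) * fderiv ℝ U (t₀, x₀, u₀) (0, 0, 1)) := by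
  set z₀ : ℝ × ℝ × ℝ := (t₀, x₀, u₀) with hz
  -- The line through `(t₀, x₀)` with direction `(ξ, η)`, lifted to the graph; the form with `s - 0`
  -- is that of `deriv_quadratic`.
  set c : ℝ → ℝ × ℝ × ℝ := fun s => (t₀ + s * ξ, x₀ + s * η,
    u₀ + (q * ξ + p * η) * (s - 0) + (a * ξ ^ 2 + r * η ^ 2) * (s - 0) ^ 2 / 2) with hc
  have hc0 : c 0 = z₀ := by simp [hc, hz]
  have hcs : ContDiff ℝ 2 c := by rw [hc]; fun_prop
  have hc1 : ∀ s, deriv c s = (ξ, η, (q * ξ + p * η) + (a * ξ ^ 2 + r * η ^ 2) * (s - 0)) := by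
    intro s
    have h1 : HasDerivAt (fun s => t₀ + s * ξ) ξ s := by
      simpa using ((hasDerivAt_id s).mul_const ξ).const_add t₀
    have h2 : HasDerivAt (fun s => x₀ + s * η) η s := by
      simpa using ((hasDerivAt_id s).mul_const η).const_add x₀
    have h3 : DifferentiableAt ℝ (fun s => u₀ + (q * ξ + p * η) * (s - 0)
        + (a * ξ ^ 2 + r * η ^ 2) * (s - 0) ^ 2 / 2) s := by fun_prop
    have h3' := h3.hasDerivAt
    rw [deriv_quadratic] at h3'
    exact (h1.prodMk (h2.prodMk h3')).deriv
  have hc1' : deriv c 0 = (ξ, η, q * ξ + p * η) := by rw [hc1]; simp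
  have hc2 : deriv (deriv c) 0 = (0, 0, a * ξ ^ 2 + r * η ^ 2) := by
    rw [funext hc1]
    have h1 : HasDerivAt (fun s => (q * ξ + p * η) + (a * ξ ^ 2 + r * η ^ 2) * (s - 0))
        (a * ξ ^ 2 + r * η ^ 2) 0 := by
      simpa using (((hasDerivAt_id (0:ℝ)).sub_const 0).const_mul
        (a * ξ ^ 2 + r * η ^ 2)).const_add (q * ξ + p * η)
    exact ((hasDerivAt_const (0:ℝ) ξ).prodMk ((hasDerivAt_const (0:ℝ) η).prodMk h1)).deriv
  have hev : (fun s => w (T (c s), X (c s))) =ᶠ[𝓝 0] fun s => U (c s) := by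
    have hcont : Tendsto (fun s : ℝ => (t₀ + s * ξ, x₀ + s * η)) (𝓝 0) (𝓝 (t₀, x₀)) := by
      have : Continuous (fun s : ℝ => (t₀ + s * ξ, x₀ + s * η)) := by fun_prop
      simpa using this.tendsto 0
    filter_upwards [hcont.eventually hm] with s hs
    have hcs' : (t₀ + s * ξ, x₀ + s * η, jetFun t₀ x₀ u₀ q p a r (t₀ + s * ξ, x₀ + s * η)) = c s := by
      simp only [hc, jetFun, Prod.mk.injEq, true_and]; ring
    rw [hcs'] at hs
    exact hs
  have hTc : ContDiffAt ℝ 2 (fun s => T (c s)) 0 :=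
    ContDiffAt.comp (g := T) 0 (by rw [hc0]; exact hT) hcs.contDiffAt
  have hXc : ContDiffAt ℝ 2 (fun s => X (c s)) 0 :=
    ContDiffAt.comp (g := X) 0 (by rw [hc0]; exact hX) hcs.contDiffAt
  have d1 : ∀ {G : ℝ × ℝ × ℝ → ℝ}, ContDiffAt ℝ 2 G z₀ →
      deriv (fun s => G (c s)) 0 = fderiv ℝ G z₀ (ξ, η, q * ξ + p * η) := by
    intro G hG
    have := fderiv_comp_deriv (𝕜 := ℝ) (l := G) (f := c) 0
      (by rw [hc0]; exact hG.differentiableAt (by simp))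
      (hcs.contDiffAt.differentiableAt (by simp))
    rw [hc0, hc1'] at this
    exact this
  have d2 : ∀ {G : ℝ × ℝ × ℝ → ℝ}, ContDiffAt ℝ 2 G z₀ →
      deriv (deriv (fun s => G (c s))) 0 =
        fderiv ℝ (fderiv ℝ G) z₀ (ξ, η, q * ξ + p * η) (ξ, η, q * ξ + p * η)
        + (a * ξ ^ 2 + r * η ^ 2) * fderiv ℝ G z₀ (0, 0, 1) := by
    intro G hG
    rw [deriv_deriv_comp_curve (G := G) (by rw [hc0]; exact hG) hcs.contDiffAt, hc0, hc1', hc2]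
    have : ((0:ℝ), (0:ℝ), a * ξ ^ 2 + r * η ^ 2) = (a * ξ ^ 2 + r * η ^ 2) • ((0:ℝ), (0:ℝ), (1:ℝ)) := by
      simp
    rw [this, map_smul, smul_eq_mul]
  set γ : ℝ → ℝ × ℝ := fun s => (T (c s), X (c s)) with hγ
  have hγ0 : γ 0 = (T z₀, X z₀) := by simp [hγ, hc0]
  have hγs : ContDiffAt ℝ 2 γ 0 := hTc.prodMk hXc
  have dγ : ∀ᶠ s in 𝓝 (0:ℝ), deriv γ s = (deriv (fun s => T (c s)) s, deriv (fun s => X (c s)) s) := by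
    filter_upwards [hTc.eventually (by simp), hXc.eventually (by simp)] with s h1 h2
    exact ((h1.differentiableAt (by simp)).hasDerivAt.prodMk
      (h2.differentiableAt (by simp)).hasDerivAt).deriv
  have ddγ : deriv (deriv γ) 0 =
      (deriv (deriv (fun s => T (c s))) 0, deriv (deriv (fun s => X (c s))) 0) := by
    rw [EventuallyEq.deriv_eq (f₁ := deriv γ) dγ]
    exact (hTc.deriv_differentiableAt.hasDerivAt.prodMk hXc.deriv_differentiableAt.hasDerivAt).deriv
  have hwd := hw.differentiableAt (by simp)
  have wT : deriv (fun s => w (s, X z₀)) (T z₀) = fderiv ℝ w (T z₀, X z₀) (1, 0) := by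
    have h := (hwd.hasFDerivAt.comp_hasDerivAt (T z₀)
      ((hasDerivAt_id (T z₀)).prodMk (hasDerivAt_const (T z₀) (X z₀))))
    exact h.deriv
  have wX : deriv (fun s => w (T z₀, s)) (X z₀) = fderiv ℝ w (T z₀, X z₀) (0, 1) := by
    have h := (hwd.hasFDerivAt.comp_hasDerivAt (X z₀)
      ((hasDerivAt_const (X z₀) (T z₀)).prodMk (hasDerivAt_id (X z₀))))
    exact h.deriv
  have wXX : deriv (deriv (fun s => w (T z₀, s))) (X z₀) =
      fderiv ℝ (fderiv ℝ w) (T z₀, X z₀) (0, 1) (0, 1) := by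
    have hl : deriv (fun s : ℝ => (T z₀, s)) = fun _ => (0, 1) := by
      funext s
      exact ((hasDerivAt_const s (T z₀)).prodMk (hasDerivAt_id s)).deriv
    rw [deriv_deriv_comp_curve (G := w) (c := fun s => (T z₀, s)) hw (by fun_prop), hl]
    simp
  have split : ∀ (α β : ℝ) (L : ℝ × ℝ →L[ℝ] ℝ), L (α, β) = L (1, 0) * α + L (0, 1) * β := by
    intro α β L
    have : (α, β) = α • ((1:ℝ), (0:ℝ)) + β • ((0:ℝ), (1:ℝ)) := by simp
    rw [this, map_add, map_smul, map_smul, smul_eq_mul, smul_eq_mul]; ring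
  constructor
  · have h1 := hev.deriv_eq
    have h2 : deriv (fun s => w (T (c s), X (c s))) 0 = fderiv ℝ w (γ 0) (deriv γ 0) :=
      fderiv_comp_deriv (𝕜 := ℝ) (l := w) (f := γ) 0 (by rw [hγ0]; exact hwd)
        (hγs.differentiableAt (by simp))
    rw [h2, dγ.self_of_nhds, hγ0, split, d1 hT, d1 hX, d1 hU] at h1
    rw [wT, wX, h1]
  -- Where `T` is stationary, the velocity of `γ` is a multiple of `(0, 1)`, so `w_XX` is the only
  -- second derivative of `w` that enters. The derivatives `w_TT` and `w_TX`, which the equation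
  -- does not control, drop out.
  · intro hT0
    have h1 := hev.deriv.deriv_eq
    have h2 : deriv (deriv (fun s => w (T (c s), X (c s)))) 0 = _ :=
      deriv_deriv_comp_curve (G := w) (c := γ) (by rw [hγ0]; exact hw) hγs
    rw [h2, dγ.self_of_nhds, ddγ, hγ0, split _ _ (fderiv ℝ w _), d1 hT, d1 hX, d2 hT, d2 hX, d2 hU,
      hT0] at h1
    rw [← h1, wT, wX, wXX]
    have hB : ∀ (β : ℝ) (B : ℝ × ℝ →L[ℝ] ℝ × ℝ →L[ℝ] ℝ), B (0, β) (0, β) = β ^ 2 * B (0, 1) (0, 1) := by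
      intro β B
      have : ((0:ℝ), β) = β • ((0:ℝ), (1:ℝ)) := by simp
      rw [this]
      simp only [map_smul, _root_.smul_apply, smul_eq_mul]
      ring
    rw [hB (fderiv ℝ X z₀ _)]
    ring

theorem fderiv_jetFun (t₀ x₀ u₀ q p a r : ℝ) :
    HasFDerivAt (jetFun t₀ x₀ u₀ q p a r)
      (q • ContinuousLinearMap.fst ℝ ℝ ℝ + p • ContinuousLinearMap.snd ℝ ℝ ℝ) (t₀, x₀) := by
  have h1 : HasFDerivAt (fun z : ℝ × ℝ => z.1 - t₀) (ContinuousLinearMap.fst ℝ ℝ ℝ) (t₀, x₀) :=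
    hasFDerivAt_fst.sub_const t₀
  have h2 : HasFDerivAt (fun z : ℝ × ℝ => z.2 - x₀) (ContinuousLinearMap.snd ℝ ℝ ℝ) (t₀, x₀) :=
    hasFDerivAt_snd.sub_const x₀
  have h := (((((h1.const_mul q).const_add u₀).add (h2.const_mul p)).add
    (((h1.pow 2).const_mul a).mul_const (1 / 2))).add (((h2.pow 2).const_mul r).mul_const (1 / 2)))
  refine (h.congr_fderiv ?_).congr_of_eventuallyEq (Eventually.of_forall fun z => ?_)
  · ext <;> simp
  · simp only [jetFun, Pi.add_apply]; ring

/-- The quantity in `hJ` is `D_t T · D_x X - D_x T · D_t X` on the given jet. Its nonvanishing means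
that the image of the tangent plane is not vertical, so the image is locally a graph to which the
hypothesis on the equations applies. -/
theorem exists_transformed_jet {W : Set (ℝ × ℝ × ℝ)} {P : ℝ × ℝ × ℝ → ℝ × ℝ × ℝ}
    {f h f' h' : ℝ → ℝ} {n n' t₀ x₀ u₀ : ℝ} (hW : IsOpen W)
    (hC : ConnectsEquations W P f h n f' h' n') (hz : (t₀, x₀, u₀) ∈ W) {q p a r : ℝ}
    (hE : f x₀ * q = Real.exp (n * u₀) * (r + n * p ^ 2 + h x₀))
    (hJ : fderiv ℝ (fun z => (P z).1) (t₀, x₀, u₀) (1, 0, q) *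
        fderiv ℝ (fun z => (P z).2.1) (t₀, x₀, u₀) (0, 1, p)
      - fderiv ℝ (fun z => (P z).1) (t₀, x₀, u₀) (0, 1, p) *
        fderiv ℝ (fun z => (P z).2.1) (t₀, x₀, u₀) (1, 0, q) ≠ 0) :
    ∃ w : ℝ × ℝ → ℝ, ContDiffAt ℝ ∞ w ((P (t₀, x₀, u₀)).1, (P (t₀, x₀, u₀)).2.1) ∧
      (∀ᶠ z in 𝓝 (t₀, x₀), w ((P (z.1, z.2, jetFun t₀ x₀ u₀ q p a r z)).1,
        (P (z.1, z.2, jetFun t₀ x₀ u₀ q p a r z)).2.1) =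
        (P (z.1, z.2, jetFun t₀ x₀ u₀ q p a r z)).2.2) ∧
      SatisfiesAt f' h' n' w ((P (t₀, x₀, u₀)).1, (P (t₀, x₀, u₀)).2.1) := by
  obtain ⟨hP, -, hcon⟩ := hC
  have hPz : ContDiffAt ℝ ∞ P (t₀, x₀, u₀) := hP.contDiffAt (hW.mem_nhds hz)
  set v := jetFun t₀ x₀ u₀ q p a r with hv
  have hvs : ContDiffAt ℝ ∞ v (t₀, x₀) := (contDiff_jetFun _ _ _ _ _ _ _).contDiffAt
  have hv0 : v (t₀, x₀) = u₀ := jetFun_apply ..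
  have hc : HasFDerivAt (fun z : ℝ × ℝ => (z.1, z.2, v z)) _ (t₀, x₀) :=
    hasFDerivAt_fst.prodMk (hasFDerivAt_snd.prodMk (fderiv_jetFun t₀ x₀ u₀ q p a r))
  have hT : DifferentiableAt ℝ (fun z => (P z).1) ((fun z : ℝ × ℝ => (z.1, z.2, v z)) (t₀, x₀)) := by
    simp only [hv0]
    exact (hPz.fst).differentiableAt (by simp)
  have hX : DifferentiableAt ℝ (fun z => (P z).2.1)
      ((fun z : ℝ × ℝ => (z.1, z.2, v z)) (t₀, x₀)) := by
    simp only [hv0]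
    exact (hPz.snd.fst).differentiableAt (by simp)
  have hdet : (fderiv ℝ (fun z : ℝ × ℝ => ((P (z.1, z.2, v z)).1, (P (z.1, z.2, v z)).2.1))
      (t₀, x₀)).det ≠ 0 := by
    rw [ContinuousLinearMap.det_ne_zero_iff]
    rintro ⟨ξ, η⟩ h0
    have h1 := ((hT.hasFDerivAt.comp (t₀, x₀) hc).prodMk (hX.hasFDerivAt.comp (t₀, x₀) hc)).fderiv
    have h2 : fderiv ℝ (fun z : ℝ × ℝ => ((P (z.1, z.2, v z)).1, (P (z.1, z.2, v z)).2.1))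
      (t₀, x₀) = _ := h1
    rw [h2] at h0
    simp only [hv0, ContinuousLinearMap.prod_apply, ContinuousLinearMap.comp_apply,
      _root_.add_apply, _root_.smul_apply, ContinuousLinearMap.coe_fst',
      ContinuousLinearMap.coe_snd', smul_eq_mul, Prod.mk_eq_zero] at h0
    have e : (ξ, η, q * ξ + p * η) = ξ • ((1:ℝ), (0:ℝ), q) + η • ((0:ℝ), (1:ℝ), p) := by
      simp; ring
    rw [e] at h0
    simp only [map_add, map_smul, smul_eq_mul] at h0
    obtain ⟨h3, h4⟩ := h0
    have h5 : ξ = 0 := by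
      apply (mul_eq_zero.1 (?_ : ξ * _ = 0)).resolve_right hJ
      linear_combination (fderiv ℝ (fun z => (P z).2.1) (t₀, x₀, u₀)) (0, 1, p) * h3
        - (fderiv ℝ (fun z => (P z).1) (t₀, x₀, u₀)) (0, 1, p) * h4
    have h6 : η = 0 := by
      apply (mul_eq_zero.1 (?_ : η * _ = 0)).resolve_right hJ
      linear_combination (fderiv ℝ (fun z => (P z).1) (t₀, x₀, u₀)) (1, 0, q) * h4
        - (fderiv ℝ (fun z => (P z).2.1) (t₀, x₀, u₀)) (1, 0, q) * h3
    simp [h5, h6]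
  obtain ⟨w, hw, hm⟩ := exists_image_graph (P := P) hvs (by simpa only [hv0] using hPz) hdet
  simp only [hv0] at hw
  have := hcon t₀ x₀ v w (by rwa [hv0]) hvs (by rwa [hv0]) hm
  rw [hv0] at this
  exact ⟨w, hw, hm.2, this.1 (satisfiesAt_jetFun.2 hE)⟩

/-- The jet relations at a point, for arbitrary jets on the manifold of the equation. -/
theorem exists_jet_relations {W : Set (ℝ × ℝ × ℝ)} {P : ℝ × ℝ × ℝ → ℝ × ℝ × ℝ}
    {f h f' h' : ℝ → ℝ} {n n' t₀ x₀ u₀ : ℝ} (hW : IsOpen W)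
    (hC : ConnectsEquations W P f h n f' h' n') (hz : (t₀, x₀, u₀) ∈ W)
    {T X U : ℝ × ℝ × ℝ → ℝ} (hT : T = fun z => (P z).1) (hX : X = fun z => (P z).2.1)
    (hU : U = fun z => (P z).2.2) {q p : ℝ} (a : ℝ) {r : ℝ}
    (hE : f x₀ * q = Real.exp (n * u₀) * (r + n * p ^ 2 + h x₀))
    (hJ : fderiv ℝ T (t₀, x₀, u₀) (1, 0, q) * fderiv ℝ X (t₀, x₀, u₀) (0, 1, p)
      - fderiv ℝ T (t₀, x₀, u₀) (0, 1, p) * fderiv ℝ X (t₀, x₀, u₀) (1, 0, q) ≠ 0) :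
    ∃ wT wX wXX : ℝ,
      f' (X (t₀, x₀, u₀)) * wT = Real.exp (n' * U (t₀, x₀, u₀)) *
        (wXX + n' * wX ^ 2 + h' (X (t₀, x₀, u₀))) ∧
      ∀ ξ η : ℝ, (wT * fderiv ℝ T (t₀, x₀, u₀) (ξ, η, q * ξ + p * η)
        + wX * fderiv ℝ X (t₀, x₀, u₀) (ξ, η, q * ξ + p * η)
        = fderiv ℝ U (t₀, x₀, u₀) (ξ, η, q * ξ + p * η)) ∧
      (fderiv ℝ T (t₀, x₀, u₀) (ξ, η, q * ξ + p * η) = 0 →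
        (fderiv ℝ X (t₀, x₀, u₀) (ξ, η, q * ξ + p * η)) ^ 2 * wXX
        + wT * (fderiv ℝ (fderiv ℝ T) (t₀, x₀, u₀) (ξ, η, q * ξ + p * η) (ξ, η, q * ξ + p * η)
          + (a * ξ ^ 2 + r * η ^ 2) * fderiv ℝ T (t₀, x₀, u₀) (0, 0, 1))
        + wX * (fderiv ℝ (fderiv ℝ X) (t₀, x₀, u₀) (ξ, η, q * ξ + p * η) (ξ, η, q * ξ + p * η)
          + (a * ξ ^ 2 + r * η ^ 2) * fderiv ℝ X (t₀, x₀, u₀) (0, 0, 1))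
        = fderiv ℝ (fderiv ℝ U) (t₀, x₀, u₀) (ξ, η, q * ξ + p * η) (ξ, η, q * ξ + p * η)
          + (a * ξ ^ 2 + r * η ^ 2) * fderiv ℝ U (t₀, x₀, u₀) (0, 0, 1)) := by
  have hPz : ContDiffAt ℝ ∞ P (t₀, x₀, u₀) := hC.1.contDiffAt (hW.mem_nhds hz)
  subst hT hX hU
  obtain ⟨w, hw, hm, hs⟩ := exists_transformed_jet (a := a) hW hC hz hE hJ
  have hw0 : w ((P (t₀, x₀, u₀)).1, (P (t₀, x₀, u₀)).2.1) = (P (t₀, x₀, u₀)).2.2 := by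
    simpa using hm.self_of_nhds
  rw [satisfiesAt_iff hw.of_infty, hw0] at hs
  exact ⟨_, _, _, hs, fun ξ η => image_graph_jet (hPz.fst).of_infty (hPz.snd.fst).of_infty
    (hPz.snd.snd).of_infty hw.of_infty hm ξ η⟩

/-! ### The new `t` depends on `t` only, the new `x` not on `u`. -/

theorem map_triple (L : ℝ × ℝ × ℝ →L[ℝ] ℝ) (a b c : ℝ) :
    L (a, b, c) = a * L (1, 0, 0) + b * L (0, 1, 0) + c * L (0, 0, 1) := by
  have : (a, b, c) = a • ((1:ℝ), (0:ℝ), (0:ℝ)) + b • ((0:ℝ), (1:ℝ), (0:ℝ)) +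
    c • ((0:ℝ), (0:ℝ), (1:ℝ)) := by simp
  rw [this]
  simp only [map_add, map_smul, smul_eq_mul]

/-- Nondegeneracy as a cofactor expansion in partial derivatives: it is contradicted later by
writing the derivatives of `U` as one linear combination of those of `T` and `X`, or by vanishing
minors. -/
theorem jacobian_ne_zero {P : ℝ × ℝ × ℝ → ℝ × ℝ × ℝ} {z : ℝ × ℝ × ℝ}
    (hP : DifferentiableAt ℝ P z) (hdet : (fderiv ℝ P z).det ≠ 0)
    {T X U : ℝ × ℝ × ℝ → ℝ} (hT : T = fun z => (P z).1) (hX : X = fun z => (P z).2.1)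
    (hU : U = fun z => (P z).2.2) :
    fderiv ℝ T z (1, 0, 0) * (fderiv ℝ X z (0, 1, 0) * fderiv ℝ U z (0, 0, 1)
        - fderiv ℝ X z (0, 0, 1) * fderiv ℝ U z (0, 1, 0))
      - fderiv ℝ T z (0, 1, 0) * (fderiv ℝ X z (1, 0, 0) * fderiv ℝ U z (0, 0, 1)
        - fderiv ℝ X z (0, 0, 1) * fderiv ℝ U z (1, 0, 0))
      + fderiv ℝ T z (0, 0, 1) * (fderiv ℝ X z (1, 0, 0) * fderiv ℝ U z (0, 1, 0)
        - fderiv ℝ X z (0, 1, 0) * fderiv ℝ U z (1, 0, 0)) ≠ 0 := by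
  subst hT hX hU
  have e : fderiv ℝ P z = (fderiv ℝ (fun z => (P z).1) z).prod
      ((fderiv ℝ (fun z => (P z).2.1) z).prod (fderiv ℝ (fun z => (P z).2.2) z)) :=
    (hP.fst.hasFDerivAt.prodMk (hP.snd.fst.hasFDerivAt.prodMk hP.snd.snd.hasFDerivAt)).fderiv
  rw [ContinuousLinearMap.det_ne_zero_iff] at hdet
  intro h0
  let M : Matrix (Fin 3) (Fin 3) ℝ :=
    !![fderiv ℝ (fun z => (P z).1) z (1, 0, 0), fderiv ℝ (fun z => (P z).1) z (0, 1, 0),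
        fderiv ℝ (fun z => (P z).1) z (0, 0, 1);
      fderiv ℝ (fun z => (P z).2.1) z (1, 0, 0), fderiv ℝ (fun z => (P z).2.1) z (0, 1, 0),
        fderiv ℝ (fun z => (P z).2.1) z (0, 0, 1);
      fderiv ℝ (fun z => (P z).2.2) z (1, 0, 0), fderiv ℝ (fun z => (P z).2.2) z (0, 1, 0),
        fderiv ℝ (fun z => (P z).2.2) z (0, 0, 1)]
  have hM : M.det = 0 := by
    rw [Matrix.det_fin_three, ← h0]
    simp [M]
    ring
  obtain ⟨v, hv, hMv⟩ := Matrix.exists_mulVec_eq_zero_iff.2 hM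
  apply hv
  have h1 := congrFun hMv 0
  have h2 := congrFun hMv 1
  have h3 := congrFun hMv 2
  simp only [M, Matrix.mulVec, dotProduct, Fin.sum_univ_three] at h1 h2 h3
  simp at h1 h2 h3
  have := hdet (v 0, v 1, v 2) (by
    rw [e]
    simp only [ContinuousLinearMap.prod_apply, Prod.mk_eq_zero]
    refine ⟨?_, ?_, ?_⟩
    · rw [map_triple]; linarith
    · rw [map_triple]; linarith
    · rw [map_triple]; linarith)
  simp only [Prod.mk_eq_zero] at this
  funext i
  fin_cases i
  · exact this.1
  · exact this.2.1
  · exact this.2.2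

/-- The product of the two polynomials in `q, p` vanishes identically and polynomials have no zero
divisors; five evaluations give the coefficients. It is meant for `a + b p = D_x T` and the total
Jacobian of `(T, X)`, allowing a conclusion from jets with nonvertical image only. -/
theorem eq_zero_of_affine_products {a b A B C : ℝ}
    (h : ∀ q p : ℝ, A + q * B + p * C ≠ 0 → a + b * p = 0)
    (hne : ¬ (A = 0 ∧ B = 0 ∧ C = 0)) : a = 0 ∧ b = 0 := by
  have H : ∀ q p : ℝ, (a + b * p) * (A + q * B + p * C) = 0 := by
    intro q p
    by_cases hq : A + q * B + p * C = 0
    · rw [hq, mul_zero]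
    · rw [h q p hq, zero_mul]
  have h00 := H 0 0
  have h10 := H 1 0
  have h01 := H 0 1
  have h0m := H 0 (-1)
  have h11 := H 1 1
  have e1 : a * A = 0 := by linarith
  have e2 : a * B = 0 := by linarith
  have e3 : b * C = 0 := by linarith
  have e4 : a * C + b * A = 0 := by linarith
  have e5 : b * B = 0 := by linarith
  rw [mul_eq_zero] at e1 e2 e3 e5
  have ha : a = 0 := by
    by_contra ha
    have hA := e1.resolve_left ha
    have hB := e2.resolve_left ha
    rw [hA, mul_zero, add_zero, mul_eq_zero] at e4
    exact hne ⟨hA, hB, e4.resolve_left ha⟩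
  refine ⟨ha, ?_⟩
  by_contra hb
  rw [ha, zero_mul, zero_add, mul_eq_zero] at e4
  exact hne ⟨e4.resolve_left hb, e5.resolve_left hb, e3.resolve_left hb⟩

/-- The new time does not depend on `x` and `u`. -/
theorem fderiv_time_eq_zero {W : Set (ℝ × ℝ × ℝ)} {P : ℝ × ℝ × ℝ → ℝ × ℝ × ℝ}
    {f h f' h' : ℝ → ℝ} {n n' t₀ x₀ u₀ : ℝ} (hW : IsOpen W)
    (hC : ConnectsEquations W P f h n f' h' n') (hz : (t₀, x₀, u₀) ∈ W) :
    fderiv ℝ (fun z => (P z).1) (t₀, x₀, u₀) (0, 1, 0) = 0 ∧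
    fderiv ℝ (fun z => (P z).1) (t₀, x₀, u₀) (0, 0, 1) = 0 := by
  have hPz : ContDiffAt ℝ ∞ P (t₀, x₀, u₀) := hC.1.contDiffAt (hW.mem_nhds hz)
  have hdet := jacobian_ne_zero (hPz.differentiableAt (by simp)) (hC.2.1 _ hz) rfl rfl rfl
  have key := fun q p a r => exists_jet_relations (q := q) (p := p) (r := r) hW hC hz rfl rfl rfl a
  set T : ℝ × ℝ × ℝ → ℝ := fun z => (P z).1
  set X : ℝ × ℝ × ℝ → ℝ := fun z => (P z).2.1
  set U : ℝ × ℝ × ℝ → ℝ := fun z => (P z).2.2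
  set z₀ := (t₀, x₀, u₀)
  set Tt := fderiv ℝ T z₀ (1, 0, 0) with hTt
  set Tx := fderiv ℝ T z₀ (0, 1, 0) with hTx
  set Tu := fderiv ℝ T z₀ (0, 0, 1) with hTu
  set Xt := fderiv ℝ X z₀ (1, 0, 0) with hXt
  set Xx := fderiv ℝ X z₀ (0, 1, 0) with hXx
  set Xu := fderiv ℝ X z₀ (0, 0, 1) with hXu
  set Ut := fderiv ℝ U z₀ (1, 0, 0) with hUt
  set Ux := fderiv ℝ U z₀ (0, 1, 0) with hUx
  set Uu := fderiv ℝ U z₀ (0, 0, 1) with hUu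
  have sT : ∀ a b c, fderiv ℝ T z₀ (a, b, c) = a * Tt + b * Tx + c * Tu := map_triple _
  have sX : ∀ a b c, fderiv ℝ X z₀ (a, b, c) = a * Xt + b * Xx + c * Xu := map_triple _
  have sU : ∀ a b c, fderiv ℝ U z₀ (a, b, c) = a * Ut + b * Ux + c * Uu := map_triple _
  simp only [sT, sX, sU] at key
  clear_value Tt Tx Tu Xt Xx Xu Ut Ux Uu
  apply eq_zero_of_affine_products (A := Tt * Xx - Tx * Xt) (B := Tu * Xx - Tx * Xu)
    (C := Tt * Xu - Tu * Xt)
  swap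
  -- `A`, `B`, `C` are, up to sign, the 2×2 minors of the derivatives of `T` and `X`; were all zero,
  -- the full Jacobian would vanish.
  · rintro ⟨h1, h2, h3⟩
    apply hdet
    linear_combination Uu * h1 - Ut * h2 - Ux * h3
  intro q p hJ
  have hJ' : (1 * Tt + 0 * Tx + q * Tu) * (0 * Xt + 1 * Xx + p * Xu)
      - (0 * Tt + 1 * Tx + p * Tu) * (1 * Xt + 0 * Xx + q * Xu) ≠ 0 := by
    convert hJ using 1; ring
  have hexp := Real.exp_pos (n * u₀)
  have hr : f x₀ * q = Real.exp (n * u₀) *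
      ((f x₀ * q / Real.exp (n * u₀) - n * p ^ 2 - h x₀) + n * p ^ 2 + h x₀) := by
    field_simp; ring
  -- Two jets on the equation that differ in `u_tt` alone. The first-order relations give them the
  -- same image `w_T`, `w_X`, and then the image equation gives the same `w_XX`.
  obtain ⟨wT, wX, wXX, e1, k1⟩ := key q p 0 _ hr hJ'
  obtain ⟨vT, vX, vXX, e2, k2⟩ := key q p 1 _ hr hJ'
  have a1 := (k1 1 0).1
  have a2 := (k1 0 1).1
  have b1 := (k2 1 0).1
  have b2 := (k2 0 1).1
  have hT : vT = wT := by
    apply sub_eq_zero.1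
    apply (mul_eq_zero.1 (?_ : (vT - wT) * _ = 0)).resolve_right hJ'
    linear_combination (Xx + p * Xu) * (b1 - a1) - (Xt + q * Xu) * (b2 - a2)
  have hX : vX = wX := by
    apply sub_eq_zero.1
    apply (mul_eq_zero.1 (?_ : (vX - wX) * _ = 0)).resolve_right hJ'
    linear_combination (Tt + q * Tu) * (b2 - a2) - (Tx + p * Tu) * (b1 - a1)
  subst hT hX
  have hXX : vXX = wXX := by
    rw [e1] at e2
    have := mul_left_cancel₀ (Real.exp_pos _).ne' e2
    linarith
  subst hXX
  -- The direction `(-D_x T, D_t T)` annihilates `T`; the coefficient of `u_tt` in its second-order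
  -- relation is `(D_x T)^2` times `U_u - w_T T_u - w_X X_u`.
  have c1 := (k1 (-(Tx + p * Tu)) (Tt + q * Tu)).2 (by ring)
  have c2 := (k2 (-(Tx + p * Tu)) (Tt + q * Tu)).2 (by ring)
  have hk : (Tx + Tu * p) ^ 2 * (Uu - vT * Tu - vX * Xu) = 0 := by
    linear_combination c1 - c2
  rcases mul_eq_zero.1 hk with h0 | h0
  · exact pow_eq_zero_iff (by norm_num) |>.1 h0
  -- If the other factor vanishes, the differential of `U` is `w_T dT + w_X dX`, against
  -- nondegeneracy.
  · exfalso
    apply hdet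
    have hUt : Ut = vT * Tt + vX * Xt := by linear_combination -a1 - q * h0
    have hUx : Ux = vT * Tx + vX * Xx := by linear_combination -a2 - p * h0
    have hUu : Uu = vT * Tu + vX * Xu := by linear_combination h0
    rw [hUt, hUx, hUu]
    ring

/-- Two jets with the same `u_x` and with `u_xx` equal to `0` and `1` have `u_t` differing by
`e^{nu}/f`. With `κ = U_u - w_X X_u`, the increments of the image jet satisfy `T_t Δw_T = κ
e^{nu}/f`, `(D_x X)^2 Δw_XX = κ` and `f' Δw_T = e^{n'U} Δw_XX`. Since `κ ≠ 0` by nondegeneracy, it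
can be eliminated. -/
theorem space_relation {W : Set (ℝ × ℝ × ℝ)} {P : ℝ × ℝ × ℝ → ℝ × ℝ × ℝ}
    {f h f' h' : ℝ → ℝ} {n n' t₀ x₀ u₀ : ℝ} (hW : IsOpen W)
    (hC : ConnectsEquations W P f h n f' h' n') (hz : (t₀, x₀, u₀) ∈ W) (hf : f x₀ ≠ 0)
    (p : ℝ) (hd : fderiv ℝ (fun z => (P z).2.1) (t₀, x₀, u₀) (0, 1, p) ≠ 0) :
    f' (P (t₀, x₀, u₀)).2.1 * Real.exp (n * u₀) *
        (fderiv ℝ (fun z => (P z).2.1) (t₀, x₀, u₀) (0, 1, p)) ^ 2 =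
      Real.exp (n' * (P (t₀, x₀, u₀)).2.2) *
        (fderiv ℝ (fun z => (P z).1) (t₀, x₀, u₀) (1, 0, 0) * f x₀) := by
  have hPz : ContDiffAt ℝ ∞ P (t₀, x₀, u₀) := hC.1.contDiffAt (hW.mem_nhds hz)
  have hdet := jacobian_ne_zero (hPz.differentiableAt (by simp)) (hC.2.1 _ hz) rfl rfl rfl
  have key := fun q p a r => exists_jet_relations (q := q) (p := p) (r := r) hW hC hz rfl rfl rfl a
  have hT0 : ∀ z ∈ W, fderiv ℝ (fun z => (P z).1) z (0, 1, p) = 0 := by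
    rintro ⟨t, x, u⟩ hz'
    rw [map_triple, (fderiv_time_eq_zero hW hC hz').1, (fderiv_time_eq_zero hW hC hz').2]
    simp
  have hTT : fderiv ℝ (fderiv ℝ (fun z => (P z).1)) (t₀, x₀, u₀) (0, 1, p) (0, 1, p) = 0 := by
    have hfd : ContDiffAt ℝ 1 (fderiv ℝ (fun z => (P z).1)) (t₀, x₀, u₀) :=
      (hPz.fst).of_infty.fderiv_right (by norm_num)
    have h1 := ((hfd.differentiableAt (by simp)).hasFDerivAt.clm_apply
      (hasFDerivAt_const ((0:ℝ), (1:ℝ), p) (t₀, x₀, u₀))).fderiv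
    have h2 : (fun z => fderiv ℝ (fun z => (P z).1) z (0, 1, p)) =ᶠ[𝓝 (t₀, x₀, u₀)] fun _ => 0 := by
      filter_upwards [hW.mem_nhds hz] with z hz' using hT0 z hz'
    rw [h2.fderiv_eq] at h1
    have h3 := congrArg (fun L => L ((0:ℝ), (1:ℝ), p)) h1
    simpa using h3.symm
  obtain ⟨hTx, hTu⟩ := fderiv_time_eq_zero hW hC hz
  set T : ℝ × ℝ × ℝ → ℝ := fun z => (P z).1
  set X : ℝ × ℝ × ℝ → ℝ := fun z => (P z).2.1
  set U : ℝ × ℝ × ℝ → ℝ := fun z => (P z).2.2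
  set z₀ := (t₀, x₀, u₀)
  have sT : ∀ a b c, fderiv ℝ T z₀ (a, b, c) = a * fderiv ℝ T z₀ (1, 0, 0) := fun a b c => by
    rw [map_triple, hTx, hTu]; ring
  set Tt := fderiv ℝ T z₀ (1, 0, 0)
  set Xx := fderiv ℝ X z₀ (0, 1, 0)
  set Xu := fderiv ℝ X z₀ (0, 0, 1)
  set Ux := fderiv ℝ U z₀ (0, 1, 0)
  set Uu := fderiv ℝ U z₀ (0, 0, 1)
  rw [hTx, hTu] at hdet
  have hTt : Tt ≠ 0 := by rintro h0; apply hdet; rw [h0]; ring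
  have sX : fderiv ℝ X z₀ (0, 1, p) = Xx + p * Xu := by rw [map_triple]; ring
  have sU : fderiv ℝ U z₀ (0, 1, p) = Ux + p * Uu := by rw [map_triple]; ring
  have hexp := Real.exp_pos (n * u₀)
  have hE : ∀ r, f x₀ * (Real.exp (n * u₀) * (r + n * p ^ 2 + h x₀) / f x₀) =
      Real.exp (n * u₀) * (r + n * p ^ 2 + h x₀) := fun r => by field_simp
  have hJ : ∀ q, fderiv ℝ T z₀ (1, 0, q) * fderiv ℝ X z₀ (0, 1, p)
      - fderiv ℝ T z₀ (0, 1, p) * fderiv ℝ X z₀ (1, 0, q) ≠ 0 := fun q => by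
    rw [sT, sT 0]
    simpa using ⟨hTt, hd⟩
  obtain ⟨wT, wX, wXX, e1, k1⟩ := key _ p 0 0 (hE 0) (hJ _)
  obtain ⟨vT, vX, vXX, e2, k2⟩ := key _ p 0 1 (hE 1) (hJ _)
  have a1 := (k1 1 0).1
  have b1 := (k2 1 0).1
  have a2 := (k1 0 1).1
  have b2 := (k2 0 1).1
  have c1 := (k1 0 1).2
  have c2 := (k2 0 1).2
  simp only [mul_zero, mul_one, zero_add, add_zero, sT, zero_mul, one_mul, hTT, sX, sU]
    at a1 a2 b1 b2 c1 c2
  rw [map_triple (fderiv ℝ X z₀), map_triple (fderiv ℝ U z₀)] at a1 b1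
  replace c1 := c1 trivial
  replace c2 := c2 trivial
  rw [sX] at hd ⊢
  have hvX : vX = wX := mul_right_cancel₀ hd (b2.trans a2.symm)
  subst hvX
  have hκ : Uu - vX * Xu ≠ 0 := by
    intro h0
    apply hdet
    have hUu : Uu = vX * Xu := by linear_combination h0
    have hUx : Ux = vX * Xx := by linear_combination -a2 - p * h0
    change Tt * (Xx * Uu - Xu * Ux) - 0 * _ + 0 * _ = 0
    rw [hUx, hUu]
    ring
  apply mul_right_cancel₀ hκ
  have d1 : Tt * (vT - wT) * f x₀ = (Uu - vX * Xu) * Real.exp (n * u₀) := by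
    have q1 := hE 0
    have q2 := hE 1
    linear_combination f x₀ * (b1 - a1) + (Uu - vX * Xu) * (q2 - q1)
  have d2 : f' (X z₀) * (vT - wT) = Real.exp (n' * U z₀) * (vXX - wXX) := by
    linear_combination e2 - e1
  have d3 : (Xx + p * Xu) ^ 2 * (vXX - wXX) = Uu - vX * Xu := by
    linear_combination c2 - c1
  change f' (X z₀) * Real.exp (n * u₀) * (Xx + p * Xu) ^ 2 * (Uu - vX * Xu) =
    Real.exp (n' * U z₀) * (Tt * f x₀) * (Uu - vX * Xu)
  linear_combination (-(f' (X z₀)) * (Xx + p * Xu) ^ 2) * d1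
    + (Xx + p * Xu) ^ 2 * Tt * f x₀ * d2 + Real.exp (n' * U z₀) * Tt * f x₀ * d3

/-- The new space variable does not depend on `u`. -/
theorem fderiv_space_eq_zero {W : Set (ℝ × ℝ × ℝ)} {P : ℝ × ℝ × ℝ → ℝ × ℝ × ℝ}
    {f h f' h' : ℝ → ℝ} {n n' t₀ x₀ u₀ : ℝ} (hW : IsOpen W)
    (hC : ConnectsEquations W P f h n f' h' n') (hz : (t₀, x₀, u₀) ∈ W) (hf : f x₀ ≠ 0)
    (hf' : f' (P (t₀, x₀, u₀)).2.1 ≠ 0) :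
    fderiv ℝ (fun z => (P z).2.1) (t₀, x₀, u₀) (0, 0, 1) = 0 := by
  have key := space_relation hW hC hz hf
  have sX : ∀ p, fderiv ℝ (fun z => (P z).2.1) (t₀, x₀, u₀) (0, 1, p) =
      fderiv ℝ (fun z => (P z).2.1) (t₀, x₀, u₀) (0, 1, 0) +
      p * fderiv ℝ (fun z => (P z).2.1) (t₀, x₀, u₀) (0, 0, 1) := fun p => by
    rw [map_triple]; ring
  set Xx := fderiv ℝ (fun z => (P z).2.1) (t₀, x₀, u₀) (0, 1, 0)
  set Xu := fderiv ℝ (fun z => (P z).2.1) (t₀, x₀, u₀) (0, 0, 1)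
  by_contra hne
  -- If `X_u ≠ 0`, then `p` can be chosen to give `D_x X` the values 1 and 2; the left side of the
  -- relation is then multiplied by 4 while the right side stays the same.
  have e1 : fderiv ℝ (fun z => (P z).2.1) (t₀, x₀, u₀) (0, 1, (1 - Xx) / Xu) = 1 := by
    rw [sX]; field_simp; ring
  have e2 : fderiv ℝ (fun z => (P z).2.1) (t₀, x₀, u₀) (0, 1, (2 - Xx) / Xu) = 2 := by
    rw [sX]; field_simp; ring
  have k1 := key ((1 - Xx) / Xu) (by rw [e1]; norm_num)
  have k2 := key ((2 - Xx) / Xu) (by rw [e2]; norm_num)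
  rw [e1] at k1
  rw [e2] at k2
  have : f' (P (t₀, x₀, u₀)).2.1 * Real.exp (n * u₀) = 0 := by linarith
  exact mul_ne_zero hf' (Real.exp_pos _).ne' this

/-! ### Integration over the box: the split form of the transformation. -/

theorem IsOpenInterval.eq_of_deriv_eq_zero {s : Set ℝ} (hs : IsOpenInterval s) {g : ℝ → ℝ}
    (hg : ∀ x ∈ s, HasDerivAt g 0 x) {a b : ℝ} (ha : a ∈ s) (hb : b ∈ s) : g a = g b :=
  hs.1.is_const_of_deriv_eq_zero hs.2.1.isPreconnected
    (fun x hx => (hg x hx).differentiableAt.differentiableWithinAt)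
    (fun x hx => (hg x hx).deriv) ha hb

theorem IsOpenInterval.exists_ne {s : Set ℝ} (hs : IsOpenInterval s) (a : ℝ) :
    ∃ b ∈ s, b ≠ a := by
  obtain ⟨c, hc⟩ := hs.2.2
  by_cases h : c = a
  · subst h
    have : (𝓝[≠] c).NeBot := inferInstance
    obtain ⟨b, hb, hb'⟩ := ((eventually_nhdsWithin_of_eventually_nhds (hs.1.mem_nhds hc)).and
      (self_mem_nhdsWithin : {c}ᶜ ∈ 𝓝[≠] c)).exists
    exact ⟨b, hb, hb'⟩
  · exact ⟨c, hc, h⟩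

theorem hasDerivAt_slice₁ {G : ℝ × ℝ × ℝ → ℝ} {t x u : ℝ} (hG : DifferentiableAt ℝ G (t, x, u)) :
    HasDerivAt (fun s => G (s, x, u)) (fderiv ℝ G (t, x, u) (1, 0, 0)) t :=
  hG.hasFDerivAt.comp_hasDerivAt t
    ((hasDerivAt_id t).prodMk ((hasDerivAt_const t x).prodMk (hasDerivAt_const t u)))

theorem hasDerivAt_slice₂ {G : ℝ × ℝ × ℝ → ℝ} {t x u : ℝ} (hG : DifferentiableAt ℝ G (t, x, u)) :
    HasDerivAt (fun s => G (t, s, u)) (fderiv ℝ G (t, x, u) (0, 1, 0)) x :=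
  hG.hasFDerivAt.comp_hasDerivAt x
    ((hasDerivAt_const x t).prodMk ((hasDerivAt_id x).prodMk (hasDerivAt_const x u)))

theorem hasDerivAt_slice₃ {G : ℝ × ℝ × ℝ → ℝ} {t x u : ℝ} (hG : DifferentiableAt ℝ G (t, x, u)) :
    HasDerivAt (fun s => G (t, x, s)) (fderiv ℝ G (t, x, u) (0, 0, 1)) u :=
  hG.hasFDerivAt.comp_hasDerivAt u
    ((hasDerivAt_const u t).prodMk ((hasDerivAt_const u x).prodMk (hasDerivAt_id u)))

/-- The partial splitting of the transformation. -/
theorem exists_split_form {A B C : Set ℝ} (hA : IsOpenInterval A) (hB : IsOpenInterval B)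
    (hCi : IsOpenInterval C) {P : ℝ × ℝ × ℝ → ℝ × ℝ × ℝ} {f h f' h' : ℝ → ℝ} {n n' : ℝ}
    (hn' : n' ≠ 0)
    (hC : ConnectsEquations (A ×ˢ B ×ˢ C) P f h n f' h' n') (hf : ∀ x ∈ B, f x ≠ 0)
    (hf' : ∀ z ∈ A ×ˢ B ×ˢ C, f' (P z).2.1 ≠ 0) :
    ∃ (τ : ℝ → ℝ) (ξ ψ : ℝ × ℝ → ℝ), ContDiffOn ℝ ∞ τ A ∧ ContDiffOn ℝ ∞ ξ (A ×ˢ B) ∧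
      ContDiffOn ℝ ∞ ψ (A ×ˢ B) ∧
      ∀ t ∈ A, ∀ x ∈ B, deriv τ t ≠ 0 ∧ deriv (fun y => ξ (t, y)) x ≠ 0 ∧
        f' (ξ (t, x)) * deriv (fun y => ξ (t, y)) x ^ 2 =
          Real.exp (n' * ψ (t, x)) * (deriv τ t * f x) ∧
        ∀ u ∈ C, P (t, x, u) = (τ t, ξ (t, x), n / n' * u + ψ (t, x)) ∧
          ∀ q p, fderiv ℝ (fun z => (P z).1) (t, x, u) (1, 0, q) *
              fderiv ℝ (fun z => (P z).2.1) (t, x, u) (0, 1, p)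
            - fderiv ℝ (fun z => (P z).1) (t, x, u) (0, 1, p) *
              fderiv ℝ (fun z => (P z).2.1) (t, x, u) (1, 0, q) ≠ 0 := by
  have hW : IsOpen (A ×ˢ B ×ˢ C) := hA.1.prod (hB.1.prod hCi.1)
  obtain ⟨x₁, hx₁⟩ := hB.2.2
  obtain ⟨u₁, hu₁⟩ := hCi.2.2
  have hP : ∀ z ∈ A ×ˢ B ×ˢ C, ContDiffAt ℝ ∞ P z := fun z hz => hC.1.contDiffAt (hW.mem_nhds hz)
  have hT : ∀ z ∈ A ×ˢ B ×ˢ C, DifferentiableAt ℝ (fun z => (P z).1) z := fun z hz =>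
    (hP z hz).fst.differentiableAt (by simp)
  have hX : ∀ z ∈ A ×ˢ B ×ˢ C, DifferentiableAt ℝ (fun z => (P z).2.1) z := fun z hz =>
    (hP z hz).snd.fst.differentiableAt (by simp)
  have T1 : ∀ t ∈ A, ∀ x ∈ B, ∀ u ∈ C, (P (t, x, u)).1 = (P (t, x₁, u₁)).1 := by
    intro t ht x hx u hu
    have e1 : (P (t, x, u)).1 = (P (t, x₁, u)).1 :=
      hB.eq_of_deriv_eq_zero (g := fun x => (P (t, x, u)).1) (fun y hy => by
        have := hasDerivAt_slice₂ (hT (t, y, u) ⟨ht, hy, hu⟩)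
        rwa [(fderiv_time_eq_zero hW hC ⟨ht, hy, hu⟩).1] at this) hx hx₁
    have e2 : (P (t, x₁, u)).1 = (P (t, x₁, u₁)).1 :=
      hCi.eq_of_deriv_eq_zero (g := fun u => (P (t, x₁, u)).1) (fun y hy => by
        have := hasDerivAt_slice₃ (hT (t, x₁, y) ⟨ht, hx₁, hy⟩)
        rwa [(fderiv_time_eq_zero hW hC ⟨ht, hx₁, hy⟩).2] at this) hu hu₁
    rw [e1, e2]
  have X1 : ∀ t ∈ A, ∀ x ∈ B, ∀ u ∈ C, (P (t, x, u)).2.1 = (P (t, x, u₁)).2.1 := by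
    intro t ht x hx u hu
    exact hCi.eq_of_deriv_eq_zero (g := fun u => (P (t, x, u)).2.1) (fun y hy => by
        have := hasDerivAt_slice₃ (hX (t, x, y) ⟨ht, hx, hy⟩)
        rwa [fderiv_space_eq_zero hW hC ⟨ht, hx, hy⟩ (hf x hx) (hf' _ ⟨ht, hx, hy⟩)] at this)
        hu hu₁
  have dT : ∀ t ∈ A, ∀ x ∈ B, ∀ u ∈ C, fderiv ℝ (fun z => (P z).1) (t, x, u) (1, 0, 0) =
      deriv (fun s => (P (s, x₁, u₁)).1) t := by
    intro t ht x hx u hu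
    rw [← (hasDerivAt_slice₁ (hT (t, x, u) ⟨ht, hx, hu⟩)).deriv]
    apply EventuallyEq.deriv_eq
    filter_upwards [hA.1.mem_nhds ht] with s hs using T1 s hs x hx u hu
  have dX : ∀ t ∈ A, ∀ x ∈ B, ∀ u ∈ C, fderiv ℝ (fun z => (P z).2.1) (t, x, u) (0, 1, 0) =
      deriv (fun y => (P (t, y, u₁)).2.1) x := by
    intro t ht x hx u hu
    rw [← (hasDerivAt_slice₂ (hX (t, x, u) ⟨ht, hx, hu⟩)).deriv]
    apply EventuallyEq.deriv_eq
    filter_upwards [hB.1.mem_nhds hx] with s hs using X1 t ht s hs u hu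
  have nz : ∀ t ∈ A, ∀ x ∈ B, ∀ u ∈ C, deriv (fun s => (P (s, x₁, u₁)).1) t ≠ 0 ∧
      deriv (fun y => (P (t, y, u₁)).2.1) x ≠ 0 := by
    intro t ht x hx u hu
    have hz : (t, x, u) ∈ A ×ˢ B ×ˢ C := ⟨ht, hx, hu⟩
    have hdet := jacobian_ne_zero ((hP _ hz).differentiableAt (by simp)) (hC.2.1 _ hz) rfl rfl rfl
    rw [(fderiv_time_eq_zero hW hC hz).1, (fderiv_time_eq_zero hW hC hz).2,
      fderiv_space_eq_zero hW hC hz (hf x hx) (hf' _ hz), dT t ht x hx u hu, dX t ht x hx u hu]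
      at hdet
    constructor
    · intro h0; apply hdet; rw [h0]; ring
    · intro h0; apply hdet; rw [h0]; ring
  have rel : ∀ t ∈ A, ∀ x ∈ B, ∀ u ∈ C,
      f' (P (t, x, u₁)).2.1 * Real.exp (n * u) * deriv (fun y => (P (t, y, u₁)).2.1) x ^ 2 =
      Real.exp (n' * (P (t, x, u)).2.2) * (deriv (fun s => (P (s, x₁, u₁)).1) t * f x) := by
    intro t ht x hx u hu
    have hz : (t, x, u) ∈ A ×ˢ B ×ˢ C := ⟨ht, hx, hu⟩
    have := space_relation hW hC hz (hf x hx) 0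
      (by rw [dX t ht x hx u hu]; exact (nz t ht x hx u hu).2)
    rwa [dX t ht x hx u hu, dT t ht x hx u hu, X1 t ht x hx u hu] at this
  -- The relation at `u` and at `u₁` involves the same `f'`, `X_x`, `T_t` and `f`, so `n'U - nu` is
  -- independent of `u`.
  have U1 : ∀ t ∈ A, ∀ x ∈ B, ∀ u ∈ C,
      (P (t, x, u)).2.2 = n / n' * u + ((P (t, x, u₁)).2.2 - n / n' * u₁) := by
    intro t ht x hx u hu
    have r1 := rel t ht x hx u hu
    have r2 := rel t ht x hx u₁ hu₁
    have hne : deriv (fun s => (P (s, x₁, u₁)).1) t * f x ≠ 0 :=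
      mul_ne_zero (nz t ht x hx u hu).1 (hf x hx)
    have e : Real.exp (n' * (P (t, x, u)).2.2 + n * u₁) =
        Real.exp (n' * (P (t, x, u₁)).2.2 + n * u) := by
      rw [Real.exp_add, Real.exp_add]
      apply mul_right_cancel₀ hne
      linear_combination Real.exp (n * u) * r2 - Real.exp (n * u₁) * r1
    have e' := Real.exp_injective e
    field_simp
    linarith
  refine ⟨fun t => (P (t, x₁, u₁)).1, fun q => (P (q.1, q.2, u₁)).2.1,
    fun q => (P (q.1, q.2, u₁)).2.2 - n / n' * u₁, ?_, ?_, ?_, ?_⟩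
  · have : ContDiffOn ℝ ∞ (fun t => P (t, x₁, u₁)) A :=
      hC.1.comp (by fun_prop) (fun t ht => ⟨ht, hx₁, hu₁⟩)
    exact this.fst
  · have : ContDiffOn ℝ ∞ (fun q : ℝ × ℝ => P (q.1, q.2, u₁)) (A ×ˢ B) :=
      hC.1.comp (by fun_prop) (fun q hq => ⟨hq.1, hq.2, hu₁⟩)
    exact this.snd.fst
  · have : ContDiffOn ℝ ∞ (fun q : ℝ × ℝ => P (q.1, q.2, u₁)) (A ×ˢ B) :=
      hC.1.comp (by fun_prop) (fun q hq => ⟨hq.1, hq.2, hu₁⟩)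
    exact this.snd.snd.sub contDiffOn_const
  · intro t ht x hx
    obtain ⟨n1, n2⟩ := nz t ht x hx u₁ hu₁
    refine ⟨n1, n2, ?_, ?_⟩
    · have r := rel t ht x hx u₁ hu₁
      have e : n' * (P (t, x, u₁)).2.2 = n' * ((P (t, x, u₁)).2.2 - n / n' * u₁) + n * u₁ := by
        field_simp; ring
      rw [e, Real.exp_add] at r
      apply mul_right_cancel₀ (Real.exp_pos (n * u₁)).ne'
      linear_combination r
    · intro u hu
      have hz : (t, x, u) ∈ A ×ˢ B ×ˢ C := ⟨ht, hx, hu⟩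
      refine ⟨?_, ?_⟩
      · exact Prod.ext (T1 t ht x hx u hu) (Prod.ext (X1 t ht x hx u hu) (U1 t ht x hx u hu))
      -- The total Jacobian reduces to `T_t X_x`, so from here on every jet is an admissible test.
      · intro q p
        have s1 := map_triple (fderiv ℝ (fun z => (P z).1) (t, x, u)) 1 0 q
        have s2 := map_triple (fderiv ℝ (fun z => (P z).1) (t, x, u)) 0 1 p
        have s3 := map_triple (fderiv ℝ (fun z => (P z).2.1) (t, x, u)) 0 1 p
        rw [s1, s2, s3, (fderiv_time_eq_zero hW hC hz).1, (fderiv_time_eq_zero hW hC hz).2,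
          fderiv_space_eq_zero hW hC hz (hf x hx) (hf' _ hz), dT t ht x hx u hu, dX t ht x hx u hu]
        simpa using ⟨n1, n2⟩

/-! ### Determining equations and their solution for a single equation. -/

theorem deriv_deriv_comp {g c : ℝ → ℝ} {s : ℝ}
    (hg : ContDiffAt ℝ 2 g (c s)) (hc : ContDiffAt ℝ 2 c s) :
    deriv (deriv (fun r => g (c r))) s =
      deriv (deriv g) (c s) * deriv c s ^ 2 + deriv g (c s) * deriv (deriv c) s := by
  have h1 : deriv (fun r => g (c r)) =ᶠ[𝓝 s] fun r => deriv g (c r) * deriv c r := by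
    have hg' : ∀ᶠ r in 𝓝 s, ContDiffAt ℝ 2 g (c r) :=
      hc.continuousAt.eventually (hg.eventually (by simp))
    filter_upwards [hg', hc.eventually (by simp)] with r h1 h2
    exact deriv_comp r (h1.differentiableAt (by simp)) (h2.differentiableAt (by simp))
  rw [h1.deriv_eq]
  have h2 := hg.deriv_differentiableAt.hasDerivAt.comp s (hc.differentiableAt (by simp)).hasDerivAt
  have h3 := (h2.mul hc.deriv_differentiableAt.hasDerivAt).deriv
  refine Eq.trans ?_ (h3.trans ?_)
  · rfl
  · simp only [Function.comp]; ring

/-- The transformation of jets by a transformation of split form. -/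
theorem split_form_jet {τ : ℝ → ℝ} {ξ ψ v w : ℝ × ℝ → ℝ} {k t x : ℝ}
    (hτ : ContDiffAt ℝ 2 τ t) (hξ : ContDiffAt ℝ 2 ξ (t, x)) (hψ : ContDiffAt ℝ 2 ψ (t, x))
    (hv : ContDiffAt ℝ 2 v (t, x)) (hw : ContDiffAt ℝ 2 w (τ t, ξ (t, x)))
    (hm : ∀ᶠ q in 𝓝 (t, x), w (τ q.1, ξ q) = k * v q + ψ q) :
    (deriv τ t * deriv (fun s => w (s, ξ (t, x))) (τ t) +
      deriv (fun s => ξ (s, x)) t * deriv (fun y => w (τ t, y)) (ξ (t, x)) =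
      k * deriv (fun s => v (s, x)) t + deriv (fun s => ψ (s, x)) t) ∧
    (deriv (fun y => ξ (t, y)) x * deriv (fun y => w (τ t, y)) (ξ (t, x)) =
      k * deriv (fun y => v (t, y)) x + deriv (fun y => ψ (t, y)) x) ∧
    (deriv (fun y => ξ (t, y)) x ^ 2 * deriv (deriv fun y => w (τ t, y)) (ξ (t, x)) +
      deriv (deriv fun y => ξ (t, y)) x * deriv (fun y => w (τ t, y)) (ξ (t, x)) =
      k * deriv (deriv fun y => v (t, y)) x + deriv (deriv fun y => ψ (t, y)) x) := by
  have sl : ∀ {g : ℝ × ℝ → ℝ} {a b : ℝ}, ContDiffAt ℝ 2 g (a, b) →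
      ContDiffAt ℝ 2 (fun y => g (a, y)) b := fun {g a b} hg =>
    ContDiffAt.comp (g := g) (f := fun y => (a, y)) b hg (by fun_prop)
  have sl' : ∀ {g : ℝ × ℝ → ℝ} {a b : ℝ}, ContDiffAt ℝ 2 g (a, b) →
      ContDiffAt ℝ 2 (fun s => g (s, b)) a := fun {g a b} hg =>
    ContDiffAt.comp (g := g) (f := fun s => (s, b)) a hg (by fun_prop)
  have hx : (fun y => w (τ t, ξ (t, y))) =ᶠ[𝓝 x] fun y => k * v (t, y) + ψ (t, y) := by
    have : Tendsto (fun y : ℝ => (t, y)) (𝓝 x) (𝓝 (t, x)) :=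
      (by fun_prop : Continuous fun y : ℝ => (t, y)).tendsto x
    exact this.eventually hm
  have ht : (fun s => w (τ s, ξ (s, x))) =ᶠ[𝓝 t] fun s => k * v (s, x) + ψ (s, x) := by
    have : Tendsto (fun s : ℝ => (s, x)) (𝓝 t) (𝓝 (t, x)) :=
      (by fun_prop : Continuous fun s : ℝ => (s, x)).tendsto t
    exact this.eventually hm
  have dd : ∀ᶠ y in 𝓝 x, deriv (fun y => k * v (t, y) + ψ (t, y)) y =
      k * deriv (fun y => v (t, y)) y + deriv (fun y => ψ (t, y)) y := by
    filter_upwards [(sl hv).eventually (by simp), (sl hψ).eventually (by simp)] with y h1 h2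
    exact (((h1.differentiableAt (by simp)).hasDerivAt.const_mul k).add
      (h2.differentiableAt (by simp)).hasDerivAt).deriv
  refine ⟨?_, ?_, ?_⟩
  · have hwd := (hw.differentiableAt (by simp)).hasFDerivAt
    have h1 := (hwd.comp_hasDerivAt t ((hτ.differentiableAt (by simp)).hasDerivAt.prodMk
      ((sl' hξ).differentiableAt (by simp)).hasDerivAt)).deriv
    have h2 := ((((sl' hv).differentiableAt (by simp)).hasDerivAt.const_mul k).add
      ((sl' hψ).differentiableAt (by simp)).hasDerivAt).deriv
    have h3 := ht.deriv_eq
    have wT : deriv (fun s => w (s, ξ (t, x))) (τ t) = fderiv ℝ w (τ t, ξ (t, x)) (1, 0) :=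
      (hwd.comp_hasDerivAt (τ t)
        ((hasDerivAt_id (τ t)).prodMk (hasDerivAt_const (τ t) (ξ (t, x))))).deriv
    have wX : deriv (fun s => w (τ t, s)) (ξ (t, x)) = fderiv ℝ w (τ t, ξ (t, x)) (0, 1) :=
      (hwd.comp_hasDerivAt (ξ (t, x))
        ((hasDerivAt_const (ξ (t, x)) (τ t)).prodMk (hasDerivAt_id (ξ (t, x))))).deriv
    have h4 : fderiv ℝ w (τ t, ξ (t, x)) (deriv τ t, deriv (fun s => ξ (s, x)) t) =
        k * deriv (fun s => v (s, x)) t + deriv (fun s => ψ (s, x)) t :=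
      h1.symm.trans (h3.trans h2)
    have h5 : (deriv τ t, deriv (fun s => ξ (s, x)) t) =
      deriv τ t • ((1:ℝ), (0:ℝ)) + deriv (fun s => ξ (s, x)) t • ((0:ℝ), (1:ℝ)) := by simp
    rw [h5, map_add, map_smul, map_smul, smul_eq_mul, smul_eq_mul] at h4
    rw [wT, wX, h4]
  · have h1 : deriv (fun y => w (τ t, ξ (t, y))) x = _ :=
      deriv_comp (h₂ := fun y => w (τ t, y)) (h := fun y => ξ (t, y)) x
      ((sl hw).differentiableAt (by simp)) ((sl hξ).differentiableAt (by simp))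
    have h3 := hx.deriv_eq
    rw [h1, dd.self_of_nhds] at h3
    rw [← h3, mul_comm]
  · have h1 : deriv (deriv (fun y => w (τ t, ξ (t, y)))) x = _ :=
      deriv_deriv_comp (g := fun y => w (τ t, y)) (c := fun y => ξ (t, y)) (sl hw) (sl hξ)
    have h3 := hx.deriv.deriv_eq
    rw [h1, EventuallyEq.deriv_eq (f₁ := deriv fun y => k * v (t, y) + ψ (t, y)) dd] at h3
    have h2 := (((sl hv).deriv_differentiableAt.hasDerivAt.const_mul k).add
      (sl hψ).deriv_differentiableAt.hasDerivAt).deriv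
    have h4 := h3.trans h2
    linear_combination h4

/-- On test jets with `u_xx = 0`, eliminating the image jet leaves an identity polynomial in `p =
u_x` and affine in `e^{nu}`. Its `p^2` terms agree automatically; the coefficients of `p` and `1`,
each split with respect to `1` and `e^{nu}`, give the four relations. -/
theorem determining_relations {A B C : Set ℝ} (hA : IsOpenInterval A) (hB : IsOpenInterval B)
    (hCi : IsOpenInterval C) {P : ℝ × ℝ × ℝ → ℝ × ℝ × ℝ} {f h f' h' : ℝ → ℝ} {n n' : ℝ}
    (hn : n ≠ 0) (hn' : n' ≠ 0)
    (hC : ConnectsEquations (A ×ˢ B ×ˢ C) P f h n f' h' n') (hf : ∀ x ∈ B, f x ≠ 0)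
    {τ : ℝ → ℝ} {ξ ψ : ℝ × ℝ → ℝ} (hτ : ContDiffOn ℝ ∞ τ A) (hξ : ContDiffOn ℝ ∞ ξ (A ×ˢ B))
    (hψ : ContDiffOn ℝ ∞ ψ (A ×ˢ B))
    (hform : ∀ t ∈ A, ∀ x ∈ B, deriv τ t ≠ 0 ∧ deriv (fun y => ξ (t, y)) x ≠ 0 ∧
        f' (ξ (t, x)) * deriv (fun y => ξ (t, y)) x ^ 2 =
          Real.exp (n' * ψ (t, x)) * (deriv τ t * f x) ∧
        ∀ u ∈ C, P (t, x, u) = (τ t, ξ (t, x), n / n' * u + ψ (t, x)) ∧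
          ∀ q p, fderiv ℝ (fun z => (P z).1) (t, x, u) (1, 0, q) *
              fderiv ℝ (fun z => (P z).2.1) (t, x, u) (0, 1, p)
            - fderiv ℝ (fun z => (P z).1) (t, x, u) (0, 1, p) *
              fderiv ℝ (fun z => (P z).2.1) (t, x, u) (1, 0, q) ≠ 0)
    {t x : ℝ} (ht : t ∈ A) (hx : x ∈ B) :
    deriv (fun s => ξ (s, x)) t = 0 ∧ deriv (fun s => ψ (s, x)) t = 0 ∧
    deriv (deriv fun y => ξ (t, y)) x =
      2 * n' * deriv (fun y => ψ (t, y)) x * deriv (fun y => ξ (t, y)) x ∧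
    n / n' * h x = deriv (deriv fun y => ψ (t, y)) x - n' * deriv (fun y => ψ (t, y)) x ^ 2
      + deriv (fun y => ξ (t, y)) x ^ 2 * h' (ξ (t, x)) := by
  have hW : IsOpen (A ×ˢ B ×ˢ C) := hA.1.prod (hB.1.prod hCi.1)
  have hAB : (A ×ˢ B) ∈ 𝓝 (t, x) := (hA.1.prod hB.1).mem_nhds ⟨ht, hx⟩
  obtain ⟨dτ, dξ, hrel, hP⟩ := hform t ht x hx
  have key : ∀ u ∈ C, ∀ p : ℝ, ∃ wX : ℝ, deriv (fun y => ξ (t, y)) x * wX =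
        n / n' * p + deriv (fun y => ψ (t, y)) x ∧
      f x * deriv (fun s => ψ (s, x)) t + n / n' * Real.exp (n * u) * (n * p ^ 2 + h x)
        - f x * deriv (fun s => ξ (s, x)) t * wX =
      Real.exp (n * u) * (deriv (deriv fun y => ψ (t, y)) x
        - deriv (deriv fun y => ξ (t, y)) x * wX
        + n' * (n / n' * p + deriv (fun y => ψ (t, y)) x) ^ 2
        + deriv (fun y => ξ (t, y)) x ^ 2 * h' (ξ (t, x))) := by
    intro u hu p
    have hfx := hf x hx
    obtain ⟨hPu, hJ⟩ := hP u hu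
    obtain ⟨w, hw, hm, hs⟩ := exists_transformed_jet (a := 0) (r := 0) (p := p)
      (q := Real.exp (n * u) * (0 + n * p ^ 2 + h x) / f x) hW hC ⟨ht, hx, hu⟩
      (by field_simp) (hJ _ _)
    set q := Real.exp (n * u) * (0 + n * p ^ 2 + h x) / f x with hq
    have hqf : f x * q = Real.exp (n * u) * (n * p ^ 2 + h x) := by rw [hq]; field_simp; ring
    set v := jetFun t x u q p 0 0 with hv
    have hvs : ContDiff ℝ ∞ v := contDiff_jetFun ..
    have hv0 : v (t, x) = u := jetFun_apply ..
    simp only [hPu] at hw hs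
    have hm' : ∀ᶠ r in 𝓝 (t, x), w (τ r.1, ξ r) = n / n' * v r + ψ r := by
      have hvC : ∀ᶠ r in 𝓝 (t, x), v r ∈ C :=
        hvs.continuous.continuousAt.eventually (hCi.1.mem_nhds (by rw [hv0]; exact hu))
      filter_upwards [hm, hAB, hvC] with r hr hr1 hr2
      rw [((hform r.1 hr1.1 r.2 hr1.2).2.2.2 _ hr2).1] at hr
      exact hr
    obtain ⟨r1, r2, r3⟩ := split_form_jet (hτ.contDiffAt (hA.1.mem_nhds ht)).of_infty
      (hξ.contDiffAt hAB).of_infty (hψ.contDiffAt hAB).of_infty hvs.contDiffAt.of_infty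
      hw.of_infty hm'
    have h1 : (fun s => v (s, x)) = fun s => u + q * (s - t) + 0 * (s - t) ^ 2 / 2 := by
      funext s; simp [hv, jetFun]
    have h2 : (fun s => v (t, s)) = fun s => u + p * (s - x) + 0 * (s - x) ^ 2 / 2 := by
      funext s; simp [hv, jetFun]
    rw [h1, deriv_quadratic] at r1
    rw [h2, deriv_quadratic] at r2
    rw [h2, deriv_deriv_quadratic] at r3
    have hw0 : w (τ t, ξ (t, x)) = n / n' * u + ψ (t, x) := by
      have := hm'.self_of_nhds
      rw [hv0] at this
      exact this
    rw [satisfiesAt_iff hw.of_infty, hw0] at hs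
    refine ⟨deriv (fun y => w (τ t, y)) (ξ (t, x)), by linear_combination r2, ?_⟩
    -- The slope `n/n'` is what makes the image exponential a multiple of `e^{nu}`.
    have he : Real.exp (n' * (n / n' * u + ψ (t, x))) =
        Real.exp (n * u) * Real.exp (n' * ψ (t, x)) := by
      rw [← Real.exp_add]; congr 1; field_simp
    rw [he] at hs
    set E := Real.exp (n * u)
    set F := Real.exp (n' * ψ (t, x)) with hF
    have hF0 : F ≠ 0 := (Real.exp_pos _).ne'
    set wX := deriv (fun y => w (τ t, y)) (ξ (t, x))
    set wT := deriv (fun s => w (s, ξ (t, x))) (τ t)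
    set wXX := deriv (deriv fun y => w (τ t, y)) (ξ (t, x))
    have main : f x * (deriv τ t * wT) = E * deriv (fun y => ξ (t, y)) x ^ 2 *
        (wXX + n' * wX ^ 2 + h' (ξ (t, x))) := by
      apply mul_left_cancel₀ hF0
      linear_combination (-wT) * hrel + deriv (fun y => ξ (t, y)) x ^ 2 * hs
    have r2' : n / n' * p + deriv (fun y => ψ (t, y)) x = deriv (fun y => ξ (t, y)) x * wX := by
      linear_combination -r2
    rw [r2']
    linear_combination main - f x * r1 + n / n' * (-hqf) + E * r3
  set Ξx := deriv (fun y => ξ (t, y)) x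
  set Ξt := deriv (fun s => ξ (s, x)) t
  set Ξxx := deriv (deriv fun y => ξ (t, y)) x
  set Ψx := deriv (fun y => ψ (t, y)) x
  set Ψt := deriv (fun s => ψ (s, x)) t
  set Ψxx := deriv (deriv fun y => ψ (t, y)) x
  have hk : n / n' ≠ 0 := div_ne_zero hn hn'
  have eqs : ∀ u ∈ C, f x * Ξt = Real.exp (n * u) * (Ξxx - 2 * n' * Ψx * Ξx) ∧
      Ξx * (f x * Ψt + n / n' * Real.exp (n * u) * h x) - f x * Ξt * Ψx =
        Real.exp (n * u) * (Ξx * (Ψxx + n' * Ψx ^ 2 + Ξx ^ 2 * h' (ξ (t, x))) - Ξxx * Ψx) := by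
    intro u hu
    obtain ⟨w0, a0, b0⟩ := key u hu 0
    obtain ⟨w1, a1, b1⟩ := key u hu 1
    obtain ⟨w2, a2, b2⟩ := key u hu (-1)
    refine ⟨?_, ?_⟩
    -- The difference of the values at `p = 1` and `p = -1` isolates the coefficient of `p`; the
    -- next relation is the value at `p = 0`.
    · apply mul_left_cancel₀ (mul_ne_zero two_ne_zero hk)
      linear_combination (-Ξx) * (b1 - b2) + (Real.exp (n * u) * Ξxx - f x * Ξt) * (a1 - a2)
    · linear_combination Ξx * b0 + (f x * Ξt - Real.exp (n * u) * Ξxx) * a0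
  obtain ⟨u₁, hu₁⟩ := hCi.2.2
  obtain ⟨u₂, hu₂, hne⟩ := hCi.exists_ne u₁
  -- As `n ≠ 0`, two values of `u` give two values of `e^{nu}`, which separates the coefficients of
  -- `1` and `e^{nu}`.
  have hE : Real.exp (n * u₁) - Real.exp (n * u₂) ≠ 0 := by
    rw [sub_ne_zero]
    intro h0
    exact hne (mul_left_cancel₀ hn (Real.exp_injective h0)).symm
  obtain ⟨a1, b1⟩ := eqs u₁ hu₁
  obtain ⟨a2, b2⟩ := eqs u₂ hu₂
  have c1 : Ξxx - 2 * n' * Ψx * Ξx = 0 := by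
    apply mul_left_cancel₀ hE
    linear_combination a2 - a1
  have c2 : Ξt = 0 := by
    rw [c1, mul_zero] at a1
    exact (mul_eq_zero.1 a1).resolve_left (hf x hx)
  have c3 : Ξx * (Ψxx + n' * Ψx ^ 2 + Ξx ^ 2 * h' (ξ (t, x)) - n / n' * h x) - Ξxx * Ψx = 0 := by
    apply mul_left_cancel₀ hE
    linear_combination b2 - b1
  have c4 : Ψt = 0 := by
    have : (Ξx * f x) * Ψt = 0 := by
      rw [c2] at b1
      linear_combination b1 + Real.exp (n * u₁) * c3
    exact (mul_eq_zero.1 this).resolve_left (mul_ne_zero dξ (hf x hx))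
  refine ⟨c2, c4, by linear_combination c1, ?_⟩
  apply mul_left_cancel₀ dξ
  linear_combination -c3 - Ψx * c1

theorem rpow_abs_eq_exp {s : ℝ} (hs : s ≠ 0) (a : ℝ) : |s| ^ a = Real.exp (a * Real.log s) := by
  rw [Real.rpow_def_of_pos (abs_pos.2 hs), Real.log_abs, mul_comm]

theorem ContDiffOn.deriv_smooth {I : Set ℝ} (hI : IsOpen I) {φ : ℝ → ℝ} (h : ContDiffOn ℝ ∞ φ I) :
    ContDiffOn ℝ ∞ (deriv φ) I := h.deriv_of_isOpen hI (by simp)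

theorem ContDiffOn.hasDerivAt' {I : Set ℝ} (hI : IsOpen I) {φ : ℝ → ℝ} (h : ContDiffOn ℝ ∞ φ I)
    {x : ℝ} (hx : x ∈ I) : HasDerivAt φ (deriv φ x) x :=
  ((h.contDiffAt (hI.mem_nhds hx)).differentiableAt (by simp)).hasDerivAt

/-- The right side is `-1/2` times the Schwarzian derivative of `φ`, divided by `φ_x^2`. Powers of
`|φ_x|` are written as `exp (a * log φ_x)`; as `Real.log` ignores the sign, no case distinction is
needed. -/
theorem potential_term_eq {I : Set ℝ} (hI : IsOpen I) {φ : ℝ → ℝ} (hφ : ContDiffOn ℝ ∞ φ I)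
    (hd : ∀ x ∈ I, deriv φ x ≠ 0) {x : ℝ} (hx : x ∈ I) :
    |deriv φ x| ^ (-(3 / 2) : ℝ) * iteratedDeriv 2 (fun y => |deriv φ y| ^ (-(1 / 2) : ℝ)) x =
      (3 / 4 * deriv (deriv φ) x ^ 2 / deriv φ x ^ 2
        - 1 / 2 * deriv (deriv (deriv φ)) x / deriv φ x) / deriv φ x ^ 2 := by
  have h1 := hφ.deriv_smooth hI
  have h2 := h1.deriv_smooth hI
  have hg : ∀ y ∈ I, HasDerivAt (fun y => |deriv φ y| ^ (-(1 / 2) : ℝ))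
      (Real.exp (-(1 / 2) * Real.log (deriv φ y)) *
        (-(1 / 2) * (deriv (deriv φ) y / deriv φ y))) y := by
    intro y hy
    have := (((h1.hasDerivAt' hI hy).log (hd y hy)).const_mul (-(1 / 2))).exp
    refine this.congr_of_eventuallyEq ?_
    filter_upwards [hI.mem_nhds hy] with z hz using rpow_abs_eq_exp (hd z hz) _
  have hg' : deriv (fun y => |deriv φ y| ^ (-(1 / 2) : ℝ)) =ᶠ[𝓝 x] fun y =>
      Real.exp (-(1 / 2) * Real.log (deriv φ y)) *
        (-(1 / 2) * (deriv (deriv φ) y / deriv φ y)) := by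
    filter_upwards [hI.mem_nhds hx] with z hz using (hg z hz).deriv
  have hx0 := hd x hx
  have e1 := (((h1.hasDerivAt' hI hx).log hx0).const_mul (-(1 / 2))).exp
  have e2 := ((h2.hasDerivAt' hI hx).div (h1.hasDerivAt' hI hx) hx0).const_mul (-(1 / 2))
  have e3 := (e1.mul e2).deriv
  rw [iteratedDeriv_succ, iteratedDeriv_one, hg'.deriv_eq.trans e3, rpow_abs_eq_exp hx0]
  have hexp : Real.exp (-(3 / 2) * Real.log (deriv φ x)) *
      Real.exp (-(1 / 2) * Real.log (deriv φ x)) = 1 / deriv φ x ^ 2 := by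
    rw [← Real.exp_add, ← sq_abs, ← Real.log_abs,
      show -(3 / 2) * Real.log |deriv φ x| + -(1 / 2) * Real.log |deriv φ x| =
        -(Real.log |deriv φ x| + Real.log |deriv φ x|) by ring, Real.exp_neg, Real.exp_add,
        Real.exp_log (abs_pos.2 hx0)]
    field_simp
  simp only [Pi.div_apply]
  field_simp at hexp ⊢
  rw [← Real.log_abs] at hexp ⊢
  linear_combination
    4 * (3 * deriv (deriv φ) x ^ 2 - 2 * deriv φ x * deriv (deriv (deriv φ)) x) * hexp

theorem rpow_abs_neg_three_halves {s : ℝ} (hs : s ≠ 0) :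
    |s| ^ (-(3 / 2) : ℝ) * s ^ 2 = Real.exp (1 / 2 * Real.log |s|) := by
  rw [rpow_abs_eq_exp hs, ← sq_abs, ← Real.log_abs]
  have h : |s| = Real.exp (Real.log |s|) := (Real.exp_log (abs_pos.2 hs)).symm
  conv_lhs => rw [h, Real.log_exp]
  rw [← Real.exp_nat_mul, ← Real.exp_add]
  congr 1
  push_cast
  ring

/-- The form of a point transformation connecting two equations of the class. -/
theorem exists_explicit_form {A B C : Set ℝ} (hA : IsOpenInterval A) (hB : IsOpenInterval B)
    (hCi : IsOpenInterval C) {P : ℝ × ℝ × ℝ → ℝ × ℝ × ℝ} {f h f' h' : ℝ → ℝ} {n n' : ℝ}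
    (hn : n ≠ 0) (hn' : n' ≠ 0)
    (hC : ConnectsEquations (A ×ˢ B ×ˢ C) P f h n f' h' n') (hf : ∀ x ∈ B, f x ≠ 0)
    (hf' : ∀ z ∈ A ×ˢ B ×ˢ C, f' (P z).2.1 ≠ 0) :
    ∃ (δ₀ δ₁ δ₂ δ₃ : ℝ) (φ : ℝ → ℝ), AdmissibleParams B δ₀ δ₁ δ₃ φ ∧
      ∀ t ∈ A, ∀ x ∈ B, ∀ u ∈ C,
        ((P (t, x, u)).1, (P (t, x, u)).2.1, (P (t, x, u)).2.2,
          f' (P (t, x, u)).2.1, h' (P (t, x, u)).2.1, n') =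
        explicitTransf δ₀ δ₁ δ₂ δ₃ φ (t, x, u, f x, h x, n) := by
  obtain ⟨τ, ξ, ψ, hτ, hξ, hψ, hform⟩ := exists_split_form hA hB hCi hn' hC hf hf'
  obtain ⟨t₁, ht₁⟩ := hA.2.2
  obtain ⟨x₁, hx₁⟩ := hB.2.2
  obtain ⟨u₁, hu₁⟩ := hCi.2.2
  have det := fun t ht x hx => determining_relations hA hB hCi hn hn' hC hf hτ hξ hψ hform
    (t := t) (x := x) ht hx
  have slt : ∀ {G : ℝ × ℝ → ℝ}, ContDiffOn ℝ ∞ G (A ×ˢ B) → ∀ t ∈ A, ∀ x ∈ B,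
      HasDerivAt (fun s => G (s, x)) (deriv (fun s => G (s, x)) t) t := by
    intro G hG t ht x hx
    have : ContDiffAt ℝ ∞ (fun s => G (s, x)) t :=
      ContDiffAt.comp (g := G) (f := fun s => (s, x)) t
        (hG.contDiffAt ((hA.1.prod hB.1).mem_nhds ⟨ht, hx⟩)) (by fun_prop)
    exact (this.differentiableAt (by simp)).hasDerivAt
  have ξ0 : ∀ t ∈ A, ∀ x ∈ B, ξ (t, x) = ξ (t₁, x) := by
    intro t ht x hx
    refine hA.eq_of_deriv_eq_zero (g := fun s => ξ (s, x)) (fun s hs => ?_) ht ht₁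
    have := slt hξ s hs x hx
    rwa [(det s hs x hx).1] at this
  have ψ0 : ∀ t ∈ A, ∀ x ∈ B, ψ (t, x) = ψ (t₁, x) := by
    intro t ht x hx
    refine hA.eq_of_deriv_eq_zero (g := fun s => ψ (s, x)) (fun s hs => ?_) ht ht₁
    have := slt hψ s hs x hx
    rwa [(det s hs x hx).2.1] at this
  set φ : ℝ → ℝ := fun x => ξ (t₁, x) with hφ
  set χ : ℝ → ℝ := fun x => ψ (t₁, x) with hχ
  have φs : ContDiffOn ℝ ∞ φ B := hξ.comp (by fun_prop) fun x hx => ⟨ht₁, hx⟩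
  have χs : ContDiffOn ℝ ∞ χ B := hψ.comp (by fun_prop) fun x hx => ⟨ht₁, hx⟩
  have dφ : ∀ x ∈ B, deriv φ x ≠ 0 := fun x hx => (hform t₁ ht₁ x hx).2.1
  have φ's := φs.deriv_smooth hB.1
  have φ''s := φ's.deriv_smooth hB.1
  -- The relation `ξ_xx = 2 n' ψ_x ξ_x` says that `n'ψ` has the logarithmic derivative of
  -- `|φ_x|^{1/2}` as its derivative.
  have χ' : ∀ x ∈ B, n' * deriv χ x = 1 / 2 * (deriv (deriv φ) x / deriv φ x) := by
    intro x hx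
    have := (det t₁ ht₁ x hx).2.2.1
    have h0 := dφ x hx
    field_simp
    linear_combination -this
  have χ'' : ∀ x ∈ B, n' * deriv (deriv χ) x = 1 / 2 *
      ((deriv (deriv (deriv φ)) x * deriv φ x - deriv (deriv φ) x * deriv (deriv φ) x) /
        deriv φ x ^ 2) := by
    intro x hx
    have e1 := (((χs.deriv_smooth hB.1).hasDerivAt' hB.1 hx).const_mul n').deriv
    have e2 := (((φ''s.hasDerivAt' hB.1 hx).div (φ's.hasDerivAt' hB.1 hx) (dφ x hx)).const_mul
      (1 / 2)).deriv
    have e3 : (fun x => n' * deriv χ x) =ᶠ[𝓝 x]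
        fun x => 1 / 2 * (deriv (deriv φ) / deriv φ) x := by
      filter_upwards [hB.1.mem_nhds hx] with y hy using χ' y hy
    exact e1.symm.trans (e3.deriv_eq.trans e2)
  -- The constant of integration; `δ₀ = exp c`, which is why `δ₀` comes out positive.
  set c := n' * χ x₁ - 1 / 2 * Real.log (deriv φ x₁) with hc
  have hcx : ∀ x ∈ B, n' * χ x = 1 / 2 * Real.log (deriv φ x) + c := by
    intro x hx
    have : n' * χ x - 1 / 2 * Real.log (deriv φ x) = c := by
      refine hB.eq_of_deriv_eq_zero (g := fun x => n' * χ x - 1 / 2 * Real.log (deriv φ x))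
        (fun y hy => ?_) hx hx₁
      have := ((χs.hasDerivAt' hB.1 hy).const_mul n').sub
        (((φ's.hasDerivAt' hB.1 hy).log (dφ y hy)).const_mul (1 / 2))
      rwa [χ' y hy, sub_self] at this
    linear_combination this
  set δ₁ := deriv τ t₁ with hδ₁
  -- In the relation between `f` and `f'` only `τ_t` can still depend on `t`.
  have τ1 : ∀ t ∈ A, deriv τ t = δ₁ := by
    intro t ht
    have r1 := (hform t ht x₁ hx₁).2.2.1
    have r2 := (hform t₁ ht₁ x₁ hx₁).2.2.1
    have ed : deriv (fun y => ξ (t, y)) x₁ = deriv φ x₁ := by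
      apply EventuallyEq.deriv_eq
      filter_upwards [hB.1.mem_nhds hx₁] with y hy using ξ0 t ht y hy
    rw [ed, ξ0 t ht x₁ hx₁, ψ0 t ht x₁ hx₁] at r1
    have := mul_left_cancel₀ (Real.exp_pos _).ne' (r1.symm.trans r2)
    exact mul_right_cancel₀ (hf x₁ hx₁) this
  have τ2 : ∀ t ∈ A, τ t = δ₁ * t + (τ t₁ - δ₁ * t₁) := by
    intro t ht
    have : τ t - δ₁ * t = τ t₁ - δ₁ * t₁ := by
      refine hA.eq_of_deriv_eq_zero (g := fun t => τ t - δ₁ * t) (fun s hs => ?_) ht ht₁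
      have := (hτ.hasDerivAt' hA.1 hs).sub ((hasDerivAt_id s).const_mul δ₁)
      rwa [τ1 s hs, mul_one, sub_self] at this
    linear_combination this
  refine ⟨Real.exp c, δ₁, τ t₁ - δ₁ * t₁, n / n', φ, ⟨Real.exp_pos c,
    (hform t₁ ht₁ x₁ hx₁).1, div_ne_zero hn hn', φs, dφ⟩, ?_⟩
  intro t ht x hx u hu
  have hdx := dφ x hx
  have hPeq : P (t, x, u) = (τ t, φ x, n / n' * u + χ x) := by
    rw [((hform t ht x hx).2.2.2 u hu).1, ξ0 t ht x hx, ψ0 t ht x hx]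
  rw [hPeq]
  simp only [explicitTransf, Prod.mk.injEq]
  have hlog : Real.log |Real.exp c ^ 2 * deriv φ x| = 2 * c + Real.log (deriv φ x) := by
    rw [Real.log_abs, Real.log_mul (pow_ne_zero 2 (Real.exp_pos c).ne') hdx, Real.log_pow,
      Real.log_exp]
    push_cast; ring
  have hd2 : deriv φ x ^ 2 ≠ 0 := pow_ne_zero 2 hdx
  refine ⟨τ2 t ht, trivial, ?_, ?_, ?_, ?_⟩
  · rw [hlog]
    have := hcx x hx
    field_simp
    linear_combination 2 * this
  · have r := (hform t₁ ht₁ x hx).2.2.1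
    have e := rpow_abs_neg_three_halves hdx
    have e2 : Real.exp (n' * ψ (t₁, x)) = Real.exp c * Real.exp (1 / 2 * Real.log |deriv φ x|) := by
      rw [← Real.exp_add, Real.log_abs]
      congr 1
      have := hcx x hx
      linear_combination this
    rw [e2] at r
    apply mul_right_cancel₀ hd2
    linear_combination r - Real.exp c * δ₁ * f x * e
  · have r := (det t₁ ht₁ x hx).2.2.2
    have e := potential_term_eq hB.1 φs dφ hx
    have x1 := χ' x hx
    have x2 := χ'' x hx
    rw [mul_assoc (n / n' / n), e]
    change n / n' * h x = deriv (deriv χ) x - n' * deriv χ x ^ 2 + deriv φ x ^ 2 * h' (φ x) at r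
    have y1 : deriv χ x = 1 / n' * (1 / 2 * (deriv (deriv φ) x / deriv φ x)) := by
      rw [← x1]; field_simp
    have y2 : deriv (deriv χ) x = 1 / n' * (1 / 2 *
      ((deriv (deriv (deriv φ)) x * deriv φ x - deriv (deriv φ) x * deriv (deriv φ) x) /
        deriv φ x ^ 2)) := by
      rw [← x2]; field_simp
    rw [y1, y2] at r
    apply mul_left_cancel₀ hd2
    have z : n / n' * (deriv φ x) ^ (-2 : ℤ) * h x = n / n' * h x / deriv φ x ^ 2 := by
      rw [zpow_neg]
      norm_cast
      field_simp
    rw [z, mul_add, mul_div_cancel₀ _ hd2, r]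
    field_simp
    ring
  · field_simp

/-! ### From single equations to the joint space. -/

theorem Box.isOpen (D : Box) : IsOpen D.toSet :=
  D.ht.1.prod (D.hx.1.prod (D.hu.1.prod (D.hf.1.prod (D.hh.1.prod D.hn.1))))

/-- The values of `Φ` on the equation with arbitrary elements `f, h, n` are those of a member
of the explicit family. -/
def HasRepresentation (D : Box) (Φ : Joint → Joint) (f h : ℝ → ℝ) (n : ℝ)
    (δ₀ δ₁ δ₂ δ₃ : ℝ) (φ : ℝ → ℝ) : Prop :=
  AdmissibleParams D.x δ₀ δ₁ δ₃ φ ∧ ∀ t ∈ D.t, ∀ x ∈ D.x, ∀ u ∈ D.u,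
    Φ (t, x, u, f x, h x, n) = explicitTransf δ₀ δ₁ δ₂ δ₃ φ (t, x, u, f x, h x, n)

/-- The parameters obtained here may depend on the functions `f` and `h`; removing this dependence
is what remains. -/
theorem IsGeneralizedEquivalence.exists_representation {D : Box} {Φ : Joint → Joint}
    (hΦ : IsGeneralizedEquivalence D Φ) {f h : ℝ → ℝ} {n : ℝ} (hf : ContDiff ℝ ∞ f)
    (hh : ContDiff ℝ ∞ h) (hfm : ∀ x, f x ∈ D.f) (hhm : ∀ x, h x ∈ D.h) (hn : n ∈ D.n) :
    ∃ δ₀ δ₁ δ₂ δ₃ φ, HasRepresentation D Φ f h n δ₀ δ₁ δ₂ δ₃ φ := by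
  have hn0 : n ≠ 0 := fun h => D.n_ne (h ▸ hn)
  have hf0 : ∀ x ∈ D.x, f x ≠ 0 := fun x _ h => D.f_ne (h ▸ hfm x)
  obtain ⟨f', h', n', hcl, hv, hC⟩ := hΦ.2.2 f h n ⟨hn0, hf.contDiffOn, hh.contDiffOn, hf0⟩
    (fun x _ => hfm x) (fun x _ => hhm x) hn
  obtain ⟨δ₀, δ₁, δ₂, δ₃, φ, had, hform⟩ := exists_explicit_form D.ht D.hx D.hu hn0 hcl.1 hC hf0
    (fun z hz => hcl.2.2.2 _ ⟨z, hz, rfl⟩)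
  refine ⟨δ₀, δ₁, δ₂, δ₃, φ, had, fun t ht x hx u hu => ?_⟩
  rw [← hform t ht x hx u hu]
  have := hv (t, x, u) ⟨ht, hx, hu⟩
  exact Prod.ext rfl (Prod.ext rfl (Prod.ext rfl this))

theorem IsOpenInterval.exists_interpolation {J : Set ℝ} (hJ : IsOpenInterval J) {a b : ℝ}
    (ha : a ∈ J) (hb : b ∈ J) {x y : ℝ} (hxy : x ≠ y) :
    ∃ g : ℝ → ℝ, ContDiff ℝ ∞ g ∧ (∀ z, g z ∈ J) ∧ g x = a ∧ g y = b := by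
  refine ⟨fun z => a + Real.smoothTransition ((z - x) / (y - x)) * (b - a), ?_, ?_, ?_, ?_⟩
  · have : ContDiff ℝ ∞ fun z => Real.smoothTransition ((z - x) / (y - x)) :=
      Real.smoothTransition.contDiff.comp (by fun_prop)
    fun_prop
  · intro z
    have h0 := Real.smoothTransition.nonneg ((z - x) / (y - x))
    have h1 := Real.smoothTransition.le_one ((z - x) / (y - x))
    have := hJ.2.1.convex.add_smul_sub_mem ha hb ⟨h0, h1⟩
    simpa using this
  · simp [Real.smoothTransition.zero_of_nonpos]
  · have : (y - x) / (y - x) = 1 := div_self (sub_ne_zero.2 hxy.symm)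
    simp [this]

/-- A quantity is constant if it is constant along all graphs. -/
theorem eq_of_const_on_graphs {α : Type*} {D : Box} {G : ℝ → ℝ → ℝ → α}
    (hG : ∀ f h : ℝ → ℝ, ContDiff ℝ ∞ f → ContDiff ℝ ∞ h → (∀ x, f x ∈ D.f) → (∀ x, h x ∈ D.h) →
      ∀ x ∈ D.x, ∀ y ∈ D.x, G x (f x) (h x) = G y (f y) (h y))
    {x y a b c d : ℝ} (hx : x ∈ D.x) (hy : y ∈ D.x) (ha : a ∈ D.f) (hb : b ∈ D.f) (hc : c ∈ D.h)
    (hd : d ∈ D.h) : G x a c = G y b d := by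
  have key : ∀ {x y a b c d : ℝ}, x ∈ D.x → y ∈ D.x → a ∈ D.f → b ∈ D.f → c ∈ D.h → d ∈ D.h →
      x ≠ y → G x a c = G y b d := by
    intro x y a b c d hx hy ha hb hc hd hxy
    obtain ⟨f, hf, hfm, rfl, rfl⟩ := D.hf.exists_interpolation ha hb hxy
    obtain ⟨h, hh, hhm, rfl, rfl⟩ := D.hh.exists_interpolation hc hd hxy
    exact hG f h hf hh hfm hhm x hx y hy
  by_cases hxy : x = y
  -- One graph cannot pass through two points over the same `x`, so a third abscissa is used.
  · obtain ⟨z, hz, hzx⟩ := D.hx.exists_ne x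
    exact (key hx hz ha ha hc hc hzx.symm).trans (key hz hy ha hb hc hd (hxy ▸ hzx))
  · exact key hx hy ha hb hc hd hxy

/-- Serves to prescribe a value and a slope at one point by a smooth function on the whole line that
never leaves `J`. -/
theorem IsOpenInterval.add_mul_sin_mem {J : Set ℝ} (hJ : IsOpenInterval J) {a ε : ℝ}
    (h1 : a + ε ∈ J) (h2 : a - ε ∈ J) (s : ℝ) : a + ε * Real.sin s ∈ J := by
  have h0 := Real.sin_le_one s
  have h0' := Real.neg_one_le_sin s
  have := hJ.2.1.convex.add_smul_sub_mem h2 h1 (t := (1 + Real.sin s) / 2)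
    ⟨by linarith, by linarith⟩
  convert this using 1
  simp only [smul_eq_mul]; ring

/-- In logarithms this is a linear system for `log a` and `log |s|` with rows `(1, -3/2)` and `(2,
1)`, whose determinant is 4. -/
theorem abs_eq_of_amplitude_eq {a b s r : ℝ} (ha : 0 < a) (hb : 0 < b) (hs : s ≠ 0) (hr : r ≠ 0)
    (h1 : a * |s| ^ (-(3 / 2) : ℝ) = b * |r| ^ (-(3 / 2) : ℝ))
    (h2 : Real.log |a ^ 2 * s| = Real.log |b ^ 2 * r|) : |s| = |r| := by
  have hs' := abs_pos.2 hs
  have hr' := abs_pos.2 hr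
  have l1 := congrArg Real.log h1
  rw [Real.log_mul ha.ne' (Real.rpow_pos_of_pos hs' _).ne',
    Real.log_mul hb.ne' (Real.rpow_pos_of_pos hr' _).ne', Real.log_rpow hs', Real.log_rpow hr'] at l1
  rw [abs_mul, abs_mul, abs_of_pos (pow_pos ha 2), abs_of_pos (pow_pos hb 2),
    Real.log_mul (pow_pos ha 2).ne' hs'.ne', Real.log_mul (pow_pos hb 2).ne' hr'.ne', Real.log_pow,
    Real.log_pow] at h2
  push_cast at h2
  have : Real.log |s| = Real.log |r| := by linarith
  exact Real.log_injOn_pos hs' hr' this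

section
variable {D : Box} {Φ : Joint → Joint} {n : ℝ}

/-- On each single equation this component is the constant `n/δ₃`. Constant `f` and `h` allow
changing `t` and `u`; varying graphs then allow changing `x`, `f` and `h`. -/
theorem IsGeneralizedEquivalence.component_n_eq (hΦ : IsGeneralizedEquivalence D Φ) (hn : n ∈ D.n)
    {t t' x x' u u' f f' h h' : ℝ} (ht : t ∈ D.t) (ht' : t' ∈ D.t) (hx : x ∈ D.x) (hx' : x' ∈ D.x)
    (hu : u ∈ D.u) (hu' : u' ∈ D.u) (hf : f ∈ D.f) (hf' : f' ∈ D.f) (hh : h ∈ D.h)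
    (hh' : h' ∈ D.h) : (Φ (t, x, u, f, h, n)).2.2.2.2.2 = (Φ (t', x', u', f', h', n)).2.2.2.2.2 := by
  have e1 : (Φ (t, x, u, f, h, n)).2.2.2.2.2 = (Φ (t', x, u', f, h, n)).2.2.2.2.2 := by
    obtain ⟨δ₀, δ₁, δ₂, δ₃, φ, -, h1⟩ := hΦ.exists_representation (f := fun _ => f) (h := fun _ => h)
      contDiff_const contDiff_const (fun _ => hf) (fun _ => hh) hn
    rw [h1 t ht x hx u hu, h1 t' ht' x hx u' hu']
    rfl
  rw [e1]
  refine eq_of_const_on_graphs (D := D) (G := fun x f h => (Φ (t', x, u', f, h, n)).2.2.2.2.2) ?_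
    hx hx' hf hf' hh hh'
  intro f h hfs hhs hfm hhm x hx y hy
  obtain ⟨δ₀, δ₁, δ₂, δ₃, φ, -, h1⟩ := hΦ.exists_representation hfs hhs hfm hhm hn
  simp only [h1 t' ht' x hx u' hu', h1 t' ht' y hy u' hu']
  rfl

theorem IsGeneralizedEquivalence.component_t_eq (hΦ : IsGeneralizedEquivalence D Φ) (hn : n ∈ D.n)
    {t x x' u u' f f' h h' : ℝ} (ht : t ∈ D.t) (hx : x ∈ D.x) (hx' : x' ∈ D.x)
    (hu : u ∈ D.u) (hu' : u' ∈ D.u) (hf : f ∈ D.f) (hf' : f' ∈ D.f) (hh : h ∈ D.h)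
    (hh' : h' ∈ D.h) : (Φ (t, x, u, f, h, n)).1 = (Φ (t, x', u', f', h', n)).1 := by
  have e1 : (Φ (t, x, u, f, h, n)).1 = (Φ (t, x, u', f, h, n)).1 := by
    obtain ⟨δ₀, δ₁, δ₂, δ₃, φ, -, h1⟩ := hΦ.exists_representation (f := fun _ => f) (h := fun _ => h)
      contDiff_const contDiff_const (fun _ => hf) (fun _ => hh) hn
    rw [h1 t ht x hx u hu, h1 t ht x hx u' hu']
    rfl
  rw [e1]
  refine eq_of_const_on_graphs (D := D) (G := fun x f h => (Φ (t, x, u', f, h, n)).1) ?_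
    hx hx' hf hf' hh hh'
  intro f h hfs hhs hfm hhm x hx y hy
  obtain ⟨δ₀, δ₁, δ₂, δ₃, φ, -, h1⟩ := hΦ.exists_representation hfs hhs hfm hhm hn
  simp only [h1 t ht x hx u' hu', h1 t ht y hy u' hu']
  rfl

/-- Two equations with the same `f`, `h` at `x` share the values of `Φ` over that point. Two times
determine `δ₁`, the last component determines `δ₃`, and the `f` and `u` components are then two
independent conditions on `δ₀` and `|φ_x|`. -/
theorem HasRepresentation.abs_deriv_eq (hn : n ∈ D.n) {f h f' h' φ φ' : ℝ → ℝ}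
    {δ₀ δ₁ δ₂ δ₃ ε₀ ε₁ ε₂ ε₃ : ℝ} (hR : HasRepresentation D Φ f h n δ₀ δ₁ δ₂ δ₃ φ)
    (hR' : HasRepresentation D Φ f' h' n ε₀ ε₁ ε₂ ε₃ φ') {x : ℝ} (hx : x ∈ D.x)
    (hf : f x = f' x) (hf0 : f x ≠ 0) (hh : h x = h' x) : |deriv φ x| = |deriv φ' x| := by
  have hn0 : n ≠ 0 := fun h => D.n_ne (h ▸ hn)
  obtain ⟨t, ht⟩ := D.ht.2.2
  obtain ⟨u, hu⟩ := D.hu.2.2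
  obtain ⟨t', ht', htt⟩ := D.ht.exists_ne t
  have e1 := (hR.2 t ht x hx u hu)
  have e2 := (hR.2 t' ht' x hx u hu)
  rw [hf, hh, hR'.2 t ht x hx u hu] at e1
  rw [hf, hh, hR'.2 t' ht' x hx u hu] at e2
  simp only [explicitTransf, Prod.mk.injEq] at e1 e2
  obtain ⟨a1, -, a3, a4, -, a6⟩ := e1
  obtain ⟨b1, -⟩ := e2
  obtain ⟨p0, p1, p3, -, p5⟩ := hR.1
  obtain ⟨q0, q1, q3, -, q5⟩ := hR'.1
  have hδ1 : δ₁ = ε₁ := by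
    apply mul_right_cancel₀ (sub_ne_zero.2 htt)
    linarith
  have hδ3 : δ₃ = ε₃ := by
    field_simp at a6
    exact a6
  subst hδ1 hδ3
  refine abs_eq_of_amplitude_eq p0 q0 (p5 x hx) (q5 x hx) ?_ ?_
  · rw [← hf] at a4
    apply mul_right_cancel₀ (mul_ne_zero p1 hf0)
    linear_combination -a4
  · have : δ₃ / (2 * n) ≠ 0 := by positivity
    apply mul_left_cancel₀ this
    linarith

theorem eq_zero_of_abs_eq {a b : ℝ} (h1 : |a + b| = |a|) (h2 : |a - b| = |a|) : b = 0 := by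
  have h1' := (sq_eq_sq_iff_abs_eq_abs _ _).2 h1
  have h2' := (sq_eq_sq_iff_abs_eq_abs _ _).2 h2
  have : b ^ 2 = 0 := by linarith
  exact pow_eq_zero_iff (by norm_num) |>.1 this

/-- The graphs with `s = 0, 1, -1` pass through the same point with different slopes, and there `φ_x
= X_x + s (a X_f + b X_h)`. Its absolute value does not depend on `s`, so the slope term vanishes.
-/
theorem IsGeneralizedEquivalence.fderiv_component_x (hΦ : IsGeneralizedEquivalence D Φ)
    (hn : n ∈ D.n) {t x u f h a b : ℝ} (ht : t ∈ D.t) (hx : x ∈ D.x) (hu : u ∈ D.u)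
    (hf : f ∈ D.f) (hh : h ∈ D.h) (ha : f + a ∈ D.f) (ha' : f - a ∈ D.f) (hb : h + b ∈ D.h)
    (hb' : h - b ∈ D.h) :
    fderiv ℝ (fun z => (Φ z).2.1) (t, x, u, f, h, n) (0, 0, 0, a, b, 0) = 0 := by
  have hz : (t, x, u, f, h, n) ∈ D.toSet := ⟨ht, hx, hu, hf, hh, hn⟩
  have hX : DifferentiableAt ℝ (fun z => (Φ z).2.1) (t, x, u, f, h, n) :=
    (hΦ.1.contDiffAt (D.isOpen.mem_nhds hz)).snd.fst.differentiableAt (by simp)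
  have rep := fun s : ℝ => hΦ.exists_representation (f := fun y => f + s * a * Real.sin (y - x))
    (h := fun y => h + s * b * Real.sin (y - x)) (n := n)
  have der : ∀ s : ℝ, ∀ δ₀ δ₁ δ₂ δ₃ φ, HasRepresentation D Φ
      (fun y => f + s * a * Real.sin (y - x)) (fun y => h + s * b * Real.sin (y - x)) n
        δ₀ δ₁ δ₂ δ₃ φ →
      deriv φ x = fderiv ℝ (fun z => (Φ z).2.1) (t, x, u, f, h, n) (0, 1, 0, 0, 0, 0) +
        s * fderiv ℝ (fun z => (Φ z).2.1) (t, x, u, f, h, n) (0, 0, 0, a, b, 0) := by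
    intro s δ₀ δ₁ δ₂ δ₃ φ hR
    have e : φ =ᶠ[𝓝 x] fun y => (Φ (t, y, u, f + s * a * Real.sin (y - x),
        h + s * b * Real.sin (y - x), n)).2.1 := by
      filter_upwards [D.hx.1.mem_nhds hx] with y hy
      rw [hR.2 t ht y hy u hu]
      rfl
    have hsin : HasDerivAt (fun y => Real.sin (y - x)) 1 x := by
      simpa using ((hasDerivAt_id x).sub_const x).sin
    have hc : HasDerivAt (fun y => (t, y, u, f + s * a * Real.sin (y - x),
        h + s * b * Real.sin (y - x), n)) (0, 1, 0, s * a * 1, s * b * 1, 0) x :=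
      (hasDerivAt_const x t).prodMk ((hasDerivAt_id x).prodMk ((hasDerivAt_const x u).prodMk
        (((hsin.const_mul (s * a)).const_add f).prodMk
          (((hsin.const_mul (s * b)).const_add h).prodMk (hasDerivAt_const x n)))))
    have hX' : DifferentiableAt ℝ (fun z => (Φ z).2.1) ((fun y => (t, y, u,
        f + s * a * Real.sin (y - x), h + s * b * Real.sin (y - x), n)) x) := by
      simpa using hX
    have h1 := (hX'.hasFDerivAt.comp_hasDerivAt x hc).deriv
    rw [e.deriv_eq]
    refine Eq.trans ?_ (h1.trans ?_)
    · rfl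
    · have : ((0:ℝ), (1:ℝ), (0:ℝ), s * a * 1, s * b * 1, (0:ℝ)) =
        ((0:ℝ), (1:ℝ), (0:ℝ), (0:ℝ), (0:ℝ), (0:ℝ)) + s • ((0:ℝ), (0:ℝ), (0:ℝ), a, b, (0:ℝ)) := by
        simp
      rw [this, map_add, map_smul, smul_eq_mul]
      simp
  have smooth : ∀ c d : ℝ, ContDiff ℝ ∞ fun y => c + d * Real.sin (y - x) := by
    intro c d
    have : ContDiff ℝ ∞ fun y => Real.sin (y - x) := Real.contDiff_sin.comp (by fun_prop)
    fun_prop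
  have hf0 : f ≠ 0 := fun h => D.f_ne (h ▸ hf)
  obtain ⟨δ₀, δ₁, δ₂, δ₃, φ, R0⟩ := rep 0 (smooth _ _) (smooth _ _) (fun y => by simpa using hf)
    (fun y => by simpa using hh) hn
  obtain ⟨ε₀, ε₁, ε₂, ε₃, χ, R1⟩ := rep 1 (smooth _ _) (smooth _ _)
    (fun y => D.hf.add_mul_sin_mem (by simpa using ha) (by simpa using ha') _)
    (fun y => D.hh.add_mul_sin_mem (by simpa using hb) (by simpa using hb') _) hn
  obtain ⟨ζ₀, ζ₁, ζ₂, ζ₃, ψ, R2⟩ := rep (-1) (smooth _ _) (smooth _ _)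
    (fun y => D.hf.add_mul_sin_mem (by simpa [sub_eq_add_neg] using ha') (by simpa using ha) _)
    (fun y => D.hh.add_mul_sin_mem (by simpa [sub_eq_add_neg] using hb') (by simpa using hb) _) hn
  have a1 := R1.abs_deriv_eq hn R0 hx (by simp) (by simpa using hf0) (by simp)
  have a2 := R2.abs_deriv_eq hn R0 hx (by simp) (by simpa using hf0) (by simp)
  rw [der _ _ _ _ _ _ R0, der _ _ _ _ _ _ R1] at a1
  rw [der _ _ _ _ _ _ R0, der _ _ _ _ _ _ R2] at a2
  refine eq_zero_of_abs_eq (a := fderiv ℝ (fun z => (Φ z).2.1) (t, x, u, f, h, n)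
    (0, 1, 0, 0, 0, 0)) ?_ ?_
  · simpa using a1
  · simpa [sub_eq_add_neg] using a2

theorem IsOpenInterval.exists_add_sub_mem {J : Set ℝ} (hJ : IsOpenInterval J) {a : ℝ}
    (ha : a ∈ J) : ∃ ε ≠ 0, a + ε ∈ J ∧ a - ε ∈ J := by
  obtain ⟨r, hr, hb⟩ := Metric.isOpen_iff.1 hJ.1 a ha
  refine ⟨r / 2, by positivity, hb ?_, hb ?_⟩
  · simp [abs_of_pos hr, hr]
  · simp [abs_of_pos hr, hr]

theorem IsGeneralizedEquivalence.component_x_eq (hΦ : IsGeneralizedEquivalence D Φ) (hn : n ∈ D.n)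
    {t t' x u u' f f' h h' : ℝ} (ht : t ∈ D.t) (ht' : t' ∈ D.t) (hx : x ∈ D.x)
    (hu : u ∈ D.u) (hu' : u' ∈ D.u) (hf : f ∈ D.f) (hf' : f' ∈ D.f) (hh : h ∈ D.h)
    (hh' : h' ∈ D.h) : (Φ (t, x, u, f, h, n)).2.1 = (Φ (t', x, u', f', h', n)).2.1 := by
  have e1 : (Φ (t, x, u, f, h, n)).2.1 = (Φ (t', x, u', f, h, n)).2.1 := by
    obtain ⟨δ₀, δ₁, δ₂, δ₃, φ, -, h1⟩ := hΦ.exists_representation (f := fun _ => f) (h := fun _ => h)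
      contDiff_const contDiff_const (fun _ => hf) (fun _ => hh) hn
    rw [h1 t ht x hx u hu, h1 t' ht' x hx u' hu']
    rfl
  have hX : ∀ f ∈ D.f, ∀ h ∈ D.h, DifferentiableAt ℝ (fun z => (Φ z).2.1) (t', x, u', f, h, n) :=
    fun f hf h hh => (hΦ.1.contDiffAt
      (D.isOpen.mem_nhds ⟨ht', hx, hu', hf, hh, hn⟩)).snd.fst.differentiableAt (by simp)
  have e2 : (Φ (t', x, u', f, h, n)).2.1 = (Φ (t', x, u', f', h, n)).2.1 := by
    refine D.hf.eq_of_deriv_eq_zero (g := fun f => (Φ (t', x, u', f, h, n)).2.1)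
      (fun y hy => ?_) hf hf'
    obtain ⟨ε, hε, h1, h2⟩ := D.hf.exists_add_sub_mem hy
    have hd := hΦ.fderiv_component_x hn ht' hx hu' hy hh h1 h2 (b := 0) (by simpa using hh)
      (by simpa using hh)
    have hc : HasDerivAt (fun y => (t', x, u', y, h, n)) (0, 0, 0, 1, 0, 0) y :=
      (hasDerivAt_const y t').prodMk ((hasDerivAt_const y x).prodMk ((hasDerivAt_const y u').prodMk
        ((hasDerivAt_id y).prodMk ((hasDerivAt_const y h).prodMk (hasDerivAt_const y n)))))
    have := (hX y hy h hh).hasFDerivAt.comp_hasDerivAt y hc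
    have e : ((0:ℝ), (0:ℝ), (0:ℝ), ε, (0:ℝ), (0:ℝ)) =
      ε • ((0:ℝ), (0:ℝ), (0:ℝ), (1:ℝ), (0:ℝ), (0:ℝ)) := by simp
    rw [e, map_smul, smul_eq_mul, mul_eq_zero] at hd
    rw [hd.resolve_left hε] at this
    exact this
  have e3 : (Φ (t', x, u', f', h, n)).2.1 = (Φ (t', x, u', f', h', n)).2.1 := by
    refine D.hh.eq_of_deriv_eq_zero (g := fun h => (Φ (t', x, u', f', h, n)).2.1)
      (fun y hy => ?_) hh hh'
    obtain ⟨ε, hε, h1, h2⟩ := D.hh.exists_add_sub_mem hy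
    have hd := hΦ.fderiv_component_x hn ht' hx hu' hf' hy (a := 0) (by simpa using hf')
      (by simpa using hf') h1 h2
    have hc : HasDerivAt (fun y => (t', x, u', f', y, n)) (0, 0, 0, 0, 1, 0) y :=
      (hasDerivAt_const y t').prodMk ((hasDerivAt_const y x).prodMk ((hasDerivAt_const y u').prodMk
        ((hasDerivAt_const y f').prodMk ((hasDerivAt_id y).prodMk (hasDerivAt_const y n)))))
    have := (hX f' hf' y hy).hasFDerivAt.comp_hasDerivAt y hc
    have e : ((0:ℝ), (0:ℝ), (0:ℝ), (0:ℝ), ε, (0:ℝ)) =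
      ε • ((0:ℝ), (0:ℝ), (0:ℝ), (0:ℝ), (1:ℝ), (0:ℝ)) := by simp
    rw [e, map_smul, smul_eq_mul, mul_eq_zero] at hd
    rw [hd.resolve_left hε] at this
    exact this
  rw [e1, e2, e3]

end

theorem contDiffOn_deriv_param {φ : ℝ → ℝ → ℝ} {S : Set (ℝ × ℝ)} (hS : IsOpen S)
    (hφ : ContDiffOn ℝ ∞ (fun q : ℝ × ℝ => φ q.1 q.2) S) :
    ContDiffOn ℝ ∞ (fun q : ℝ × ℝ => deriv (φ q.1) q.2) S := by
  have h1 : ContDiffOn ℝ ∞ (fderiv ℝ (fun q : ℝ × ℝ => φ q.1 q.2)) S :=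
    hφ.fderiv_of_isOpen hS (by simp)
  have h2 : ContDiffOn ℝ ∞ (fun q : ℝ × ℝ => fderiv ℝ (fun q : ℝ × ℝ => φ q.1 q.2) q (0, 1)) S :=
    h1.clm_apply contDiffOn_const
  refine h2.congr fun q hq => ?_
  have h3 := ((hφ.contDiffAt (hS.mem_nhds hq)).differentiableAt (by simp)).hasFDerivAt
  have h4 := h3.comp_hasDerivAt q.2
    ((hasDerivAt_const q.2 q.1).prodMk (hasDerivAt_id q.2))
  exact h4.deriv

/-- All parameters are read off from `Φ` at a fixed base point, the second time `t₁` serving for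
`δ₁`. This makes them smooth in `n`; the representation of each single equation is then shown to
have these parameters. -/
theorem IsGeneralizedEquivalence.hasExplicitForm {D : Box} {Φ : Joint → Joint}
    (hΦ : IsGeneralizedEquivalence D Φ) : HasExplicitForm D Φ := by
  obtain ⟨t₀, ht₀⟩ := D.ht.2.2
  obtain ⟨t₁, ht₁, ht₁₀⟩ := D.ht.exists_ne t₀
  obtain ⟨x₀, hx₀⟩ := D.hx.2.2
  obtain ⟨u₀, hu₀⟩ := D.hu.2.2
  obtain ⟨f₀, hf₀⟩ := D.hf.2.2
  obtain ⟨h₀, hh₀⟩ := D.hh.2.2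
  have ht10 : t₁ - t₀ ≠ 0 := sub_ne_zero.2 ht₁₀
  set N : ℝ → ℝ := fun n => (Φ (t₀, x₀, u₀, f₀, h₀, n)).2.2.2.2.2 with hN
  set d₃ : ℝ → ℝ := fun n => n / N n with hd₃
  set d₁ : ℝ → ℝ := fun n =>
    ((Φ (t₁, x₀, u₀, f₀, h₀, n)).1 - (Φ (t₀, x₀, u₀, f₀, h₀, n)).1) / (t₁ - t₀) with hd₁
  set d₂ : ℝ → ℝ := fun n => (Φ (t₀, x₀, u₀, f₀, h₀, n)).1 - d₁ n * t₀ with hd₂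
  set φ : ℝ → ℝ → ℝ := fun n x => (Φ (t₀, x, u₀, f₀, h₀, n)).2.1 with hφ
  -- The `u` component solved for `log δ₀`; it is constant along every graph, hence constant.
  set K : ℝ → ℝ → ℝ → ℝ → ℝ := fun n x f h =>
    n / d₃ n * (Φ (t₀, x, u₀, f, h, n)).2.2.1 - n * u₀ - 1 / 2 * Real.log (deriv (φ n) x) with hK
  set d₀ : ℝ → ℝ := fun n => Real.exp (K n x₀ f₀ h₀) with hd₀
  have rep3 : ∀ {n}, n ∈ D.n → ∀ {f h : ℝ → ℝ}, (∀ x, f x ∈ D.f) → (∀ x, h x ∈ D.h) →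
      ∀ {δ₀ δ₁ δ₂ δ₃ χ}, HasRepresentation D Φ f h n δ₀ δ₁ δ₂ δ₃ χ →
      N n ≠ 0 ∧ δ₃ = d₃ n ∧ δ₁ = d₁ n ∧ δ₂ = d₂ n ∧ (∀ x ∈ D.x, χ x = φ n x) ∧
        ∀ x ∈ D.x, K n x (f x) (h x) = Real.log δ₀ := by
    intro n hn f h hfm hhm δ₀ δ₁ δ₂ δ₃ χ hR
    have hn0 : n ≠ 0 := fun h => D.n_ne (h ▸ hn)
    obtain ⟨p0, p1, p3, -, p5⟩ := hR.1
    have e := hR.2 t₀ ht₀ x₀ hx₀ u₀ hu₀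
    have e' := hR.2 t₁ ht₁ x₀ hx₀ u₀ hu₀
    have a6 : N n = n / δ₃ := by
      rw [hN]; dsimp only
      rw [hΦ.component_n_eq hn ht₀ ht₀ hx₀ hx₀ hu₀ hu₀ hf₀ (hfm x₀) hh₀ (hhm x₀), e]
      rfl
    have a1 : (Φ (t₀, x₀, u₀, f₀, h₀, n)).1 = δ₁ * t₀ + δ₂ := by
      rw [hΦ.component_t_eq hn ht₀ hx₀ hx₀ hu₀ hu₀ hf₀ (hfm x₀) hh₀ (hhm x₀), e]
      rfl
    have a1' : (Φ (t₁, x₀, u₀, f₀, h₀, n)).1 = δ₁ * t₁ + δ₂ := by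
      rw [hΦ.component_t_eq hn ht₁ hx₀ hx₀ hu₀ hu₀ hf₀ (hfm x₀) hh₀ (hhm x₀), e']
      rfl
    have b3 : δ₃ = d₃ n := by simp only [hd₃]; rw [a6]; field_simp
    have b1 : δ₁ = d₁ n := by simp only [hd₁]; rw [a1, a1']; field_simp; ring
    have bx : ∀ x ∈ D.x, χ x = φ n x := by
      intro x hx
      rw [hφ]; dsimp only
      rw [hΦ.component_x_eq hn ht₀ ht₀ hx hu₀ hu₀ hf₀ (hfm x) hh₀ (hhm x), hR.2 t₀ ht₀ x hx u₀ hu₀]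
      rfl
    refine ⟨a6 ▸ div_ne_zero hn0 p3, b3, b1, ?_, bx, ?_⟩
    · simp only [hd₂]; rw [← b1, a1]; ring
    · intro x hx
      have hdx := p5 x hx
      have hder : deriv (φ n) x = deriv χ x := by
        apply EventuallyEq.deriv_eq
        filter_upwards [D.hx.1.mem_nhds hx] with y hy using (bx y hy).symm
      simp only [hK]
      rw [hR.2 t₀ ht₀ x hx u₀ hu₀, hder, ← b3]
      simp only [explicitTransf]
      rw [Real.log_abs, Real.log_mul (pow_pos p0 2).ne' hdx, Real.log_pow]
      field_simp
      push_cast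
      ring
  have crep : ∀ {n}, n ∈ D.n → ∀ {f h}, f ∈ D.f → h ∈ D.h →
      ∃ δ₀ δ₁ δ₂ δ₃ χ, HasRepresentation D Φ (fun _ => f) (fun _ => h) n δ₀ δ₁ δ₂ δ₃ χ :=
    fun hn _ _ hf hh => hΦ.exists_representation contDiff_const contDiff_const (fun _ => hf)
      (fun _ => hh) hn
  have Kc : ∀ {n}, n ∈ D.n → ∀ {x f h}, x ∈ D.x → f ∈ D.f → h ∈ D.h →
      K n x f h = K n x₀ f₀ h₀ := by
    intro n hn x f h hx hf hh
    refine eq_of_const_on_graphs (D := D) (G := K n) ?_ hx hx₀ hf hf₀ hh hh₀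
    intro f h hfs hhs hfm hhm x hx y hy
    obtain ⟨δ₀, δ₁, δ₂, δ₃, χ, hR⟩ := hΦ.exists_representation hfs hhs hfm hhm hn
    have := (rep3 hn hfm hhm hR).2.2.2.2.2
    rw [this x hx, this y hy]
  have N0 : ∀ n ∈ D.n, N n ≠ 0 := by
    intro n hn
    obtain ⟨δ₀, δ₁, δ₂, δ₃, χ, hR⟩ := crep hn hf₀ hh₀
    exact (rep3 hn (fun _ => hf₀) (fun _ => hh₀) hR).1
  have hder : ∀ {n χ}, (∀ x ∈ D.x, χ x = φ n x) → ∀ x ∈ D.x, deriv χ x = deriv (φ n) x := by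
    intro n χ h x hx
    apply EventuallyEq.deriv_eq
    filter_upwards [D.hx.1.mem_nhds hx] with y hy using h y hy
  have adm : ∀ n ∈ D.n, AdmissibleParams D.x (d₀ n) (d₁ n) (d₃ n) (φ n) := by
    intro n hn
    obtain ⟨δ₀, δ₁, δ₂, δ₃, χ, hR⟩ := crep hn hf₀ hh₀
    obtain ⟨-, b3, b1, -, bx, -⟩ := rep3 hn (fun _ => hf₀) (fun _ => hh₀) hR
    obtain ⟨-, p1, p3, p4, p5⟩ := hR.1
    refine ⟨Real.exp_pos _, b1 ▸ p1, b3 ▸ p3, p4.congr fun x hx => (bx x hx).symm, fun x hx => ?_⟩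
    rw [← hder bx x hx]
    exact p5 x hx
  have cs : ∀ t ∈ D.t, ContDiffOn ℝ ∞ (fun n => Φ (t, x₀, u₀, f₀, h₀, n)) D.n := fun t ht =>
    hΦ.1.comp (by fun_prop) fun n hn => ⟨ht, hx₀, hu₀, hf₀, hh₀, hn⟩
  have Ns : ContDiffOn ℝ ∞ N D.n := (cs t₀ ht₀).snd.snd.snd.snd.snd
  have d₃s : ContDiffOn ℝ ∞ d₃ D.n := contDiffOn_id.div Ns N0
  have d₁s : ContDiffOn ℝ ∞ d₁ D.n := ((cs t₁ ht₁).fst.sub (cs t₀ ht₀).fst).div_const _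
  have d₂s : ContDiffOn ℝ ∞ d₂ D.n := (cs t₀ ht₀).fst.sub (d₁s.mul contDiffOn_const)
  have φs : ContDiffOn ℝ ∞ (fun q : ℝ × ℝ => φ q.1 q.2) (D.n ×ˢ D.x) := by
    have : ContDiffOn ℝ ∞ (fun q : ℝ × ℝ => Φ (t₀, q.2, u₀, f₀, h₀, q.1)) (D.n ×ˢ D.x) :=
      hΦ.1.comp (by fun_prop) fun q hq => ⟨ht₀, hq.2, hu₀, hf₀, hh₀, hq.1⟩
    exact this.snd.fst
  have d₀s : ContDiffOn ℝ ∞ d₀ D.n := by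
    have e1 : ContDiffOn ℝ ∞ (fun n => deriv (φ n) x₀) D.n :=
      (contDiffOn_deriv_param (D.hn.1.prod D.hx.1) φs).comp
        (by fun_prop : ContDiffOn ℝ ∞ (fun n : ℝ => (n, x₀)) D.n) fun n hn => ⟨hn, hx₀⟩
    have e2 : ContDiffOn ℝ ∞ (fun n => (Φ (t₀, x₀, u₀, f₀, h₀, n)).2.2.1) D.n :=
      (cs t₀ ht₀).snd.snd.fst
    have e3 : ContDiffOn ℝ ∞ (fun n => n / d₃ n) D.n :=
      contDiffOn_id.div d₃s fun n hn => (adm n hn).2.2.1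
    have e4 : ContDiffOn ℝ ∞ (fun n => Real.log (deriv (φ n) x₀)) D.n :=
      e1.log fun n hn => (adm n hn).2.2.2.2 x₀ hx₀
    exact (((e3.mul e2).sub (contDiffOn_id.mul contDiffOn_const)).sub
      (contDiffOn_const.mul e4)).exp
  refine ⟨d₀, d₁, d₂, d₃, φ, d₀s, d₁s, d₂s, d₃s, φs, fun n hn => ⟨adm n hn, ?_⟩, ?_⟩
  · intro hzero
    have hn0 : n ≠ 0 := fun h => D.n_ne (h ▸ hn)
    have e1 : (fun k => k / d₃ k) =ᶠ[𝓝 n] N := by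
      filter_upwards [D.hn.1.mem_nhds hn] with k hk
      have hk0 : k ≠ 0 := fun h => D.n_ne (h ▸ hk)
      have := N0 k hk
      simp only [hd₃]; field_simp
    have hNd : HasDerivAt N 0 n := by
      rw [← hzero, e1.deriv_eq]
      exact Ns.hasDerivAt' D.hn.1 hn
    set z : Joint := (t₀, x₀, u₀, f₀, h₀, n) with hz
    have hzD : z ∈ D.toSet := ⟨ht₀, hx₀, hu₀, hf₀, hh₀, hn⟩
    have hdet := (ContinuousLinearMap.det_ne_zero_iff _).1 (hΦ.2.1 z hzD)
    -- If `N` is stationary at `n`, the last component of `Φ` has zero differential at `z`, so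
    -- `fderiv ℝ Φ z` cannot be onto.
    have hinj : Function.Injective (fderiv ℝ Φ z : Joint →ₗ[ℝ] Joint) :=
      (injective_iff_map_eq_zero _).2 hdet
    obtain ⟨v, hv⟩ := (LinearMap.injective_iff_surjective.1 hinj) (0, 0, 0, 0, 0, 1)
    have hd : DifferentiableAt ℝ Φ z :=
      (hΦ.1.contDiffAt (D.isOpen.mem_nhds hzD)).differentiableAt (by simp)
    have c1 := hd.snd.snd.snd.snd.snd.hasFDerivAt
    have c2 : HasFDerivAt (fun z : Joint => (Φ z).2.2.2.2.2) (0 : Joint →L[ℝ] ℝ) z := by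
      have hp : HasFDerivAt (fun z : Joint => z.2.2.2.2.2)
        (fderiv ℝ (fun z : Joint => z.2.2.2.2.2) z) z :=
          (by fun_prop : DifferentiableAt ℝ (fun z : Joint => z.2.2.2.2.2) z).hasFDerivAt
      have h1 := HasDerivAt.comp_hasFDerivAt (h₂ := N) (f := fun z : Joint => z.2.2.2.2.2) z hNd hp
      rw [zero_smul] at h1
      refine h1.congr_of_eventuallyEq ?_
      filter_upwards [D.isOpen.mem_nhds hzD] with y hy
      obtain ⟨t, x, u, f, h, k⟩ := y
      exact hΦ.component_n_eq hy.2.2.2.2.2 hy.1 ht₀ hy.2.1 hx₀ hy.2.2.1 hu₀ hy.2.2.2.1 hf₀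
        hy.2.2.2.2.1 hh₀
    have c3 := (hd.hasFDerivAt.snd.snd.snd.snd.snd).unique c2
    have c4 := congrArg (fun L => L v) c3
    have c5 : (fderiv ℝ Φ z v).2.2.2.2.2 = 0 := c4
    have c6 : fderiv ℝ Φ z v = (0, 0, 0, 0, 0, 1) := hv
    rw [c6] at c5
    exact one_ne_zero c5
  · rintro ⟨t, x, u, f, h, n⟩ ⟨ht, hx, hu, hf, hh, hn⟩
    -- An equation with constant `f` and `h` passes through any given point of the box.
    obtain ⟨δ₀, δ₁, δ₂, δ₃, χ, hR⟩ := crep hn hf hh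
    obtain ⟨-, b3, b1, b2, bx, bK⟩ := rep3 hn (fun _ => hf) (fun _ => hh) hR
    have b0 : δ₀ = d₀ n := by
      simp only [hd₀]
      rw [← Kc hn hx hf hh, bK x hx, Real.exp_log hR.1.1]
    have hd := hder bx
    have e1 : iteratedDeriv 2 (fun y => |deriv χ y| ^ (-(1 / 2) : ℝ)) x =
        iteratedDeriv 2 (fun y => |deriv (φ n) y| ^ (-(1 / 2) : ℝ)) x := by
      apply EventuallyEq.iteratedDeriv_eq
      filter_upwards [D.hx.1.mem_nhds hx] with y hy
      rw [hd y hy]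
    have := hR.2 t ht x hx u hu
    dsimp only at this
    rw [this, ← b0, ← b1, ← b2, ← b3]
    simp only [explicitTransf]
    rw [hd x hx, e1, bx x hx]

/-! ### The explicit transformations preserve the class. -/

/-- Rolle's theorem gives injectivity on the interval; near each image point the global inverse
agrees with the smooth local one of the inverse function theorem. -/
theorem exists_smooth_inverse {I : Set ℝ} (hI : IsOpenInterval I) {φ : ℝ → ℝ}
    (hφ : ContDiffOn ℝ ∞ φ I) (hd : ∀ x ∈ I, deriv φ x ≠ 0) :
    IsOpenInterval (φ '' I) ∧ ∃ ψ : ℝ → ℝ, ContDiffOn ℝ ∞ ψ (φ '' I) ∧ (∀ x ∈ I, ψ (φ x) = x) ∧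
      ∀ x ∈ I, HasDerivAt ψ (deriv φ x)⁻¹ (φ x) := by
  have hinj : InjOn φ I := by
    have key : ∀ a ∈ I, ∀ b ∈ I, a < b → φ a ≠ φ b := by
      intro a ha b hb hab h
      have hsub : Icc a b ⊆ I := hI.2.1.out ha hb
      obtain ⟨c, hc, hc'⟩ := exists_deriv_eq_zero hab (hφ.continuousOn.mono hsub) h
      exact hd c (hsub (Ioo_subset_Icc_self hc)) hc'
    intro a ha b hb h
    rcases lt_trichotomy a b with h1 | h1 | h1
    · exact absurd h (key a ha b hb h1)
    · exact h1
    · exact absurd h.symm (key b hb a ha h1)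
  have hloc : ∀ x ∈ I, φ '' I ∈ 𝓝 (φ x) ∧ ∃ g : ℝ → ℝ, ContDiffAt ℝ ∞ g (φ x) ∧
      Function.invFunOn φ I =ᶠ[𝓝 (φ x)] g := by
    intro x hx
    have hs : ContDiffAt ℝ ∞ φ x := hφ.contDiffAt (hI.1.mem_nhds hx)
    let e : ℝ ≃L[ℝ] ℝ := ContinuousLinearEquiv.unitsEquivAut ℝ (Units.mk0 _ (hd x hx))
    have he : HasFDerivAt φ (e : ℝ →L[ℝ] ℝ) x := by
      have h1 := (hφ.hasDerivAt' hI.1 hx).hasFDerivAt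
      refine h1.congr_fderiv ?_
      ext; simp [e]
    have hst := hs.hasStrictFDerivAt' he (by simp)
    refine ⟨?_, hs.localInverse he (by simp), hs.to_localInverse he (by simp), ?_⟩
    · have := hst.map_nhds_eq_of_equiv
      rw [← this]
      exact image_mem_map (hI.1.mem_nhds hx)
    · have h1 : ∀ᶠ y in 𝓝 (φ x), φ (hs.localInverse he (by simp) y) = y :=
        hst.eventually_right_inverse
      have h2 : ∀ᶠ y in 𝓝 (φ x), hs.localInverse he (by simp) y ∈ I := by
        have hc : ContinuousAt (hs.localInverse he (by simp)) (φ x) :=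
          (hs.to_localInverse he (by simp)).continuousAt
        apply hc.eventually
        rw [hs.localInverse_apply_image he (by simp)]
        exact hI.1.mem_nhds hx
      filter_upwards [h1, h2] with y hy1 hy2
      conv_lhs => rw [← hy1]
      exact hinj.leftInvOn_invFunOn hy2
  have hopen : IsOpen (φ '' I) := by
    rw [isOpen_iff_mem_nhds]
    rintro _ ⟨x, hx, rfl⟩
    exact (hloc x hx).1
  have hleft : ∀ x ∈ I, Function.invFunOn φ I (φ x) = x := fun x hx => hinj.leftInvOn_invFunOn hx
  have hsm : ContDiffOn ℝ ∞ (Function.invFunOn φ I) (φ '' I) := by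
    rintro _ ⟨x, hx, rfl⟩
    obtain ⟨-, g, hg, hge⟩ := hloc x hx
    exact (hg.congr_of_eventuallyEq hge).contDiffWithinAt
  refine ⟨⟨hopen, ?_, hI.2.2.image φ⟩, Function.invFunOn φ I, hsm, hleft, fun x hx => ?_⟩
  · exact (hI.2.1.isPreconnected.image φ hφ.continuousOn).ordConnected
  · have h1 := hsm.hasDerivAt' hopen (mem_image_of_mem φ hx)
    have h2 := h1.comp x (hφ.hasDerivAt' hI.1 hx)
    have h3 : (Function.invFunOn φ I ∘ φ) =ᶠ[𝓝 x] id := by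
      filter_upwards [hI.1.mem_nhds hx] with y hy using hleft y hy
    have h4 := (h2.congr_of_eventuallyEq h3.symm).unique (hasDerivAt_id x)
    rwa [eq_inv_of_mul_eq_one_left h4] at h1

/-- Turns the new arbitrary elements, computed in terms of `x`, into functions of the new variable.
-/
theorem exists_smooth_factor {I : Set ℝ} (hI : IsOpenInterval I) {φ G : ℝ → ℝ}
    (hφ : ContDiffOn ℝ ∞ φ I) (hd : ∀ x ∈ I, deriv φ x ≠ 0) (hG : ContDiffOn ℝ ∞ G I) :
    ∃ g : ℝ → ℝ, ContDiffOn ℝ ∞ g (φ '' I) ∧ ∀ x ∈ I, g (φ x) = G x := by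
  obtain ⟨-, ψ, hψ, hl, -⟩ := exists_smooth_inverse hI hφ hd
  refine ⟨G ∘ ψ, hG.comp hψ ?_, fun x hx => by simp [hl x hx]⟩
  rintro _ ⟨x, hx, rfl⟩
  rw [hl x hx]
  exact hx

theorem contDiffOn_rpow_abs {E : Type*} [NormedAddCommGroup E] [NormedSpace ℝ E] {S : Set E}
    {g : E → ℝ} (hg : ContDiffOn ℝ ∞ g S) (h0 : ∀ x ∈ S, g x ≠ 0) (a : ℝ) :
    ContDiffOn ℝ ∞ (fun x => |g x| ^ a) S :=
  (contDiffOn_const.mul (hg.log h0)).exp.congr fun x hx => rpow_abs_eq_exp (h0 x hx) a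

theorem contDiffOn_zpow_neg_two {E : Type*} [NormedAddCommGroup E] [NormedSpace ℝ E] {S : Set E}
    {g : E → ℝ} (hg : ContDiffOn ℝ ∞ g S) (h0 : ∀ x ∈ S, g x ≠ 0) :
    ContDiffOn ℝ ∞ (fun x => g x ^ (-2 : ℤ)) S :=
  ((hg.pow 2).inv fun x hx => pow_ne_zero 2 (h0 x hx)).congr fun x _ => by
    rw [zpow_neg]; norm_cast

theorem contDiffOn_potential_term {I : Set ℝ} (hI : IsOpen I) {φ : ℝ → ℝ}
    (hφ : ContDiffOn ℝ ∞ φ I) (hd : ∀ x ∈ I, deriv φ x ≠ 0) :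
    ContDiffOn ℝ ∞ (iteratedDeriv 2 (fun y => |deriv φ y| ^ (-(1 / 2) : ℝ))) I := by
  have h := ((contDiffOn_rpow_abs (hφ.deriv_smooth hI) hd (-(1 / 2))).deriv_smooth hI).deriv_smooth hI
  refine h.congr fun x _ => ?_
  rw [iteratedDeriv_succ, iteratedDeriv_one]

/-- A device for nondegeneracy: along a kernel vector every component is stationary, so the entries
of the vector can be shown to vanish one at a time. -/
theorem eq_zero_of_line {E F : Type*} [NormedAddCommGroup E] [NormedSpace ℝ E]
    [NormedAddCommGroup F] [NormedSpace ℝ F] {Φ : E → F} {z v : E} {g : ℝ → ℝ} {d : ℝ}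
    (p : F →L[ℝ] ℝ) (hΦ : DifferentiableAt ℝ Φ z) (hv : fderiv ℝ Φ z v = 0)
    (hg : HasDerivAt g d 0) (he : ∀ᶠ s in 𝓝 (0:ℝ), p (Φ (z + s • v)) = g s) : d = 0 := by
  have hl : HasDerivAt (fun s : ℝ => z + s • v) v 0 := by
    simpa using ((hasDerivAt_id (0:ℝ)).smul_const v).const_add z
  have hΦ' : DifferentiableAt ℝ Φ ((fun s : ℝ => z + s • v) 0) := by simpa using hΦ
  have h1 := (p.hasFDerivAt.comp_hasDerivAt (0:ℝ) (hΦ'.hasFDerivAt.comp_hasDerivAt (0:ℝ) hl))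
  have h2 := h1.congr_of_eventuallyEq (f₁ := g) (by filter_upwards [he] with s hs using hs.symm)
  have h3 := hg.unique h2
  simp only [zero_smul, add_zero, hv, map_zero] at h3
  exact h3

theorem hasDerivAt_line (c d e : ℝ) : HasDerivAt (fun s : ℝ => c * (d + s * e)) (c * e) 0 := by
  simpa using (((hasDerivAt_id (0:ℝ)).mul_const e).const_add d).const_mul c

/-- A member of the explicit family maps equations of the class to equations of the class. -/
theorem mapsEquation_of_explicit {A I C : Set ℝ} (hA : IsOpen A) (hI : IsOpenInterval I)
    (hC : IsOpen C) {f h f' h' φ : ℝ → ℝ} {n δ₀ δ₁ δ₂ δ₃ : ℝ} {Φ : Joint → Joint}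
    (hcl : InClass I f h n) (had : AdmissibleParams I δ₀ δ₁ δ₃ φ)
    (hΦ : ∀ t ∈ A, ∀ x ∈ I, ∀ u ∈ C,
      Φ (t, x, u, f x, h x, n) = explicitTransf δ₀ δ₁ δ₂ δ₃ φ (t, x, u, f x, h x, n))
    (hf' : ContDiffOn ℝ ∞ f' (φ '' I)) (hh' : ContDiffOn ℝ ∞ h' (φ '' I))
    (hff : ∀ x ∈ I, f' (φ x) = δ₀ * δ₁ * |deriv φ x| ^ (-(3 / 2) : ℝ) * f x)
    (hhh : ∀ x ∈ I, h' (φ x) = δ₃ * (deriv φ x) ^ (-2 : ℤ) * h x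
       + δ₃ / n * |deriv φ x| ^ (-(3 / 2) : ℝ)
          * iteratedDeriv 2 (fun y => |deriv φ y| ^ (-(1 / 2) : ℝ)) x) :
    MapsEquation (A ×ˢ I ×ˢ C) Φ f h n f' h' (n / δ₃) := by
  obtain ⟨hn, hfs, hhs, hf0⟩ := hcl
  obtain ⟨p0, p1, p3, φs, dφ⟩ := had
  have hW : IsOpen (A ×ˢ I ×ˢ C) := hA.prod (hI.1.prod hC)
  set χ : ℝ → ℝ := fun x => δ₃ / (2 * n) * Real.log |δ₀ ^ 2 * deriv φ x| with hχ
  have hP : ∀ z ∈ A ×ˢ I ×ˢ C,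
      induced Φ f h n z = (δ₁ * z.1 + δ₂, φ z.2.1, δ₃ * z.2.2 + χ z.2.1) := by
    rintro ⟨t, x, u⟩ ⟨ht, hx, hu⟩
    simp only [induced, hΦ t ht x hx u hu]
    rfl
  have φ's := φs.deriv_smooth hI.1
  have φ''s := φ's.deriv_smooth hI.1
  have hχe : ∀ x ∈ I, χ x = δ₃ / (2 * n) * (2 * Real.log δ₀ + Real.log (deriv φ x)) := by
    intro x hx
    simp only [hχ]
    rw [Real.log_abs, Real.log_mul (pow_pos p0 2).ne' (dφ x hx), Real.log_pow]
    push_cast; rfl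
  have χs : ContDiffOn ℝ ∞ χ I :=
    (contDiffOn_const.mul (contDiffOn_const.add (φ's.log dφ))).congr hχe
  have hPs : ContDiffOn ℝ ∞ (induced Φ f h n) (A ×ˢ I ×ˢ C) := by
    have e1 : ContDiffOn ℝ ∞ (fun z : ℝ × ℝ × ℝ => φ z.2.1) (A ×ˢ I ×ˢ C) :=
      φs.comp (by fun_prop : ContDiffOn ℝ ∞ (fun z : ℝ × ℝ × ℝ => z.2.1) _) fun z hz => hz.2.1
    have e2 : ContDiffOn ℝ ∞ (fun z : ℝ × ℝ × ℝ => χ z.2.1) (A ×ˢ I ×ˢ C) :=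
      χs.comp (by fun_prop : ContDiffOn ℝ ∞ (fun z : ℝ × ℝ × ℝ => z.2.1) _) fun z hz => hz.2.1
    exact (((contDiffOn_const.mul contDiffOn_fst).add contDiffOn_const).prodMk
      (e1.prodMk ((contDiffOn_const.mul contDiffOn_snd.snd).add e2))).congr hP
  refine ⟨⟨div_ne_zero hn p3, ?_, ?_, ?_⟩, ?_, hPs, ?_, ?_⟩
  · refine hf'.mono ?_
    rintro _ ⟨z, hz, rfl⟩
    simp only [hP z hz]
    exact mem_image_of_mem φ hz.2.1
  · refine hh'.mono ?_
    rintro _ ⟨z, hz, rfl⟩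
    simp only [hP z hz]
    exact mem_image_of_mem φ hz.2.1
  · rintro _ ⟨z, hz, rfl⟩
    simp only [hP z hz]
    rw [hff _ hz.2.1]
    exact mul_ne_zero (mul_ne_zero (mul_ne_zero p0.ne' p1)
      (Real.rpow_pos_of_pos (abs_pos.2 (dφ _ hz.2.1)) _).ne') (hf0 _ hz.2.1)
  · rintro ⟨t, x, u⟩ ⟨ht, hx, hu⟩
    rw [hP _ ⟨ht, hx, hu⟩]
    simp only [hΦ t ht x hx u hu, hff x hx, hhh x hx]
    rfl
  · rintro ⟨t, x, u⟩ hz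
    rw [ContinuousLinearMap.det_ne_zero_iff]
    rintro ⟨a, b, c⟩ h0
    have hd : DifferentiableAt ℝ (induced Φ f h n) (t, x, u) :=
      (hPs.contDiffAt (hW.mem_nhds hz)).differentiableAt (by simp)
    have hev : ∀ v, ∀ᶠ s in 𝓝 (0:ℝ), (t, x, u) + s • v ∈ A ×ˢ I ×ˢ C := by
      intro v
      have hc : Continuous fun s : ℝ => (t, x, u) + s • v := by fun_prop
      apply hc.continuousAt.eventually
      exact hW.mem_nhds (by simpa using hz)
    have ha : a = 0 := by
      have := eq_zero_of_line (ContinuousLinearMap.fst ℝ ℝ (ℝ × ℝ)) hd h0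
        ((hasDerivAt_line δ₁ t a).add_const δ₂) (by
          filter_upwards [hev (a, b, c)] with s hs
          rw [hP _ hs]; simp)
      exact (mul_eq_zero.1 this).resolve_left p1
    have hb : b = 0 := by
      have h1 : HasDerivAt (fun s : ℝ => φ (x + s * b)) (deriv φ x * b) 0 := by
        have hl : HasDerivAt (fun s : ℝ => x + s * b) b 0 := by
          simpa using ((hasDerivAt_id (0:ℝ)).mul_const b).const_add x
        have h2 : HasDerivAt φ (deriv φ x) (x + 0 * b) := by
          simpa using φs.hasDerivAt' hI.1 hz.2.1
        exact h2.comp (0:ℝ) hl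
      have := eq_zero_of_line ((ContinuousLinearMap.fst ℝ ℝ ℝ).comp
        (ContinuousLinearMap.snd ℝ ℝ (ℝ × ℝ))) hd h0 h1 (by
          filter_upwards [hev (a, b, c)] with s hs
          rw [hP _ hs]; simp)
      exact (mul_eq_zero.1 this).resolve_left (dφ x hz.2.1)
    subst ha hb
    have hc : c = 0 := by
      have := eq_zero_of_line ((ContinuousLinearMap.snd ℝ ℝ ℝ).comp
        (ContinuousLinearMap.snd ℝ ℝ (ℝ × ℝ))) hd h0
        ((hasDerivAt_line δ₃ u c).add_const (χ x)) (by
          filter_upwards [hev (0, 0, c)] with s hs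
          rw [hP _ hs]; simp)
      exact (mul_eq_zero.1 this).resolve_left p3
    simp [hc]
  · intro t x v w hz hv hw hm
    have hx : x ∈ I := hz.2.1
    rw [hP _ hz] at hw ⊢
    simp only at hw ⊢
    have hm' : ∀ᶠ q in 𝓝 (t, x), w (δ₁ * q.1 + δ₂, φ q.2) = δ₃ * v q + χ q.2 := by
      have hc : ContinuousAt (fun q : ℝ × ℝ => (q.1, q.2, v q)) (t, x) :=
        continuousAt_fst.prodMk (continuousAt_snd.prodMk hv.continuousAt)
      have := hc.eventually (hW.mem_nhds (show (fun q : ℝ × ℝ => (q.1, q.2, v q)) (t, x) ∈ _ from hz))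
      filter_upwards [this, hm.2] with q hq1 hq2
      rwa [hP _ hq1] at hq2
    have φat : ContDiffAt ℝ ∞ φ x := φs.contDiffAt (hI.1.mem_nhds hx)
    have χat : ContDiffAt ℝ ∞ χ x := χs.contDiffAt (hI.1.mem_nhds hx)
    have ξs : ContDiffAt ℝ ∞ (fun q : ℝ × ℝ => φ q.2) (t, x) :=
      ContDiffAt.comp (g := φ) (t, x) φat contDiffAt_snd
    have ψs : ContDiffAt ℝ ∞ (fun q : ℝ × ℝ => χ q.2) (t, x) :=
      ContDiffAt.comp (g := χ) (t, x) χat contDiffAt_snd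
    obtain ⟨r1, r2, r3⟩ := split_form_jet (τ := fun s => δ₁ * s + δ₂) (ξ := fun q => φ q.2)
      (ψ := fun q => χ q.2) (k := δ₃) (by fun_prop) ξs.of_infty ψs.of_infty hv.of_infty
      hw.of_infty hm'
    have dτ : deriv (fun s => δ₁ * s + δ₂) t = δ₁ := by
      simp
    simp only [dτ, deriv_const, zero_mul, add_zero] at r1 r2 r3
    have hw0 : w (δ₁ * t + δ₂, φ x) = δ₃ * v (t, x) + χ x := hm'.self_of_nhds
    rw [satisfiesAt_iff hv.of_infty, satisfiesAt_iff hw.of_infty, hw0, hff x hx, hhh x hx]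
    have hdx := dφ x hx
    have χ' : ∀ y ∈ I, HasDerivAt χ (δ₃ / (2 * n) * (deriv (deriv φ) y / deriv φ y)) y := by
      intro y hy
      have := (((φ's.hasDerivAt' hI.1 hy).log (dφ y hy)).const_add (2 * Real.log δ₀)).const_mul
        (δ₃ / (2 * n))
      refine this.congr_of_eventuallyEq ?_
      filter_upwards [hI.1.mem_nhds hy] with z hz using hχe z hz
    have χ'' : deriv (deriv χ) x = δ₃ / (2 * n) * ((deriv (deriv (deriv φ)) x * deriv φ x -
        deriv (deriv φ) x * deriv (deriv φ) x) / deriv φ x ^ 2) := by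
      have e1 : deriv χ =ᶠ[𝓝 x] fun y => δ₃ / (2 * n) * (deriv (deriv φ) / deriv φ) y := by
        filter_upwards [hI.1.mem_nhds hx] with z hz using (χ' z hz).deriv
      rw [e1.deriv_eq]
      exact (((φ''s.hasDerivAt' hI.1 hx).div (φ's.hasDerivAt' hI.1 hx) hdx).const_mul _).deriv
    have r2' : deriv φ x * deriv (fun y => w (δ₁ * t + δ₂, y)) (φ x) =
        δ₃ * deriv (fun y => v (t, y)) x + δ₃ / (2 * n) * (deriv (deriv φ) x / deriv φ x) := by
      rw [← (χ' x hx).deriv]; exact r2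
    have r3' := r3
    change deriv φ x ^ 2 * _ + deriv (deriv φ) x * _ = δ₃ * _ + deriv (deriv χ) x at r3'
    rw [χ''] at r3'
    rw [mul_assoc (δ₃ / n), potential_term_eq hI.1 φs dφ hx]
    -- The factor `e^{n'χ} = δ₀ |φ_x|^{1/2}` is written with `|φ_x|^{-3/2} φ_x^2`, to share the
    -- factor of the new `f`.
    have hexp : Real.exp (n / δ₃ * (δ₃ * v (t, x) + χ x)) =
        Real.exp (n * v (t, x)) * (δ₀ * (|deriv φ x| ^ (-(3 / 2) : ℝ) * deriv φ x ^ 2)) := by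
      rw [rpow_abs_neg_three_halves hdx, Real.log_abs]
      conv_rhs => rw [← Real.exp_log p0, ← Real.exp_add, ← Real.exp_add]
      congr 1
      rw [hχe x hx]
      field_simp
    rw [hexp]
    set R := |deriv φ x| ^ (-(3 / 2) : ℝ) with hR
    have hR0 : R ≠ 0 := (Real.rpow_pos_of_pos (abs_pos.2 hdx) _).ne'
    set vt := deriv (fun s => v (s, x)) t
    set vx := deriv (fun y => v (t, y)) x
    set vxx := deriv (deriv fun y => v (t, y)) x
    set wT := deriv (fun s => w (s, φ x)) (δ₁ * t + δ₂)
    set wX := deriv (fun y => w (δ₁ * t + δ₂, y)) (φ x)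
    set wXX := deriv (deriv fun y => w (δ₁ * t + δ₂, y)) (φ x)
    set E := Real.exp (n * v (t, x))
    set s := deriv φ x
    set s' := deriv (deriv φ) x
    set s'' := deriv (deriv (deriv φ)) x
    have hz2 : s ^ (-2 : ℤ) = 1 / s ^ 2 := by rw [zpow_neg, one_div]; norm_cast
    rw [hz2]
    have hwX : wX = (δ₃ * vx + δ₃ / (2 * n) * (s' / s)) / s := by
      rw [← r2']; field_simp
    have hwXX : wXX = (δ₃ * vxx + δ₃ / (2 * n) * ((s'' * s - s' * s') / s ^ 2) - s' * wX) / s ^ 2 := by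
      rw [← r3']; field_simp; ring
    have main : s ^ 2 * (wXX + n / δ₃ * wX ^ 2 + (δ₃ * (1 / s ^ 2) * h x + δ₃ / n *
        ((3 / 4 * s' ^ 2 / s ^ 2 - 1 / 2 * s'' / s) / s ^ 2))) =
        δ₃ * (vxx + n * vx ^ 2 + h x) := by
      rw [hwXX, hwX]
      field_simp
      ring
    -- Both sides of the new equation are the same nonzero multiple `δ₀ R δ₃` of the sides of the
    -- old one.
    have lhs : δ₀ * δ₁ * R * f x * wT = δ₀ * R * δ₃ * (f x * vt) := by
      linear_combination δ₀ * R * f x * r1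
    have rhs : E * (δ₀ * (R * s ^ 2)) * (wXX + n / δ₃ * wX ^ 2 + (δ₃ * (1 / s ^ 2) * h x + δ₃ / n *
        ((3 / 4 * s' ^ 2 / s ^ 2 - 1 / 2 * s'' / s) / s ^ 2))) =
        δ₀ * R * δ₃ * (E * (vxx + n * vx ^ 2 + h x)) := by
      linear_combination E * δ₀ * R * main
    rw [lhs, rhs]
    exact (mul_right_inj' (mul_ne_zero (mul_ne_zero p0.ne' hR0) p3)).symm

/-- Joint smoothness in `n` and `x` of the `h` component is seen from the Schwarzian form, which
involves only three `x`-derivatives of `φ`. For fixed `n` the claim about equations is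
`mapsEquation_of_explicit`. -/
theorem HasExplicitForm.isGeneralizedEquivalence {D : Box} {Φ : Joint → Joint}
    (hΦ : HasExplicitForm D Φ) : IsGeneralizedEquivalence D Φ := by
  obtain ⟨δ₀, δ₁, δ₂, δ₃, φ, s0, s1, s2, s3, φs, had, hform⟩ := hΦ
  have n0 : ∀ n ∈ D.n, n ≠ 0 := fun n hn h => D.n_ne (h ▸ hn)
  have hNX : IsOpen (D.n ×ˢ D.x) := D.hn.1.prod D.hx.1
  have hs : ContDiffOn ℝ ∞ Φ D.toSet := by
    have pn : ContDiffOn ℝ ∞ (fun z : Joint => z.2.2.2.2.2) D.toSet := by fun_prop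
    have pt : ContDiffOn ℝ ∞ (fun z : Joint => z.1) D.toSet := by fun_prop
    have pu : ContDiffOn ℝ ∞ (fun z : Joint => z.2.2.1) D.toSet := by fun_prop
    have pf : ContDiffOn ℝ ∞ (fun z : Joint => z.2.2.2.1) D.toSet := by fun_prop
    have ph : ContDiffOn ℝ ∞ (fun z : Joint => z.2.2.2.2.1) D.toSet := by fun_prop
    have pnx : ContDiffOn ℝ ∞ (fun z : Joint => (z.2.2.2.2.2, z.2.1)) D.toSet := by fun_prop
    have mn : MapsTo (fun z : Joint => z.2.2.2.2.2) D.toSet D.n := fun z hz => hz.2.2.2.2.2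
    have mnx : MapsTo (fun z : Joint => (z.2.2.2.2.2, z.2.1)) D.toSet (D.n ×ˢ D.x) :=
      fun z hz => ⟨hz.2.2.2.2.2, hz.2.1⟩
    have c0 : ContDiffOn ℝ ∞ (fun z : Joint => δ₀ z.2.2.2.2.2) D.toSet := s0.comp pn mn
    have c1 : ContDiffOn ℝ ∞ (fun z : Joint => δ₁ z.2.2.2.2.2) D.toSet := s1.comp pn mn
    have c2 : ContDiffOn ℝ ∞ (fun z : Joint => δ₂ z.2.2.2.2.2) D.toSet := s2.comp pn mn
    have c3 : ContDiffOn ℝ ∞ (fun z : Joint => δ₃ z.2.2.2.2.2) D.toSet := s3.comp pn mn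
    have f0 : ContDiffOn ℝ ∞ (fun z : Joint => φ z.2.2.2.2.2 z.2.1) D.toSet := φs.comp pnx mnx
    have φ1 := contDiffOn_deriv_param hNX φs
    have φ2 := contDiffOn_deriv_param (φ := fun n => deriv (φ n)) hNX φ1
    have φ3 := contDiffOn_deriv_param (φ := fun n => deriv (deriv (φ n))) hNX φ2
    have f1 : ContDiffOn ℝ ∞ (fun z : Joint => deriv (φ z.2.2.2.2.2) z.2.1) D.toSet :=
      φ1.comp pnx mnx
    have f2 : ContDiffOn ℝ ∞ (fun z : Joint => deriv (deriv (φ z.2.2.2.2.2)) z.2.1) D.toSet :=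
      φ2.comp pnx mnx
    have f3 : ContDiffOn ℝ ∞ (fun z : Joint => deriv (deriv (deriv (φ z.2.2.2.2.2))) z.2.1)
      D.toSet := φ3.comp pnx mnx
    have nz : ∀ z ∈ D.toSet, deriv (φ z.2.2.2.2.2) z.2.1 ≠ 0 := fun z hz =>
      (had _ hz.2.2.2.2.2).1.2.2.2.2 _ hz.2.1
    have d0 : ∀ z ∈ D.toSet, δ₀ z.2.2.2.2.2 ^ 2 * deriv (φ z.2.2.2.2.2) z.2.1 ≠ 0 := fun z hz =>
      mul_ne_zero (pow_pos (had _ hz.2.2.2.2.2).1.1 2).ne' (nz z hz)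
    have d3 : ∀ z ∈ D.toSet, δ₃ z.2.2.2.2.2 ≠ 0 := fun z hz => (had _ hz.2.2.2.2.2).1.2.2.1
    have zn : ∀ z ∈ D.toSet, z.2.2.2.2.2 ≠ 0 := fun z hz => n0 _ hz.2.2.2.2.2
    have z2n : ∀ z ∈ D.toSet, 2 * z.2.2.2.2.2 ≠ 0 := fun z hz => mul_ne_zero two_ne_zero (zn z hz)
    have nz2 : ∀ z ∈ D.toSet, deriv (φ z.2.2.2.2.2) z.2.1 ^ 2 ≠ 0 := fun z hz =>
      pow_ne_zero 2 (nz z hz)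
    have g3 := (c3.mul pu).add ((c3.div (contDiffOn_const.mul pn) z2n).mul
      (((c0.pow 2).mul f1).log d0))
    have g4 := ((c0.mul c1).mul (contDiffOn_rpow_abs f1 nz (-(3 / 2)))).mul pf
    have g5 := ((c3.mul (contDiffOn_zpow_neg_two f1 nz)).mul ph).add ((c3.div pn zn).mul
      ((((contDiffOn_const (c := (3 / 4 : ℝ))).mul (f2.pow 2)).div (f1.pow 2) nz2).sub
        (((contDiffOn_const (c := (1 / 2 : ℝ))).mul f3).div f1 nz) |>.div (f1.pow 2) nz2))
    refine (((c1.mul pt).add c2).prodMk (f0.prodMk (g3.prodMk (g4.prodMk (g5.prodMk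
      (pn.div c3 d3)))))).congr ?_
    rintro ⟨t, x, u, f, h, n⟩ hz
    rw [hform _ hz]
    simp only [explicitTransf, Real.log_abs]
    rw [mul_assoc (δ₃ n / n), potential_term_eq D.hx.1 (had n hz.2.2.2.2.2).1.2.2.2.1
      (had n hz.2.2.2.2.2).1.2.2.2.2 hz.2.1]
    rfl
  refine ⟨hs, ?_, ?_⟩
  · rintro ⟨t, x, u, f, h, n⟩ hz
    obtain ⟨⟨p0, p1, p3, φns, dφ⟩, hN⟩ := had n hz.2.2.2.2.2
    have hdx := dφ x hz.2.1
    rw [ContinuousLinearMap.det_ne_zero_iff]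
    rintro ⟨a, b, c, d, e, g⟩ h0
    have hd : DifferentiableAt ℝ Φ (t, x, u, f, h, n) :=
      (hs.contDiffAt (D.isOpen.mem_nhds hz)).differentiableAt (by simp)
    have hev : ∀ v, ∀ᶠ s in 𝓝 (0:ℝ), Φ ((t, x, u, f, h, n) + s • v) =
        explicitTransf (δ₀ (n + s * v.2.2.2.2.2)) (δ₁ (n + s * v.2.2.2.2.2))
          (δ₂ (n + s * v.2.2.2.2.2)) (δ₃ (n + s * v.2.2.2.2.2)) (φ (n + s * v.2.2.2.2.2))
          ((t, x, u, f, h, n) + s • v) := by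
      intro v
      have hc : Continuous fun s : ℝ => (t, x, u, f, h, n) + s • v := by fun_prop
      have : ∀ᶠ s in 𝓝 (0:ℝ), (t, x, u, f, h, n) + s • v ∈ D.toSet := by
        apply hc.continuousAt.eventually
        exact D.isOpen.mem_nhds (by simpa using hz)
      filter_upwards [this] with s hs
      exact hform _ hs
    have hline : ∀ a b : ℝ, HasDerivAt (fun s : ℝ => a + s * b) b 0 := fun a b => by
      simpa using ((hasDerivAt_id (0:ℝ)).mul_const b).const_add a
    let P₂ : ∀ {F : Type} [NormedAddCommGroup F] [NormedSpace ℝ F], ℝ × F →L[ℝ] F :=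
      ContinuousLinearMap.snd ℝ ℝ _
    -- The `n` entry comes first: once it vanishes, the parameters are frozen along the line. The
    -- `x` entry must vanish before those of `u`, `f` and `h`, as `φ_x` enters these components.
    have hg : g = 0 := by
      have h1 : HasDerivAt (fun k => k / δ₃ k) (deriv (fun k => k / δ₃ k) n) (n + 0 * g) := by
        have h2 : DifferentiableAt ℝ (fun k => k / δ₃ k) n :=
          ((hasDerivAt_id n).div (s3.hasDerivAt' D.hn.1 hz.2.2.2.2.2) p3).differentiableAt
        rw [zero_mul, add_zero]
        exact h2.hasDerivAt
      have h2 := h1.comp (0:ℝ) (hline n g)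
      have := eq_zero_of_line ((((P₂.comp P₂).comp P₂).comp P₂).comp P₂) hd h0 h2 (by
          filter_upwards [hev (a, b, c, d, e, g)] with s hs
          rw [hs]; simp [explicitTransf, P₂])
      exact (mul_eq_zero.1 this).resolve_left hN
    subst hg
    have ha : a = 0 := by
      have := eq_zero_of_line (ContinuousLinearMap.fst ℝ ℝ (ℝ × ℝ × ℝ × ℝ × ℝ)) hd h0
        ((hasDerivAt_line (δ₁ n) t a).add_const (δ₂ n)) (by
          filter_upwards [hev (a, b, c, d, e, 0)] with s hs
          rw [hs]; simp [explicitTransf])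
      exact (mul_eq_zero.1 this).resolve_left p1
    have hb : b = 0 := by
      have h1 : HasDerivAt (φ n) (deriv (φ n) x) (x + 0 * b) := by
        simpa using φns.hasDerivAt' D.hx.1 hz.2.1
      have h2 := h1.comp (0:ℝ) (hline x b)
      have := eq_zero_of_line ((ContinuousLinearMap.fst ℝ ℝ (ℝ × ℝ × ℝ × ℝ)).comp P₂) hd h0 h2 (by
          filter_upwards [hev (a, b, c, d, e, 0)] with s hs
          rw [hs]; simp [explicitTransf, P₂])
      exact (mul_eq_zero.1 this).resolve_left hdx
    subst ha hb
    have hc : c = 0 := by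
      have := eq_zero_of_line
        (((ContinuousLinearMap.fst ℝ ℝ (ℝ × ℝ × ℝ)).comp P₂).comp P₂) hd h0
        ((hasDerivAt_line (δ₃ n) u c).add_const
          (δ₃ n / (2 * n) * Real.log |δ₀ n ^ 2 * deriv (φ n) x|)) (by
          filter_upwards [hev (0, 0, c, d, e, 0)] with s hs
          rw [hs]; simp [explicitTransf, P₂])
      exact (mul_eq_zero.1 this).resolve_left p3
    have hdd : d = 0 := by
      have := eq_zero_of_line
        ((((ContinuousLinearMap.fst ℝ ℝ (ℝ × ℝ)).comp P₂).comp P₂).comp P₂) hd h0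
        (hasDerivAt_line (δ₀ n * δ₁ n * |deriv (φ n) x| ^ (-(3 / 2) : ℝ)) f d) (by
          filter_upwards [hev (0, 0, c, d, e, 0)] with s hs
          rw [hs]; simp [explicitTransf, P₂])
      exact (mul_eq_zero.1 this).resolve_left (mul_ne_zero (mul_ne_zero p0.ne' p1)
        (Real.rpow_pos_of_pos (abs_pos.2 hdx) _).ne')
    have he : e = 0 := by
      have := eq_zero_of_line
        (((((ContinuousLinearMap.fst ℝ ℝ ℝ).comp P₂).comp P₂).comp P₂).comp P₂) hd h0
        ((hasDerivAt_line (δ₃ n * deriv (φ n) x ^ (-2 : ℤ)) h e).add_const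
          (δ₃ n / n * |deriv (φ n) x| ^ (-(3 / 2) : ℝ)
            * iteratedDeriv 2 (fun y => |deriv (φ n) y| ^ (-(1 / 2) : ℝ)) x)) (by
          filter_upwards [hev (0, 0, c, d, e, 0)] with s hs
          rw [hs]; simp [explicitTransf, P₂])
      exact (mul_eq_zero.1 this).resolve_left (mul_ne_zero p3 (zpow_ne_zero _ hdx))
    simp [hc, hdd, he]
  · intro f h n hcl hfm hhm hn
    obtain ⟨⟨p0, p1, p3, φns, dφ⟩, -⟩ := had n hn
    have φ1 := φns.deriv_smooth D.hx.1
    obtain ⟨f', hf's, hf'⟩ := exists_smooth_factor D.hx φns dφ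
      ((contDiffOn_const (c := δ₀ n * δ₁ n)).mul (contDiffOn_rpow_abs φ1 dφ (-(3 / 2))) |>.mul
        hcl.2.1)
    obtain ⟨h', hh's, hh'⟩ := exists_smooth_factor D.hx φns dφ
      ((((contDiffOn_const (c := δ₃ n)).mul (contDiffOn_zpow_neg_two φ1 dφ)).mul hcl.2.2.1).add
        (((contDiffOn_const (c := δ₃ n / n)).mul (contDiffOn_rpow_abs φ1 dφ (-(3 / 2)))).mul
          (contDiffOn_potential_term D.hx.1 φns dφ)))
    exact ⟨f', h', n / δ₃ n, mapsEquation_of_explicit (δ₂ := δ₂ n) D.ht.1 D.hx D.hu.1 hcl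
      ⟨p0, p1, p3, φns, dφ⟩ (fun t ht x hx u hu =>
        hform (t, x, u, f x, h x, n) ⟨ht, hx, hu, hfm hx, hhm hx, hn⟩)
      hf's hh's hf' hh'⟩

theorem IsExplicit.isGeneralizedEquivalence {I : Set ℝ} {Φ : Joint → Joint} (hΦ : IsExplicit I Φ)
    {D : Box} (hD : D.toSet ⊆ jointOver I) : IsGeneralizedEquivalence D Φ := by
  obtain ⟨δ₀, δ₁, δ₂, δ₃, φ, ⟨p0, p1, p3, φs, dφ⟩, heq⟩ := hΦ
  have hx : D.x ⊆ I := by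
    intro x hx
    obtain ⟨t, ht⟩ := D.ht.2.2
    obtain ⟨u, hu⟩ := D.hu.2.2
    obtain ⟨f, hf⟩ := D.hf.2.2
    obtain ⟨h, hh⟩ := D.hh.2.2
    obtain ⟨n, hn⟩ := D.hn.2.2
    exact (hD (show (t, x, u, f, h, n) ∈ D.toSet from ⟨ht, hx, hu, hf, hh, hn⟩)).1
  refine HasExplicitForm.isGeneralizedEquivalence ⟨fun _ => δ₀, fun _ => δ₁, fun _ => δ₂,
    fun _ => δ₃, fun _ => φ, contDiffOn_const, contDiffOn_const, contDiffOn_const, contDiffOn_const,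
    φs.comp (by fun_prop) fun q hq => hx hq.2,
    fun n hn => ⟨⟨p0, p1, p3, φs.mono hx, fun x h => dφ x (hx h)⟩, ?_⟩, fun z hz => heq (hD hz)⟩
  have := ((hasDerivAt_id n).div_const δ₃).deriv
  simp only [id] at this
  rw [this]
  exact one_div_ne_zero p3

/-! ### The pseudogroup structure of the family with constant parameters. -/

theorem explicitTransf_of_eqOn_id {I : Set ℝ} (hI : IsOpen I) {χ : ℝ → ℝ} (hχ : EqOn χ id I)
    {z : Joint} (hz : z ∈ jointOver I) : explicitTransf 1 1 0 1 χ z = z := by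
  obtain ⟨t, x, u, f, h, n⟩ := z
  have hx : x ∈ I := hz.1
  have hd : ∀ y ∈ I, deriv χ y = 1 := by
    intro y hy
    have : χ =ᶠ[𝓝 y] id := by filter_upwards [hI.mem_nhds hy] with z hz using hχ hz
    rw [this.deriv_eq, deriv_id]
  have e : iteratedDeriv 2 (fun y => |deriv χ y| ^ (-(1 / 2) : ℝ)) x = 0 := by
    have : (fun y => |deriv χ y| ^ (-(1 / 2) : ℝ)) =ᶠ[𝓝 x] fun _ => 1 := by
      filter_upwards [hI.mem_nhds hx] with y hy
      simp [hd y hy]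
    rw [this.iteratedDeriv_eq]
    simp [iteratedDeriv_const]
  simp only [explicitTransf]
  rw [e, hd x hx, hχ hx]
  simp

theorem mapsTo_explicitTransf {I J : Set ℝ} {δ₀ δ₁ δ₂ δ₃ : ℝ} {φ : ℝ → ℝ}
    (had : AdmissibleParams I δ₀ δ₁ δ₃ φ) (hIJ : MapsTo φ I J) :
    MapsTo (explicitTransf δ₀ δ₁ δ₂ δ₃ φ) (jointOver I) (jointOver J) := by
  rintro ⟨t, x, u, f, h, n⟩ ⟨hx, hf, hn⟩
  exact ⟨hIJ hx, mul_ne_zero (mul_ne_zero (mul_ne_zero had.1.ne' had.2.1)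
    (Real.rpow_pos_of_pos (abs_pos.2 (had.2.2.2.2 x hx)) _).ne') hf, div_ne_zero hn had.2.2.1⟩

/-- The composition of two members of the explicit family. -/
theorem explicitTransf_comp {I J : Set ℝ} (hI : IsOpen I) (hJ : IsOpen J)
    {δ₀ δ₁ δ₂ δ₃ ε₀ ε₁ ε₂ ε₃ : ℝ} {φ ψ : ℝ → ℝ} (hφ : AdmissibleParams I δ₀ δ₁ δ₃ φ)
    (hψ : AdmissibleParams J ε₀ ε₁ ε₃ ψ) (hIJ : MapsTo φ I J) :
    AdmissibleParams I (ε₀ * δ₀) (ε₁ * δ₁) (ε₃ * δ₃) (ψ ∘ φ) ∧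
    ∀ z ∈ jointOver I, explicitTransf ε₀ ε₁ ε₂ ε₃ ψ (explicitTransf δ₀ δ₁ δ₂ δ₃ φ z) =
      explicitTransf (ε₀ * δ₀) (ε₁ * δ₁) (ε₁ * δ₂ + ε₂) (ε₃ * δ₃) (ψ ∘ φ) z := by
  obtain ⟨p0, p1, p3, φs, dφ⟩ := hφ
  obtain ⟨q0, q1, q3, ψs, dψ⟩ := hψ
  have φ1 := φs.deriv_smooth hI
  have φ2 := φ1.deriv_smooth hI
  have ψ1 := ψs.deriv_smooth hJ
  have ψ2 := ψ1.deriv_smooth hJ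
  have D1 : ∀ x ∈ I, deriv (ψ ∘ φ) x = deriv ψ (φ x) * deriv φ x := fun x hx =>
    ((ψs.hasDerivAt' hJ (hIJ hx)).comp x (φs.hasDerivAt' hI hx)).deriv
  have D2 : ∀ x ∈ I, deriv (deriv (ψ ∘ φ)) x = deriv (deriv ψ) (φ x) * deriv φ x * deriv φ x +
      deriv ψ (φ x) * deriv (deriv φ) x := by
    intro x hx
    have e : deriv (ψ ∘ φ) =ᶠ[𝓝 x] fun x => deriv ψ (φ x) * deriv φ x := by
      filter_upwards [hI.mem_nhds hx] with y hy using D1 y hy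
    rw [e.deriv_eq]
    exact (((ψ1.hasDerivAt' hJ (hIJ hx)).comp x (φs.hasDerivAt' hI hx)).mul
      (φ1.hasDerivAt' hI hx)).deriv
  have D3 : ∀ x ∈ I, deriv (deriv (deriv (ψ ∘ φ))) x =
      ((deriv (deriv (deriv ψ)) (φ x) * deriv φ x * deriv φ x +
        deriv (deriv ψ) (φ x) * deriv (deriv φ) x) * deriv φ x +
        deriv (deriv ψ) (φ x) * deriv φ x * deriv (deriv φ) x) +
      (deriv (deriv ψ) (φ x) * deriv φ x * deriv (deriv φ) x +
        deriv ψ (φ x) * deriv (deriv (deriv φ)) x) := by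
    intro x hx
    have e : deriv (deriv (ψ ∘ φ)) =ᶠ[𝓝 x] fun x =>
        deriv (deriv ψ) (φ x) * deriv φ x * deriv φ x + deriv ψ (φ x) * deriv (deriv φ) x := by
      filter_upwards [hI.mem_nhds hx] with y hy using D2 y hy
    rw [e.deriv_eq]
    have a1 := φs.hasDerivAt' hI hx
    have a2 := φ1.hasDerivAt' hI hx
    have a3 := φ2.hasDerivAt' hI hx
    have b1 := (ψ1.hasDerivAt' hJ (hIJ hx)).comp x a1
    have b2 := (ψ2.hasDerivAt' hJ (hIJ hx)).comp x a1
    have := (((b2.mul a2).mul a2).add (b1.mul a3)).deriv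
    refine Eq.trans ?_ (this.trans ?_)
    · rfl
    · simp only [Function.comp, Pi.mul_apply]
  have cs : ContDiffOn ℝ ∞ (ψ ∘ φ) I := ψs.comp φs hIJ
  have cd : ∀ x ∈ I, deriv (ψ ∘ φ) x ≠ 0 := fun x hx => by
    rw [D1 x hx]; exact mul_ne_zero (dψ _ (hIJ hx)) (dφ x hx)
  refine ⟨⟨mul_pos q0 p0, mul_ne_zero q1 p1, mul_ne_zero q3 p3, cs, cd⟩, ?_⟩
  rintro ⟨t, x, u, f, h, n⟩ ⟨hx, hf, hn⟩
  replace hx : x ∈ I := hx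
  replace hn : n ≠ 0 := hn
  have ha := dψ _ (hIJ hx)
  have hb := dφ x hx
  simp only [explicitTransf, Prod.mk.injEq]
  -- With the potential terms expressed through derivatives of `φ` and `ψ`, the `h` component
  -- becomes the cocycle identity of the Schwarzian, an algebraic consequence of `D1`, `D2`, `D3`.
  rw [mul_assoc (ε₃ * δ₃ / n), mul_assoc (δ₃ / n), mul_assoc (ε₃ / (n / δ₃)),
    potential_term_eq hI cs cd hx, potential_term_eq hI φs dφ hx, potential_term_eq hJ ψs dψ (hIJ hx),
    D3 x hx, D2 x hx, D1 x hx]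
  refine ⟨by ring, rfl, ?_, ?_, ?_, ?_⟩
  · simp only [Real.log_abs]
    rw [Real.log_mul (pow_pos p0 2).ne' hb, Real.log_mul (pow_pos q0 2).ne' ha,
      Real.log_mul (pow_pos (mul_pos q0 p0) 2).ne' (mul_ne_zero ha hb), Real.log_mul ha hb,
      Real.log_pow, Real.log_pow, Real.log_pow, Real.log_mul q0.ne' p0.ne']
    field_simp
    ring
  · rw [abs_mul, Real.mul_rpow (abs_nonneg _) (abs_nonneg _)]
    ring
  · simp only [zpow_neg]
    norm_cast
    field_simp
    ring
  · field_simp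

theorem isExplicit_id {I : Set ℝ} (hI : IsOpenInterval I) : IsExplicit I id :=
  ⟨1, 1, 0, 1, id, ⟨one_pos, one_ne_zero, one_ne_zero, contDiffOn_id, fun x _ => by simp⟩,
    fun _ hz => (explicitTransf_of_eqOn_id hI.1 (fun _ _ => rfl) hz).symm⟩

theorem IsExplicit.comp {I J : Set ℝ} (hI : IsOpenInterval I) (hJ : IsOpenInterval J)
    {Φ Ψ : Joint → Joint} (hΦ : IsExplicit I Φ) (hΨ : IsExplicit J Ψ)
    (hm : MapsTo Φ (jointOver I) (jointOver J)) : IsExplicit I (Ψ ∘ Φ) := by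
  obtain ⟨δ₀, δ₁, δ₂, δ₃, φ, hφ, eφ⟩ := hΦ
  obtain ⟨ε₀, ε₁, ε₂, ε₃, ψ, hψ, eψ⟩ := hΨ
  have hIJ : MapsTo φ I J := by
    intro x hx
    -- Any point over `x` with nonzero `f` and `n` shows that `φ x` lies in `J`.
    have hz : ((0, x, 0, 1, 0, 1) : Joint) ∈ jointOver I := ⟨hx, one_ne_zero, one_ne_zero⟩
    have := (hm hz).1
    rw [eφ hz] at this
    exact this
  obtain ⟨had, hcomp⟩ := explicitTransf_comp hI.1 hJ.1 (δ₂ := δ₂) (ε₂ := ε₂) hφ hψ hIJ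
  refine ⟨_, _, ε₁ * δ₂ + ε₂, _, _, had, fun z hz => ?_⟩
  rw [← hcomp z hz, Function.comp, eψ (hm hz), eφ hz]

theorem IsExplicit.exists_inverse {I : Set ℝ} (hI : IsOpenInterval I) {Φ : Joint → Joint}
    (hΦ : IsExplicit I Φ) :
    ∃ (J : Set ℝ) (Ψ : Joint → Joint), IsOpenInterval J ∧ IsExplicit J Ψ ∧
        MapsTo Φ (jointOver I) (jointOver J) ∧ MapsTo Ψ (jointOver J) (jointOver I) ∧
        InvOn Ψ Φ (jointOver I) (jointOver J) := by
  obtain ⟨δ₀, δ₁, δ₂, δ₃, φ, hφ, eφ⟩ := hΦ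
  obtain ⟨hJ, ψ, ψs, hl, hψd⟩ := exists_smooth_inverse hI hφ.2.2.2.1 hφ.2.2.2.2
  obtain ⟨p0, p1, p3, φs, dφ⟩ := id hφ
  have hψ : AdmissibleParams (φ '' I) δ₀⁻¹ δ₁⁻¹ δ₃⁻¹ ψ := by
    refine ⟨inv_pos.2 p0, inv_ne_zero p1, inv_ne_zero p3, ψs, ?_⟩
    rintro _ ⟨x, hx, rfl⟩
    rw [(hψd x hx).deriv]
    exact inv_ne_zero (dφ x hx)
  have mφ : MapsTo φ I (φ '' I) := mapsTo_image φ I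
  have mψ : MapsTo ψ (φ '' I) I := by
    rintro _ ⟨x, hx, rfl⟩
    rw [hl x hx]
    exact hx
  -- The value of `δ₂` for the inverse solves `δ₁⁻¹ (δ₁ t + δ₂) + ε₂ = t`.
  have MΨ := mapsTo_explicitTransf (δ₂ := -(δ₁⁻¹ * δ₂)) hψ mψ
  have MΦ : MapsTo Φ (jointOver I) (jointOver (φ '' I)) := fun z hz => by
    rw [eφ hz]; exact mapsTo_explicitTransf hφ mφ hz
  refine ⟨φ '' I, explicitTransf δ₀⁻¹ δ₁⁻¹ (-(δ₁⁻¹ * δ₂)) δ₃⁻¹ ψ, hJ,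
    ⟨_, _, _, _, _, hψ, fun _ _ => rfl⟩, MΦ, MΨ, ?_, ?_⟩
  · intro z hz
    rw [eφ hz, (explicitTransf_comp hI.1 hJ.1 hφ hψ mφ).2 z hz, inv_mul_cancel₀ p0.ne',
      inv_mul_cancel₀ p1, inv_mul_cancel₀ p3, add_neg_cancel]
    exact explicitTransf_of_eqOn_id hI.1 (fun x hx => hl x hx) hz
  · intro z hz
    rw [eφ (MΨ hz), (explicitTransf_comp hJ.1 hI.1 hψ hφ mψ).2 z hz, mul_inv_cancel₀ p0.ne',
      mul_inv_cancel₀ p1, mul_inv_cancel₀ p3,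
      show δ₁ * -(δ₁⁻¹ * δ₂) + δ₂ = 0 by field_simp; ring]
    refine explicitTransf_of_eqOn_id hJ.1 ?_ hz
    rintro _ ⟨x, hx, rfl⟩
    simp [hl x hx]

/-! ### The gauges `f = 1` and `h = 0`. -/

theorem IsOpenInterval.exists_antiderivative {I : Set ℝ} (hI : IsOpenInterval I) {g : ℝ → ℝ}
    (hg : ContDiffOn ℝ ∞ g I) :
    ∃ G : ℝ → ℝ, ContDiffOn ℝ ∞ G I ∧ ∀ x ∈ I, HasDerivAt G (g x) x := by
  obtain ⟨x₀, hx₀⟩ := hI.2.2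
  have hd : ∀ x ∈ I, HasDerivAt (fun x => ∫ y in x₀..x, g y) (g x) x := by
    intro x hx
    have hsub : uIcc x₀ x ⊆ I := hI.2.1.uIcc_subset hx₀ hx
    exact intervalIntegral.integral_hasDerivAt_right
      (hg.continuousOn.mono hsub).intervalIntegrable
      (hg.continuousOn.stronglyMeasurableAtFilter hI.1 x hx)
      (hg.continuousOn.continuousAt (hI.1.mem_nhds hx))
  refine ⟨_, (contDiffOn_infty_iff_deriv_of_isOpen hI.1).2
    ⟨fun x hx => (hd x hx).differentiableAt.differentiableWithinAt, ?_⟩, hd⟩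
  exact hg.congr fun x hx => (hd x hx).deriv

/-- With `δ₀ = 1` the new `f` is `δ₁ |φ_x|^{-3/2} f`. On an interval `f` has constant sign `σ`, so
`δ₁ = σ` and `φ_x = |f|^{2/3}` make it 1; taking `δ₃ = 1` keeps `n`. -/
theorem exists_gauge_f_eq_one {I : Set ℝ} (hI : IsOpenInterval I) {f h : ℝ → ℝ} {n : ℝ}
    (hcl : InClass I f h n) : ∃ (Φ : Joint → Joint) (h' : ℝ → ℝ), IsExplicit I Φ ∧
        MapsEquation (univ ×ˢ I ×ˢ univ) Φ f h n (fun _ => 1) h' n := by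
  obtain ⟨hn, hf, hh, hf0⟩ := id hcl
  obtain ⟨σ, hσ0, hσ⟩ : ∃ σ : ℝ, σ ≠ 0 ∧ ∀ x ∈ I, |f x| = σ * f x := by
    rcases hI.2.1.isPreconnected.eq_or_eq_neg_of_sq_eq (f := fun x => |f x|) (g := f)
      hf.continuousOn.abs hf.continuousOn (fun x _ => by simp) (fun {x} hx => hf0 x hx) with h1 | h1
    · exact ⟨1, one_ne_zero, fun x hx => by simpa using h1 hx⟩
    · exact ⟨-1, by norm_num, fun x hx => by simpa using h1 hx⟩
  obtain ⟨φ, φs, hφ⟩ := hI.exists_antiderivative (contDiffOn_rpow_abs hf hf0 (2 / 3))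
  have hd : ∀ x ∈ I, deriv φ x = |f x| ^ (2 / 3 : ℝ) := fun x hx => (hφ x hx).deriv
  have dφ : ∀ x ∈ I, deriv φ x ≠ 0 := fun x hx => by
    rw [hd x hx]; exact (Real.rpow_pos_of_pos (abs_pos.2 (hf0 x hx)) _).ne'
  have had : AdmissibleParams I 1 σ 1 φ := ⟨one_pos, hσ0, one_ne_zero, φs, dφ⟩
  have φ1 := φs.deriv_smooth hI.1
  obtain ⟨h', hh's, hh'⟩ := exists_smooth_factor hI φs dφ
      ((((contDiffOn_const (c := (1:ℝ))).mul (contDiffOn_zpow_neg_two φ1 dφ)).mul hh).add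
        (((contDiffOn_const (c := 1 / n)).mul (contDiffOn_rpow_abs φ1 dφ (-(3 / 2)))).mul
          (contDiffOn_potential_term hI.1 φs dφ)))
  refine ⟨explicitTransf 1 σ 0 1 φ, h', ⟨_, _, _, _, _, had, fun _ _ => rfl⟩, ?_⟩
  have := mapsEquation_of_explicit (f' := fun _ => 1) isOpen_univ hI isOpen_univ hcl had
    (Φ := explicitTransf 1 σ 0 1 φ) (fun _ _ _ _ _ _ => rfl) contDiffOn_const hh's ?_ hh'
  · rwa [div_one] at this
  · intro x hx
    have ha := abs_pos.2 (hf0 x hx)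
    rw [hd x hx, abs_of_pos (Real.rpow_pos_of_pos ha _), ← Real.rpow_mul ha.le,
      show (2 / 3 : ℝ) * -(3 / 2) = -1 by norm_num, Real.rpow_neg_one]
    have := hσ x hx
    field_simp
    linarith

/-- The initial data are `y = 1`, `y' = 0` at `x₀`. The linear equation is solved as an autonomous
system for `(x, y, y')`, and positivity near `x₀` follows from continuity. -/
theorem exists_positive_solution {I : Set ℝ} (hI : IsOpen I) {q : ℝ → ℝ}
    (hq : ContDiffOn ℝ ∞ q I) {x₀ : ℝ} (hx₀ : x₀ ∈ I) :
    ∃ (I' : Set ℝ) (y : ℝ → ℝ), IsOpenInterval I' ∧ I' ⊆ I ∧ x₀ ∈ I' ∧ ContDiffOn ℝ ∞ y I' ∧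
      ∀ x ∈ I', 0 < y x ∧ deriv (deriv y) x = q x * y x := by
  let V : ℝ × ℝ × ℝ → ℝ × ℝ × ℝ := fun p => (1, p.2.2, q p.1 * p.2.1)
  have hV : ContDiffAt ℝ 1 V (x₀, 1, 0) := by
    have h1 : ContDiffAt ℝ 1 (fun p : ℝ × ℝ × ℝ => q p.1) (x₀, 1, 0) :=
      ContDiffAt.comp (g := q) (x₀, 1, 0) ((hq.contDiffAt (hI.mem_nhds hx₀)).of_le (by simp))
        contDiffAt_fst
    exact contDiffAt_const.prodMk (contDiffAt_snd.snd.prodMk (h1.mul contDiffAt_snd.fst))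
  obtain ⟨α, hα0, ε, hε, hα⟩ :=
    hV.exists_forall_mem_closedBall_exists_eq_forall_mem_Ioo_hasDerivAt₀ x₀
  have hJ : IsOpenInterval (Ioo (x₀ - ε) (x₀ + ε)) :=
    ⟨isOpen_Ioo, ordConnected_Ioo, ⟨x₀, by simp [hε]⟩⟩
  have hx₀J : x₀ ∈ Ioo (x₀ - ε) (x₀ + ε) := by simp [hε]
  -- The first coordinate has derivative 1 and starts at `x₀`, so it is `x` itself.
  have h1 : ∀ x ∈ Ioo (x₀ - ε) (x₀ + ε), (α x).1 = x := by
    intro x hx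
    have : (α x).1 - x = (α x₀).1 - x₀ :=
      hJ.eq_of_deriv_eq_zero (g := fun x => (α x).1 - x) (fun z hz => by
        have h : HasDerivAt (fun x => (α x).1) 1 z := (hα z hz).fst
        have := h.sub (hasDerivAt_id z)
        rwa [sub_self] at this) hx hx₀J
    rw [hα0] at this
    linarith
  have hy : ∀ x ∈ Ioo (x₀ - ε) (x₀ + ε), HasDerivAt (fun x => (α x).2.1) (α x).2.2 x :=
    fun x hx => (hα x hx).snd.fst
  have hz : ∀ x ∈ Ioo (x₀ - ε) (x₀ + ε), HasDerivAt (fun x => (α x).2.2) (q x * (α x).2.1) x := by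
    intro x hx
    have := (hα x hx).snd.snd
    simp only [V, h1 x hx] at this
    exact this
  have hpos : ∀ᶠ x in 𝓝 x₀, 0 < (α x).2.1 := by
    apply (hy x₀ hx₀J).continuousAt.eventually
    apply lt_mem_nhds
    simp [hα0]
  obtain ⟨r, hr, hball⟩ := Metric.mem_nhds_iff.1 (Filter.inter_mem (Filter.inter_mem
    (hI.mem_nhds hx₀) (isOpen_Ioo.mem_nhds hx₀J)) hpos)
  rw [Real.ball_eq_Ioo] at hball
  have hI'J : Ioo (x₀ - r) (x₀ + r) ⊆ Ioo (x₀ - ε) (x₀ + ε) := fun x hx => (hball hx).1.2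
  have hI'I : Ioo (x₀ - r) (x₀ + r) ⊆ I := fun x hx => (hball hx).1.1
  -- Bootstrap: if `y` and `y'` are of class `C^k`, so are their derivatives `y'` and `q y`.
  have reg : ∀ k : ℕ, ContDiffOn ℝ k (fun x => (α x).2.1) (Ioo (x₀ - r) (x₀ + r)) ∧
      ContDiffOn ℝ k (fun x => (α x).2.2) (Ioo (x₀ - r) (x₀ + r)) := by
    intro k
    induction k with
    | zero =>
      simp only [Nat.cast_zero, contDiffOn_zero]
      exact ⟨fun x hx => (hy x (hI'J hx)).continuousAt.continuousWithinAt,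
        fun x hx => (hz x (hI'J hx)).continuousAt.continuousWithinAt⟩
    | succ k ih =>
      have hqk : ContDiffOn ℝ k q (Ioo (x₀ - r) (x₀ + r)) :=
        contDiffOn_infty.1 (hq.mono hI'I) k
      push_cast
      rw [contDiffOn_succ_iff_deriv_of_isOpen isOpen_Ioo,
        contDiffOn_succ_iff_deriv_of_isOpen isOpen_Ioo]
      exact ⟨⟨fun x hx => (hy x (hI'J hx)).differentiableAt.differentiableWithinAt, by simp,
          ih.2.congr fun x hx => (hy x (hI'J hx)).deriv⟩,
        ⟨fun x hx => (hz x (hI'J hx)).differentiableAt.differentiableWithinAt, by simp,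
          (hqk.mul ih.1).congr fun x hx => (hz x (hI'J hx)).deriv⟩⟩
  refine ⟨Ioo (x₀ - r) (x₀ + r), fun x => (α x).2.1, ⟨isOpen_Ioo, ordConnected_Ioo,
    ⟨x₀, by simp [hr]⟩⟩, hI'I, by simp [hr], contDiffOn_infty.2 fun k => (reg k).1,
    fun x hx => ⟨(hball hx).2, ?_⟩⟩
  have e : deriv (fun x => (α x).2.1) =ᶠ[𝓝 x] fun x => (α x).2.2 := by
    filter_upwards [isOpen_Ioo.mem_nhds hx] with z hz' using (hy z (hI'J hz')).deriv
  rw [e.deriv_eq]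
  exact (hz x (hI'J hx)).deriv

/-- With `δ₃ = 1` and `y = φ_x^{-1/2}`, the new `h` is `y^4 h + y^3 y''/n`, which vanishes when `y''
= -n h y`. The gauge is local because it needs a solution `y` without zeros. -/
theorem exists_gauge_h_eq_zero {I : Set ℝ} (hI : IsOpenInterval I) {f h : ℝ → ℝ} {n : ℝ}
    (hcl : InClass I f h n) {x₀ : ℝ} (hx₀ : x₀ ∈ I) :
    ∃ I' : Set ℝ, IsOpenInterval I' ∧ I' ⊆ I ∧ x₀ ∈ I' ∧
        ∃ (Φ : Joint → Joint) (f' : ℝ → ℝ), IsExplicit I' Φ ∧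
          MapsEquation (univ ×ˢ I' ×ˢ univ) Φ f h n f' (fun _ => 0) n := by
  obtain ⟨hn, hf, hh, hf0⟩ := hcl
  obtain ⟨I', y, hI', hsub, hx₀', ys, hy⟩ := exists_positive_solution hI.1
    (q := fun x => -n * h x) (contDiffOn_const.mul hh) hx₀
  have y0 : ∀ x ∈ I', |y x| ^ (-2 : ℝ) ≠ 0 := fun x hx =>
    (Real.rpow_pos_of_pos (abs_pos.2 (hy x hx).1.ne') _).ne'
  obtain ⟨φ, φs, hφ⟩ := hI'.exists_antiderivative
    (contDiffOn_rpow_abs ys (fun x hx => (hy x hx).1.ne') (-2))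
  have hd : ∀ x ∈ I', deriv φ x = y x ^ (-2 : ℝ) := fun x hx => by
    rw [(hφ x hx).deriv, abs_of_pos (hy x hx).1]
  have dφ : ∀ x ∈ I', deriv φ x ≠ 0 := fun x hx => by rw [(hφ x hx).deriv]; exact y0 x hx
  have had : AdmissibleParams I' 1 1 1 φ := ⟨one_pos, one_ne_zero, one_ne_zero, φs, dφ⟩
  have φ1 := φs.deriv_smooth hI'.1
  have hpow : ∀ x ∈ I', ∀ a : ℝ, |deriv φ x| ^ a = y x ^ (-2 * a) := by
    intro x hx a
    have hp := (hy x hx).1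
    rw [hd x hx, abs_of_pos (Real.rpow_pos_of_pos hp _), ← Real.rpow_mul hp.le]
  obtain ⟨f', hf's, hf'⟩ := exists_smooth_factor hI' φs dφ
    ((contDiffOn_const (c := (1:ℝ) * 1)).mul (contDiffOn_rpow_abs φ1 dφ (-(3 / 2))) |>.mul
      (hf.mono hsub))
  refine ⟨I', hI', hsub, hx₀', explicitTransf 1 1 0 1 φ, f', ⟨_, _, _, _, _, had, fun _ _ => rfl⟩, ?_⟩
  have := mapsEquation_of_explicit (h' := fun _ => 0) isOpen_univ hI' isOpen_univ
    ⟨hn, hf.mono hsub, hh.mono hsub, fun x hx => hf0 x (hsub hx)⟩ had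
    (Φ := explicitTransf 1 1 0 1 φ) (fun _ _ _ _ _ _ => rfl) hf's contDiffOn_const hf' ?_
  · rwa [div_one] at this
  · intro x hx
    have hp := (hy x hx).1
    have e : (fun z => |deriv φ z| ^ (-(1 / 2) : ℝ)) =ᶠ[𝓝 x] y := by
      filter_upwards [hI'.1.mem_nhds hx] with z hz
      rw [hpow z hz]
      norm_num
    rw [e.iteratedDeriv_eq, iteratedDeriv_succ, iteratedDeriv_one, (hy x hx).2, hpow x hx, hd x hx]
    have e1 : y x ^ (-2 * -(3 / 2) : ℝ) = y x ^ 3 := by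
      rw [show (-2 * -(3 / 2) : ℝ) = (3 : ℕ) by norm_num, Real.rpow_natCast]
    have e2 : (y x ^ (-2 : ℝ)) ^ (-2 : ℤ) = y x ^ 4 := by
      rw [← Real.rpow_intCast, ← Real.rpow_mul hp.le,
        show (-2 * ((-2 : ℤ) : ℝ) : ℝ) = (4 : ℕ) by norm_num, Real.rpow_natCast]
    rw [e1, e2]
    field_simp
    ring

theorem theorem4 :
    -- the generalized equivalence transformations are exactly the transformations of the given form
    (∀ (D : Box) (Φ : Joint → Joint), IsGeneralizedEquivalence D Φ ↔ HasExplicitForm D Φ) ∧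
    -- the explicit family contains generalized equivalence transformations only
    (∀ (I : Set ℝ) (Φ : Joint → Joint), IsOpenInterval I → IsExplicit I Φ →
      ∀ D : Box, D.toSet ⊆ jointOver I → IsGeneralizedEquivalence D Φ) ∧
    -- the explicit family is a (pseudo)group: identity, compositions, inverses
    (∀ I : Set ℝ, IsOpenInterval I → IsExplicit I id) ∧
    (∀ (I J : Set ℝ) (Φ Ψ : Joint → Joint), IsOpenInterval I → IsOpenInterval J →
      IsExplicit I Φ → IsExplicit J Ψ → MapsTo Φ (jointOver I) (jointOver J) →
      IsExplicit I (Ψ ∘ Φ)) ∧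
    (∀ (I : Set ℝ) (Φ : Joint → Joint), IsOpenInterval I → IsExplicit I Φ →
      ∃ (J : Set ℝ) (Ψ : Joint → Joint), IsOpenInterval J ∧ IsExplicit J Ψ ∧
        MapsTo Φ (jointOver I) (jointOver J) ∧ MapsTo Ψ (jointOver J) (jointOver I) ∧
        InvOn Ψ Φ (jointOver I) (jointOver J)) ∧
    -- the gauge `f = 1`
    (∀ (I : Set ℝ) (f h : ℝ → ℝ) (n : ℝ), IsOpenInterval I → InClass I f h n →
      ∃ (Φ : Joint → Joint) (h' : ℝ → ℝ), IsExplicit I Φ ∧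
        MapsEquation (univ ×ˢ I ×ˢ univ) Φ f h n (fun _ => 1) h' n) ∧
    -- the gauge `h = 0`, in a neighbourhood of any given value of `x`
    (∀ (I : Set ℝ) (f h : ℝ → ℝ) (n : ℝ), IsOpenInterval I → InClass I f h n →
      ∀ x₀ ∈ I, ∃ I' : Set ℝ, IsOpenInterval I' ∧ I' ⊆ I ∧ x₀ ∈ I' ∧
        ∃ (Φ : Joint → Joint) (f' : ℝ → ℝ), IsExplicit I' Φ ∧
          MapsEquation (univ ×ˢ I' ×ˢ univ) Φ f h n f' (fun _ => 0) n) := by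
  exact ⟨fun D Φ => ⟨fun hΦ => hΦ.hasExplicitForm, fun hΦ => hΦ.isGeneralizedEquivalence⟩,
    fun I Φ _ hΦ D hD => hΦ.isGeneralizedEquivalence hD,
    fun I hI => isExplicit_id hI,
    fun I J Φ Ψ hI hJ hΦ hΨ hm => hΦ.comp hI hJ hΨ hm,
    fun I Φ hI hΦ => hΦ.exists_inverse hI,
    fun I f h n hI hcl => exists_gauge_f_eq_one hI hcl,
    fun I f h n hI hcl x₀ hx₀ => exists_gauge_h_eq_zero hI hcl hx₀⟩
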